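/- Let $M\ge 1$, let $g_{D,j},g_{I,j}\in\mathbb C$ for $1\le j\le M$, and let $\mathbf S=(S_1,\dots,S_M)$ be a random vector in $\{0,1\}^M$ with an arbitrary joint law such that $\mathbb P(S_j=1)=p$ for every $j$. Consider the two-user Gaussian bursty interference channel with output feedback $$y^{(i)}_j[t]=g_{D,j}\,x^{(i)}_j[t]+S_j[t]\,g_{I,j}\,x^{(i')}_j[t]+z^{(i)}_j[t],\qquad \{i,i'\}=\{1,2\},\ 1\le j\le M,\ 1\le t\le N,$$ where the vectors $\mathbf S[t]=(S_1[t],\dots,S_M[t])$ are i.i.d. copies of $\mathbf S$, the noises $z^{(i)}_j[t]$ are i.i.d. $\mathcal{CN}(0,1)$ over $i$, $j$ and $t$, and the messages $W^{(1)},W^{(2)}$ are independent and uniform on finite sets; messages, states and noises are independent. The inputs $(x^{(i)}_j[t])_{j}$ of transmitter $i$ at time $t$ are a measurable function of $W^{(i)}$ and of the past outputs $y^{(i)}_j[r]$ and states $S_j[r]$ ($r<t$, all $j$), and satisfy $\frac1N\sum_{t=1}^N|x^{(i)}_j[t]|^2\le 1$ almost surely for each $i,j$. Receiver $i$ estimates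 $W^{(i)}$ by a measurable function of all its outputs $y^{(i)}_j[t]$ and all states $S_j[t]$. All logarithms are to a fixed base $b>1$. A pair $(R^{(1)},R^{(2)})$ is achievable if there are such codes, for all block lengths $N$, in which $W^{(i)}$ takes at least $b^{N(R^{(i)}-o(1))}$ values and the decoding error probability of each receiver tends to $0$ as $N\to\infty$. Put $$\Delta_G=\sum_{j=1}^M\left[\log\left(1+(|g_{D,j}|+|g_{I,j}|)^2\right)+\log\left(1+\frac{|g_{D,j}|^2}{1+|g_{I,j}|^2}\right)-2\log\left(1+|g_{D,j}|^2\right)\right].$$ Then every achievable pair $(R^{(1)},R^{(2)})$ satisfies, for $i,i'\in\{1,2\}$ with $i\ne i'$, $$R^{(i)}\le\sum_{j=1}^M\left[(1-p)\log\left(1+|g_{D,j}|^2\right)+p\log\left(1+|g_{D,j}|^2+|g_{I,j}|^2\right)\right],$$ $$R^{(i)}+pR^{(i')}\le p\,\Delta_G+(1+p)\sum_{j=1}^M\log\left(1+|g_{D,j}|^2\right),$$ $$R^{(i)}+R^{(i')}\le p\,\Delta_G+2\sum_{j=1}^M\log\left(1+|g_{D,j}|^2\right).$$ -/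

import Mathlib

open MeasureTheory ProbabilityTheory Filter Topology

noncomputable section

namespace BurstyIC

/-- The circularly symmetric complex Gaussian law `CN(0,1)`: independent real and imaginary parts,
each centred Gaussian of variance `1/2`. -/
def stdComplexGaussian : Measure ℂ :=
  ((gaussianReal 0 (1 / 2)).prod (gaussianReal 0 (1 / 2))).map Complex.measurableEquivRealProd.symm

/-- The law of the interference-state vector has Bernoulli marginals with the same mean `p` in
every subcarrier; the joint law is otherwise arbitrary. -/
def HasMarginals {M : ℕ} (ν : Measure (Fin M → Bool)) (p : ℝ) : Prop :=
  ∀ j, ν.real {s | s j = true} = p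

/-- A block code of length `N` over `M` subcarriers, with `m i` messages for user `i`.
The encoder of user `i` at time `t` sees its own message and the feedback from its own receiver,
that is, the outputs of that receiver and the interference states at the times before `t`.
The decoder of user `i` sees all `N` outputs of its receiver and all interference states. -/
structure Code (M N : ℕ) (m : Fin 2 → ℕ) where
  enc : (i : Fin 2) → (t : Fin N) → Fin (m i) →
    (Fin t → Fin M → ℂ) × (Fin t → Fin M → Bool) → Fin M → ℂ
  measurable_enc : ∀ i t w, Measurable (enc i t w)
  dec : (i : Fin 2) → (Fin N → Fin M → ℂ) × (Fin N → Fin M → Bool) → Fin (m i)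
  measurable_dec : ∀ i, Measurable (dec i)

/-- The pairs of messages. -/
abbrev Messages (m : Fin 2 → ℕ) : Type := (i : Fin 2) → Fin (m i)

/-- The interference states `s t j`, at time `t` in subcarrier `j`. -/
abbrev States (M N : ℕ) : Type := Fin N → Fin M → Bool

/-- The noises `z t i j`, at time `t` at receiver `i` in subcarrier `j`. -/
abbrev Noises (M N : ℕ) : Type := Fin N → Fin 2 → Fin M → ℂ

/-- The outcomes of one use of the code: messages, states and noises. -/
abbrev Outcome (M N : ℕ) (m : Fin 2 → ℕ) : Type := Messages m × States M N × Noises M N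

/-- The messages are independent and uniform, the state vectors are i.i.d. over time with law `ν`,
the noises are i.i.d. `CN(0,1)` over time, receivers and subcarriers, and the three are
independent. -/
def law {M : ℕ} (ν : Measure (Fin M → Bool)) (N : ℕ) (m : Fin 2 → ℕ) :
    Measure (Outcome M N m) :=
  (uniformOn Set.univ).prod
    ((Measure.pi fun _ => ν).prod
      (Measure.pi fun _ => Measure.pi fun _ => Measure.pi fun _ => stdComplexGaussian))

/-- The other user. -/
def other (i : Fin 2) : Fin 2 := 1 - i

variable {M N : ℕ} {m : Fin 2 → ℕ}

/-- The signal that receiver `i` gets at time `t` in subcarrier `j`: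
`y = gD * x + S * gI * x' + z`, where `x` and `x'` are sent by the transmitters `i` and `other i`,
each computed from its own message and its own feedback from the times before `t`. -/
def Code.output (c : Code M N m) (gD gI : Fin M → ℂ) (ω : Outcome M N m) (t : Fin N) (i : Fin 2)
    (j : Fin M) : ℂ :=
  gD j * c.enc i t (ω.1 i)
      (fun r => c.output gD gI ω ⟨r, r.2.trans t.2⟩ i, fun r => ω.2.1 ⟨r, r.2.trans t.2⟩) j
    + (if ω.2.1 t j then 1 else 0) * gI j * c.enc (other i) t (ω.1 (other i))
      (fun r => c.output gD gI ω ⟨r, r.2.trans t.2⟩ (other i),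
        fun r => ω.2.1 ⟨r, r.2.trans t.2⟩) j
    + ω.2.2 t i j
  termination_by t.1
  decreasing_by all_goals exact r.2

/-- The signal that transmitter `i` sends at time `t` in subcarrier `j`. -/
def Code.input (c : Code M N m) (gD gI : Fin M → ℂ) (ω : Outcome M N m) (t : Fin N) (i : Fin 2)
    (j : Fin M) : ℂ :=
  c.enc i t (ω.1 i)
    (fun r => c.output gD gI ω ⟨r, r.2.trans t.2⟩ i, fun r => ω.2.1 ⟨r, r.2.trans t.2⟩) j

/-- Unit average power, over the block, in every subcarrier of every transmitter. -/
def Code.PowerConstraint (c : Code M N m) (gD gI : Fin M → ℂ) (ν : Measure (Fin M → Bool)) :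
    Prop :=
  ∀ᵐ ω ∂(law ν N m), ∀ i j, (1 / (N : ℝ)) * ∑ t, ‖c.input gD gI ω t i j‖ ^ 2 ≤ 1

/-- The probability that receiver `i` decodes its message wrongly. -/
def Code.errorProb (c : Code M N m) (gD gI : Fin M → ℂ) (ν : Measure (Fin M → Bool))
    (i : Fin 2) : ℝ :=
  (law ν N m).real {ω | c.dec i (fun t => c.output gD gI ω t i, ω.2.1) ≠ ω.1 i}

/-- The pair of rates `R`, in units of `log_b`, is achievable: there are codes for the block lengths
`N = 0, 1, 2, ...` that respect the power constraint, have at least `b ^ (N * (R i - o(1)))`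
messages for user `i`, and error probabilities that tend to `0`. -/
def Achievable (b : ℝ) (gD gI : Fin M → ℂ) (ν : Measure (Fin M → Bool)) (R : Fin 2 → ℝ) : Prop :=
  ∃ (m : ℕ → Fin 2 → ℕ) (c : (N : ℕ) → Code M N (m N)),
    (∀ N, (c N).PowerConstraint gD gI ν) ∧
    (∀ i, ∀ ε > (0 : ℝ), ∀ᶠ N : ℕ in atTop, b ^ ((N : ℝ) * (R i - ε)) ≤ (m N i : ℝ)) ∧
    (∀ i, Tendsto (fun N => (c N).errorProb gD gI ν i) atTop (𝓝 0))

/-- The quantity `Δ_G`, with logarithms to the base `b`. -/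
def deltaG (b : ℝ) (gD gI : Fin M → ℂ) : ℝ :=
  ∑ j, (Real.logb b (1 + (‖gD j‖ + ‖gI j‖) ^ 2)
    + Real.logb b (1 + ‖gD j‖ ^ 2 / (1 + ‖gI j‖ ^ 2))
    - 2 * Real.logb b (1 + ‖gD j‖ ^ 2))

end BurstyIC

end

/-! The proof rests on one change of measure. Let `P` be the law of messages, states and outputs.
Let `Q` be another measure of mass at most one under which the message to be decoded is independent
of what its decoder sees; then the decoder succeeds with `Q`-mass at most `1 / m`. With `ℓ = log
dQ/dP`, the inequality `x + 1 ≤ exp x` yields `P(correct) log m ≤ 1 - E ℓ`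
(`measureReal_mul_log_add_integral_le`). This replaces Fano's inequality and all manipulation of
differential entropies. Where `Q` is Gaussian, `-E ℓ` is a sum of second-moment costs, and the power
constraint bounds the cost of a residual under variance `v` by `log v` per channel use
(`sum_integral_cost_le`).

Feedback is harmless: with messages and states fixed, inputs depend on past outputs only, so the
outputs are a triangular translation of the noises. Hence they have a density, a product of unit
Gaussians centred at `drift` (`lintegral_comp_extOutput`).

Fix a user `a` with input `x`, and let `x'` be the input of the other user. The channel is enlarged
by fictitious observations. Field `0` carries `gI x' + u`, plus `gD x` when interference is present:
in that case it is the output of receiver `a`, otherwise an extra observation. Once `x` is known it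
amounts to the same variable `V = gI x' + u` in both states. Field `1` is the output of receiver `a`
without interference, and pure noise otherwise. Field `2` is the output of the other receiver.

The bounds come from choices of `Q`. Single rate: receiver `a` is given the other message and the
other output. The other output costs `1 + |gI|²`, and linear estimation from it leaves `1 + |gD|² /
(1 + |gI|²)` for the own output; the product is `1 + |gD|² + |gI|²`. Sum rate: the own output is
Gaussian and free of messages. Given it and the message of `a`, the other output has variance
`varCond` if interference reveals `V`, and `varDirect` if not. Weighted rate: the `Q` for user `a`
costs `varSum` or `varDirect`, less the information that `V` gives on the other message at
interfered times. The `Q` for the other user supplies `V` at all times, so it costs `varCond` plus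
that same information at all times. The information term is free of the current state
(`stateFree_crossLogRatio`), so it has weight `p` in the first bound and `1` in the second. Adding
`p` times the second to the first cancels it, without any estimate of the mixture density.

Costs add up over subcarriers, so only the marginals of the state law matter. Truncating inputs that
exceed the block power makes everything integrable and changes nothing almost surely; division by
`N` and a limit finish the proof. -/

open MeasureTheory ProbabilityTheory Filter Topology

noncomputable section

namespace BurstyIC

open scoped ENNReal Finset

variable {M N : ℕ} {m : Fin 2 → ℕ}

/-! ### Sequential integration and triangular translations -/

section Marginals

variable {ι : Type*} [DecidableEq ι] {E : Type*}

/-- The function `f` of a family does not depend on the coordinate `k`. -/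
def Ignores {β : Type*} (f : (ι → E) → β) (k : ι) : Prop :=
  ∀ x v, f (Function.update x k v) = f x

variable [MeasureSpace E] [SigmaFinite (volume : Measure E)]

/-- Integrating a product of conditional (sub)densities in sequential order gives at most `1`. -/
theorem lmarginal_mul_prod_le (B : Finset ι) (r : ι → ℕ) (h : (ι → E) → ℝ≥0∞)
    (f : ι → (ι → E) → ℝ≥0∞) (hm : Measurable h) (fm : ∀ k ∈ B, Measurable (f k))
    (hh : ∀ k ∈ B, Ignores h k)
    (hf : ∀ k ∈ B, ∀ k' ∈ B, k' ≠ k → r k ≤ r k' → Ignores (f k) k')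
    (hint : ∀ k ∈ B, ∀ x, ∫⁻ v, f k (Function.update x k v) ≤ 1) :
    (∫⋯∫⁻_B, (fun x => h x * ∏ k ∈ B, f k x)) ≤ h := by
  induction B using Finset.induction_on_max_value r with
  | empty => simp
  | insert a s ha hr ih =>
    have hm' : Measurable (fun x => h x * ∏ k ∈ insert a s, f k x) :=
      hm.mul (Finset.measurable_fun_prod _ fun k hk => fm k hk)
    -- The coordinate of highest rank is integrated innermost, since no other factor reads it.
    rw [lmarginal_insert' _ hm' ha]
    refine le_trans (lmarginal_mono (g := fun x => h x * ∏ k ∈ s, f k x) ?_)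
      (ih (fun k hk => fm k (by simp [hk])) (fun k hk => hh k (by simp [hk]))
        (fun k hk k' hk' => hf k (by simp [hk]) k' (by simp [hk']))
        (fun k hk => hint k (by simp [hk])))
    intro x
    have key : ∀ v, h (Function.update x a v) * ∏ k ∈ insert a s, f k (Function.update x a v)
        = (h x * ∏ k ∈ s, f k x) * f a (Function.update x a v) := by
      intro v
      rw [Finset.prod_insert ha, hh a (by simp) x v, Finset.prod_congr rfl (g := fun k => f k x)]
      · ring
      · intro k hk
        exact hf k (by simp [hk]) a (by simp) (by rintro rfl; exact ha hk) (hr k hk) x v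
    simp only [key]
    have hfa : Measurable fun v => f a (Function.update x a v) :=
      (fm a (by simp)).comp (measurable_update x)
    rw [lintegral_const_mul _ hfa]
    exact mul_le_of_le_one_right' (hint a (by simp) x)

theorem lmarginal_prod_le_one (B : Finset ι) (r : ι → ℕ)
    (f : ι → (ι → E) → ℝ≥0∞) (fm : ∀ k ∈ B, Measurable (f k))
    (hf : ∀ k ∈ B, ∀ k' ∈ B, k' ≠ k → r k ≤ r k' → Ignores (f k) k')
    (hint : ∀ k ∈ B, ∀ x, ∫⁻ v, f k (Function.update x k v) ≤ 1) (x : ι → E) :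
    (∫⋯∫⁻_B, (fun x => ∏ k ∈ B, f k x)) x ≤ 1 := by
  have := lmarginal_mul_prod_le B r (fun _ => 1) f measurable_const fm (fun _ _ _ _ => rfl) hf hint
    x
  simpa using this

variable [Fintype ι]

theorem lintegral_prod_le_one (r : ι → ℕ)
    (f : ι → (ι → E) → ℝ≥0∞) (fm : ∀ k, Measurable (f k))
    (hf : ∀ k k', k' ≠ k → r k ≤ r k' → Ignores (f k) k')
    (hint : ∀ k x, ∫⁻ v, f k (Function.update x k v) ≤ 1) :
    ∫⁻ x, ∏ k, f k x ≤ 1 := by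
  rcases isEmpty_or_nonempty (ι → E) with he | ⟨⟨x⟩⟩
  · simp
  · have := lmarginal_prod_le_one Finset.univ r f (fun k _ => fm k)
      (fun k _ k' _ => hf k k') (fun k _ => hint k) x
    rwa [lmarginal_univ] at this

variable [AddGroup E] [MeasurableAdd₂ E] [MeasurableNeg E]
  [(volume : Measure E).IsAddRightInvariant]

/-- Translating one coordinate by an amount that depends on the others preserves volume. -/
theorem measurePreserving_shear (k : ι) (g : (ι → E) → E) (gm : Measurable g) (hg : Ignores g k) :
    MeasurePreserving (fun x : ι → E => Function.update x k (x k - g x)) := by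
  have hmeas : Measurable (fun x : ι → E => Function.update x k (x k - g x)) := by
    refine measurable_pi_lambda _ fun i => ?_
    by_cases hi : i = k
    · subst hi; simp only [Function.update_self]; exact (measurable_pi_apply i).sub gm
    · simpa [Function.update_of_ne hi] using measurable_pi_apply i
  refine ⟨hmeas, Measure.ext_of_lintegral _ fun f fm => ?_⟩
  rw [lintegral_map fm hmeas]
  refine lintegral_eq_of_lmarginal_eq {k} (fm.comp hmeas) fm ?_
  rw [lmarginal_singleton, lmarginal_singleton]
  funext x
  simp only [Function.update_self, Function.update_idem, hg x]
  exact lintegral_sub_right_eq_self (fun v => f (Function.update x k v)) (g x)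

/-- A triangular system of translations preserves volume. -/
theorem measurePreserving_triangular (r : ι → ℕ) (g : ι → (ι → E) → E)
    (gm : ∀ k, Measurable (g k)) (hg : ∀ k k', r k ≤ r k' → Ignores (g k) k') :
    MeasurePreserving (fun (x : ι → E) k => x k - g k x) := by
  have key : ∀ s : Finset ι,
      MeasurePreserving (fun (x : ι → E) k => if k ∈ s then x k - g k x else x k) := by
    intro s
    induction s using Finset.induction_on_max_value r with
    | empty => simpa using! MeasurePreserving.id (volume : Measure (ι → E))
    | insert a s ha hr ih =>
      -- The coordinate of highest rank is translated first; the remaining translations do not read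
      -- it.
      have := ih.comp (measurePreserving_shear a (g a) (gm a) (hg a a le_rfl))
      convert this using 1
      funext x k
      by_cases hk : k = a
      · subst hk; simp [ha]
      · by_cases hs : k ∈ s
        · simp [hk, hs, hg k a (hr k hs) x]
        · simp [hk, hs]
  simpa using key Finset.univ

end Marginals

/-! ### Product densities and the complex Gaussian law -/

/-- The product formula for densities on finite products. -/
theorem lmarginal_prod_apply {ι : Type*} [DecidableEq ι] {E : Type*} [MeasureSpace E]
    [SigmaFinite (volume : Measure E)] (s : Finset ι) (f : ι → E → ℝ≥0∞)
    (fm : ∀ k, Measurable (f k)) (x : ι → E) :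
    (∫⋯∫⁻_s, (fun x => ∏ k ∈ s, f k (x k))) x = ∏ k ∈ s, ∫⁻ v, f k v := by
  induction s using Finset.induction_on generalizing x with
  | empty => simp
  | insert a s ha ih =>
    have hm : Measurable fun x : ι → E => ∏ k ∈ insert a s, f k (x k) :=
      Finset.measurable_fun_prod _ fun k _ => (fm k).comp (measurable_pi_apply k)
    rw [lmarginal_insert _ hm ha, Finset.prod_insert ha, ← lintegral_mul_const _ (fm a)]
    refine lintegral_congr fun v => ?_
    rw [← ih (Function.update x a v)]
    simp only [lmarginal]
    have hm' : Measurable fun y : (i : s) → E =>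
        ∏ k ∈ s, f k (Function.updateFinset (Function.update x a v) s y k) :=
      Finset.measurable_fun_prod _ fun k _ => (fm k).comp <|
        show Measurable ((fun z : ι → E => z k) ∘ Function.updateFinset (Function.update x a v) s)
          from
          (measurable_pi_apply k).comp measurable_updateFinset
    rw [← lintegral_const_mul _ hm']
    refine lintegral_congr fun y => ?_
    rw [Finset.prod_insert ha]
    congr 2
    simp [Function.updateFinset, ha]

theorem pi_withDensity {ι : Type*} [Fintype ι] [DecidableEq ι] {E : Type*} [MeasureSpace E]
    [Nonempty E]
    [SigmaFinite (volume : Measure E)] (f : E → ℝ≥0∞) (fm : Measurable f)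
    [SigmaFinite ((volume : Measure E).withDensity f)] :
    Measure.pi (fun _ : ι => (volume : Measure E).withDensity f)
      = (volume : Measure (ι → E)).withDensity fun x => ∏ k, f (x k) := by
  refine Measure.pi_eq fun s hs => ?_
  rw [withDensity_apply _ (MeasurableSet.univ_pi hs), ← lintegral_indicator
    (MeasurableSet.univ_pi hs)]
  have h := lmarginal_prod_apply Finset.univ (fun k => (s k).indicator f)
    (fun k => fm.indicator (hs k)) (fun _ => Classical.arbitrary E)
  rw [lmarginal_univ] at h
  calc _ = ∫⁻ x : ι → E, ∏ k, (s k).indicator f (x k) := by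
        refine lintegral_congr fun x => ?_
        by_cases hx : x ∈ Set.univ.pi s
        · rw [Set.indicator_of_mem hx]
          exact Finset.prod_congr rfl fun k _ => (Set.indicator_of_mem (hx k trivial) _).symm
        · rw [Set.indicator_of_notMem hx]
          simp only [Set.mem_univ_pi, not_forall] at hx
          obtain ⟨k, hk⟩ := hx
          exact (Finset.prod_eq_zero (Finset.mem_univ k) (Set.indicator_of_notMem hk _)).symm
    _ = _ := h.trans (Finset.prod_congr rfl fun k _ => by
        rw [lintegral_indicator (hs k), withDensity_apply _ (hs k)])

/-- The density of the circularly symmetric complex Gaussian law of variance `v`. -/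
def gaussDensity (v : ℝ) (x : ℂ) : ℝ := (Real.pi * v)⁻¹ * Real.exp (-‖x‖ ^ 2 / v)

theorem gaussDensity_pos {v : ℝ} (hv : 0 < v) (x : ℂ) : 0 < gaussDensity v x := by
  have := Real.pi_pos
  unfold gaussDensity; positivity

@[fun_prop]
theorem continuous_gaussDensity (v : ℝ) : Continuous (gaussDensity v) := by
  unfold gaussDensity; fun_prop

@[fun_prop]
theorem measurable_gaussDensity (v : ℝ) : Measurable (gaussDensity v) :=
  (continuous_gaussDensity v).measurable

theorem log_gaussDensity {v : ℝ} (hv : 0 < v) (x : ℂ) :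
    Real.log (gaussDensity v x) = -Real.log Real.pi - Real.log v - ‖x‖ ^ 2 / v := by
  have := Real.pi_pos
  rw [gaussDensity, Real.log_mul (by positivity) (by positivity), Real.log_exp, Real.log_inv,
    Real.log_mul (by positivity) (by positivity)]
  ring

theorem ofReal_gaussDensity {v : ℝ} (hv : 0 < v) (p : ℝ × ℝ) :
    ENNReal.ofReal (gaussDensity v (Complex.measurableEquivRealProd.symm p))
      = gaussianPDF 0 (v / 2).toNNReal p.1 * gaussianPDF 0 (v / 2).toNNReal p.2 := by
  have hpi := Real.pi_pos
  simp only [gaussianPDF_def]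
  rw [← ENNReal.ofReal_mul (gaussianPDFReal_nonneg _ _ _)]
  congr 1
  have h1 : ‖Complex.measurableEquivRealProd.symm p‖ ^ 2 = p.1 ^ 2 + p.2 ^ 2 := by
    rw [Complex.measurableEquivRealProd_symm_apply, Complex.sq_norm, Complex.normSq_mk]; ring
  have h2 : 2 * Real.pi * (v / 2) = Real.pi * v := by ring
  simp only [gaussDensity, gaussianPDFReal, Real.coe_toNNReal _ (by positivity : 0 ≤ v / 2), h1, h2,
    sub_zero]
  rw [mul_mul_mul_comm, ← Real.exp_add, ← mul_inv, Real.mul_self_sqrt (by positivity)]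
  congr 2
  field_simp
  ring

theorem lintegral_gaussDensity {v : ℝ} (hv : 0 < v) :
    ∫⁻ x, ENNReal.ofReal (gaussDensity v x) = 1 := by
  have hm : Measurable fun x => ENNReal.ofReal (gaussDensity v x) := by fun_prop
  have hne : (v / 2).toNNReal ≠ 0 := by simpa using hv
  rw [← (Complex.volume_preserving_equiv_real_prod.symm).lintegral_comp hm]
  simp only [ofReal_gaussDensity hv]
  rw [Measure.volume_eq_prod, lintegral_prod_mul (measurable_gaussianPDF _ _).aemeasurable
    (measurable_gaussianPDF _ _).aemeasurable, lintegral_gaussianPDF_eq_one _ hne, one_mul]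

theorem lintegral_gaussDensity_sub {v : ℝ} (hv : 0 < v) (c : ℂ) :
    ∫⁻ x, ENNReal.ofReal (gaussDensity v (x - c)) = 1 := by
  rw [lintegral_sub_right_eq_self (fun x => ENNReal.ofReal (gaussDensity v x)) c,
    lintegral_gaussDensity hv]

instance : IsProbabilityMeasure stdComplexGaussian := by
  unfold stdComplexGaussian
  exact Measure.isProbabilityMeasure_map (by fun_prop)

theorem stdComplexGaussian_eq_withDensity :
    stdComplexGaussian = volume.withDensity fun x => ENNReal.ofReal (gaussDensity 1 x) := by
  have hne : (1 / 2 : NNReal) ≠ 0 := by norm_num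
  have hm : Measurable fun x => ENNReal.ofReal (gaussDensity 1 x) := by fun_prop
  have h12 : (1 / 2 : ℝ).toNNReal = 1 / 2 := by ext; simp
  refine Measure.ext_of_lintegral _ fun f fm => ?_
  rw [stdComplexGaussian, lintegral_map fm (by fun_prop), gaussianReal_of_var_ne_zero _ hne,
    prod_withDensity (measurable_gaussianPDF _ _) (measurable_gaussianPDF _ _),
    lintegral_withDensity_eq_lintegral_mul _ (by fun_prop) (by fun_prop),
    lintegral_withDensity_eq_lintegral_mul _ hm fm,
    ← (Complex.volume_preserving_equiv_real_prod.symm).lintegral_comp (hm.mul fm),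
    Measure.volume_eq_prod]
  refine lintegral_congr fun p => ?_
  simp only [Pi.mul_apply, ofReal_gaussDensity one_pos, h12]

theorem memLp_id_stdComplexGaussian : MemLp (fun z : ℂ => z) 2 stdComplexGaussian := by
  have h := memLp_id_gaussianReal' (μ := 0) (v := 1 / 2) 2 (by simp)
  rw [stdComplexGaussian, memLp_map_measure_iff (by fun_prop) (by fun_prop)]
  have h1 := (h.comp_measurePreserving (measurePreserving_fst
    (μ := gaussianReal 0 (1 / 2)) (ν := gaussianReal 0 (1 / 2)))).ofReal (K := ℂ)
  have h2 := (h.comp_measurePreserving (measurePreserving_snd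
    (μ := gaussianReal 0 (1 / 2)) (ν := gaussianReal 0 (1 / 2)))).ofReal (K := ℂ)
  convert h1.add (h2.mul_const Complex.I) using 1
  funext p
  simp [Complex.measurableEquivRealProd_symm_apply, Complex.mk_eq_add_mul_I]

theorem integral_id_stdComplexGaussian : ∫ z, z ∂stdComplexGaussian = 0 := by
  have h := memLp_id_gaussianReal' (μ := 0) (v := 1 / 2) 1 (by simp)
  rw [stdComplexGaussian, integral_map (by fun_prop) (by fun_prop)]
  have h1 : Integrable (fun p : ℝ × ℝ => (p.1 : ℂ))
      ((gaussianReal 0 (1 / 2)).prod (gaussianReal 0 (1 / 2))) :=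
    memLp_one_iff_integrable.1 (h.comp_measurePreserving measurePreserving_fst).ofReal
  have h2 : Integrable (fun p : ℝ × ℝ => (p.2 : ℂ))
      ((gaussianReal 0 (1 / 2)).prod (gaussianReal 0 (1 / 2))) :=
    memLp_one_iff_integrable.1 (h.comp_measurePreserving measurePreserving_snd).ofReal
  have hz : ∫ x : ℝ, (x : ℂ) ∂(gaussianReal 0 (1 / 2)) = 0 := by
    have := integral_ofReal (𝕜 := ℂ) (μ := gaussianReal 0 (1 / 2)) (f := fun x : ℝ => x)
    rw [integral_id_gaussianReal] at this
    simpa using this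
  simp only [Complex.measurableEquivRealProd_symm_apply, Complex.mk_eq_add_mul_I]
  rw [integral_add h1 (h2.mul_const _), integral_mul_const,
    integral_fun_fst (fun x : ℝ => (x : ℂ)), integral_fun_snd (fun x : ℝ => (x : ℂ)), hz]
  simp

theorem integral_sq_gaussianReal : ∫ x, x ^ 2 ∂(gaussianReal 0 (1 / 2)) = 1 / 2 := by
  have h := variance_fun_id_gaussianReal (μ := 0) (v := 1 / 2)
  rw [variance_of_integral_eq_zero (by fun_prop) integral_id_gaussianReal] at h
  simpa using h

theorem integral_norm_sq_stdComplexGaussian : ∫ z, ‖z‖ ^ 2 ∂stdComplexGaussian = 1 := by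
  have h := (memLp_id_gaussianReal' (μ := 0) (v := 1 / 2) 2 (by simp))
  rw [stdComplexGaussian, integral_map (by fun_prop) (by fun_prop)]
  have h1 : Integrable (fun p : ℝ × ℝ => p.1 ^ 2)
      ((gaussianReal 0 (1 / 2)).prod (gaussianReal 0 (1 / 2))) :=
    (h.comp_measurePreserving measurePreserving_fst).integrable_sq
  have h2 : Integrable (fun p : ℝ × ℝ => p.2 ^ 2)
      ((gaussianReal 0 (1 / 2)).prod (gaussianReal 0 (1 / 2))) :=
    (h.comp_measurePreserving measurePreserving_snd).integrable_sq
  have hn : ∀ p, ‖Complex.measurableEquivRealProd.symm p‖ ^ 2 = p.1 ^ 2 + p.2 ^ 2 := by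
    intro p
    rw [Complex.measurableEquivRealProd_symm_apply, Complex.sq_norm, Complex.normSq_mk]; ring
  simp only [hn]
  rw [integral_add h1 h2, integral_fun_fst (fun x : ℝ => x ^ 2),
    integral_fun_snd (fun x : ℝ => x ^ 2), integral_sq_gaussianReal]
  norm_num

/-! ### Change of measure and resampling -/

/-- The data-processing bound behind every converse: if the change of measure `exp ℓ` has total mass
at most `1` and gives the event `C` mass at most `1 / m`, then `P(C) log m ≤ 1 - E ℓ`. -/
theorem measureReal_mul_log_add_integral_le {Ω : Type*} [MeasurableSpace Ω] (P : Measure Ω)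
    [IsProbabilityMeasure P] (ℓ : Ω → ℝ) (hℓ : Integrable ℓ P) {C : Set Ω} (hC : MeasurableSet C)
    {m : ℝ} (hm : 0 < m) (h1 : ∫⁻ ω, ENNReal.ofReal (Real.exp (ℓ ω)) ∂P ≤ 1)
    (h2 : ∫⁻ ω, C.indicator 1 ω * ENNReal.ofReal (Real.exp (ℓ ω)) ∂P ≤ ENNReal.ofReal m⁻¹) :
    P.real C * Real.log m + ∫ ω, ℓ ω ∂P ≤ 1 := by
  have hem : AEStronglyMeasurable (fun ω => Real.exp (ℓ ω)) P :=
    Real.continuous_exp.comp_aestronglyMeasurable hℓ.1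
  have hei : Integrable (fun ω => Real.exp (ℓ ω)) P := by
    refine ⟨hem, ?_⟩
    rw [hasFiniteIntegral_iff_ofReal (ae_of_all _ fun ω => (Real.exp_pos _).le)]
    exact h1.trans_lt ENNReal.one_lt_top
  have hI1 : ∫ ω, Real.exp (ℓ ω) ∂P ≤ 1 := by
    rw [integral_eq_lintegral_of_nonneg_ae (ae_of_all _ fun ω => (Real.exp_pos _).le) hem]
    exact ENNReal.toReal_mono ENNReal.one_ne_top h1
  have hI2 : ∫ ω, C.indicator (fun ω => Real.exp (ℓ ω)) ω ∂P ≤ m⁻¹ := by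
    rw [integral_eq_lintegral_of_nonneg_ae
      (ae_of_all _ fun ω => Set.indicator_nonneg (fun _ _ => (Real.exp_pos _).le) _)
      (hem.indicator hC)]
    refine ENNReal.toReal_le_of_le_ofReal (by positivity) (le_trans (le_of_eq ?_) h2)
    refine lintegral_congr fun ω => ?_
    by_cases hω : ω ∈ C <;> simp [hω]
  have hCi : Integrable (C.indicator fun _ => Real.log m) P := (integrable_const _).indicator hC
  have hCe : Integrable (C.indicator fun ω => Real.exp (ℓ ω)) P := hei.indicator hC
  -- On `C` this is `x + 1 ≤ exp x` at `x = log m + ℓ`, elsewhere at `x = ℓ`. After integration the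
  -- right side is at most `1 + 1 - 1`.
  have hle : ∀ ω, C.indicator (fun _ => Real.log m) ω + ℓ ω
      ≤ Real.exp (ℓ ω) + m * C.indicator (fun ω => Real.exp (ℓ ω)) ω - 1 := by
    intro ω
    have he := Real.exp_pos (ℓ ω)
    by_cases hω : ω ∈ C
    · have := Real.add_one_le_exp (Real.log m + ℓ ω)
      rw [Real.exp_add, Real.exp_log hm] at this
      simp only [Set.indicator_of_mem hω]
      linarith
    · have := Real.add_one_le_exp (ℓ ω)
      simp only [Set.indicator_of_notMem hω]
      linarith
  have hei2 : Integrable (fun ω => Real.exp (ℓ ω) + m * C.indicator (fun ω => Real.exp (ℓ ω)) ω) P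
    :=
    hei.add (hCe.const_mul m)
  have := integral_mono (μ := P) (hCi.add hℓ) (hei2.sub (integrable_const 1)) hle
  rw [integral_add' hCi hℓ, integral_sub' hei2 (integrable_const 1),
    integral_add hei (hCe.const_mul m), integral_const_mul, integral_indicator_const _ hC] at this
  simp only [smul_eq_mul, integral_const, probReal_univ, one_mul] at this
  have h3 : m * ∫ ω, C.indicator (fun ω => Real.exp (ℓ ω)) ω ∂P ≤ 1 := by
    calc _ ≤ m * m⁻¹ := by gcongr
      _ = 1 := mul_inv_cancel₀ hm.ne'
  linarith

/-- Resampling one coordinate of a product law does not change it. -/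
theorem measurePreserving_update {ι : Type*} [Fintype ι] [DecidableEq ι] {X : ι → Type*}
    [∀ i, MeasurableSpace (X i)] (μ : ∀ i, Measure (X i)) [∀ i, IsProbabilityMeasure (μ i)] (k : ι)
      :
    MeasurePreserving (fun p : (∀ i, X i) × X k => Function.update p.1 k p.2)
      ((Measure.pi μ).prod (μ k)) (Measure.pi μ) := by
  have hm : Measurable (fun p : (∀ i, X i) × X k => Function.update p.1 k p.2) := by
    refine measurable_pi_lambda _ fun i => ?_
    by_cases hi : i = k
    · subst hi; simpa using measurable_snd
    · simp only [Function.update_of_ne hi]; fun_prop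
  refine ⟨hm, (Measure.pi_eq fun s hs => ?_).symm⟩
  rw [Measure.map_apply hm (MeasurableSet.univ_pi hs)]
  have : (fun p : (∀ i, X i) × X k => Function.update p.1 k p.2) ⁻¹' Set.univ.pi s
      = (Set.univ.pi (Function.update s k Set.univ)) ×ˢ s k := by
    ext p
    simp only [Set.mem_preimage, Set.mem_univ_pi, Set.mem_prod]
    constructor
    · intro h
      refine ⟨fun i => ?_, by simpa using h k⟩
      by_cases hi : i = k
      · subst hi; simp
      · simpa [hi] using h i
    · rintro ⟨h, hk⟩ i
      by_cases hi : i = k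
      · subst hi; simpa using hk
      · simpa [hi] using h i
  rw [this, Measure.prod_prod, Measure.pi_pi, ← Finset.mul_prod_erase _ _ (Finset.mem_univ k),
    ← Finset.mul_prod_erase _ _ (Finset.mem_univ k)]
  simp only [Function.update_self, measure_univ, one_mul, mul_comm (μ k (s k))]
  congr 1
  refine Finset.prod_congr rfl fun i hi => ?_
  rw [Function.update_of_ne (Finset.ne_of_mem_erase hi)]

/-! ### Conditional densities of a uniform mixture -/

section Mixture

variable {W ι E : Type*} [Fintype W] [Fintype ι]

/-- The total density, over the components `w` of a uniform mixture, of the coordinates whose rank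
is below `n`. -/
def prefixMass (φ : W → ι → (ι → E) → ℝ) (r : ι → ℕ) (n : ℕ) (x : ι → E) : ℝ :=
  ∑ w, ∏ k with r k < n, φ w k x

/-- The conditional density of the coordinate `k`, given the coordinates of lower rank, under the
uniform mixture of the laws with conditional densities `φ w`. -/
def mixDensity (φ : W → ι → (ι → E) → ℝ) (r : ι → ℕ) (k : ι) (x : ι → E) : ℝ :=
  prefixMass φ r (r k + 1) x / prefixMass φ r (r k) x

variable {φ : W → ι → (ι → E) → ℝ} {r : ι → ℕ}

theorem prefixMass_pos [Nonempty W] (hφ : ∀ w k x, 0 < φ w k x) (n : ℕ) (x : ι → E) :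
    0 < prefixMass φ r n x :=
  Finset.sum_pos (fun w _ => Finset.prod_pos fun k _ => hφ w k x) Finset.univ_nonempty

/-- Injectivity of the rank ensures that raising the threshold past `r k` admits the single
coordinate `k`. -/
theorem prefixMass_succ [DecidableEq ι] (hr : Function.Injective r) (k : ι) (x : ι → E) :
    prefixMass φ r (r k + 1) x = ∑ w, (∏ k' with r k' < r k, φ w k' x) * φ w k x := by
  refine Finset.sum_congr rfl fun w _ => ?_
  have : (Finset.univ.filter fun k' => r k' < r k + 1)
      = insert k (Finset.univ.filter fun k' => r k' < r k) := by
    ext k'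
    simp only [Finset.mem_filter, Finset.mem_univ, true_and, Finset.mem_insert]
    rw [Nat.lt_succ_iff_lt_or_eq, hr.eq_iff, or_comm]
  rw [this, Finset.prod_insert (by simp), mul_comm]

theorem mixDensity_pos [Nonempty W] (hφ : ∀ w k x, 0 < φ w k x) (k : ι) (x : ι → E) :
    0 < mixDensity φ r k x :=
  div_pos (prefixMass_pos hφ _ x) (prefixMass_pos hφ _ x)

/-- The chain rule for the mixture: ratios of consecutive prefix masses telescope from the empty
prefix, of mass `card W`, to the full sum. -/
theorem sum_prod_eq_card_mul_prod_mixDensity [Nonempty W] (hφ : ∀ w k x, 0 < φ w k x)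
    (hr : Function.Injective r) (x : ι → E) :
    ∑ w, ∏ k, φ w k x = Fintype.card W * ∏ k, mixDensity φ r k x := by
  obtain ⟨n, hn⟩ : ∃ n, ∀ k, r k < n :=
    ⟨∑ k, (r k + 1), fun k => Nat.lt_of_succ_le
      (Finset.single_le_sum (f := fun k => r k + 1) (fun _ _ => Nat.zero_le _) (Finset.mem_univ k))⟩
  have h0 : prefixMass φ r 0 x = Fintype.card W := by simp [prefixMass]
  have hN : prefixMass φ r n x = ∑ w, ∏ k, φ w k x := by
    simp [prefixMass, hn]
  have htel : ∀ n, ∏ i ∈ Finset.range n, prefixMass φ r (i + 1) x / prefixMass φ r i x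
      = prefixMass φ r n x / prefixMass φ r 0 x := by
    intro n
    induction n with
    | zero => simp [(prefixMass_pos (r := r) hφ 0 x).ne']
    | succ n ih =>
      rw [Finset.prod_range_succ, ih]
      have := (prefixMass_pos (r := r) hφ n x).ne'
      field_simp
  have hprod : ∏ k, mixDensity φ r k x
      = ∏ i ∈ Finset.range n, prefixMass φ r (i + 1) x / prefixMass φ r i x := by
    rw [← Finset.prod_subset (s₁ := Finset.univ.image r)]
    · rw [Finset.prod_image (fun _ _ _ _ h => hr h)]; rfl
    · intro i hi
      obtain ⟨k, -, rfl⟩ := Finset.mem_image.1 hi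
      exact Finset.mem_range.2 (hn k)
    -- A rank that no coordinate uses leaves the prefix mass unchanged, so its ratio is `1`.
    · intro i _ hi
      have : prefixMass φ r (i + 1) x = prefixMass φ r i x := by
        refine Finset.sum_congr rfl fun w _ => ?_
        congr 1
        ext k
        simp only [Finset.mem_filter, Finset.mem_univ, true_and]
        have : r k ≠ i := fun h => hi (Finset.mem_image.2 ⟨k, Finset.mem_univ k, h⟩)
        omega
      rw [this, div_self (prefixMass_pos hφ _ x).ne']
  rw [hprod, htel, hN, h0]
  have : (Fintype.card W : ℝ) ≠ 0 := by simp
  field_simp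

/-- The conditional density is a weighted average of the `φ w k x`, the weights being the posterior
masses of the components. It serves for integrability, and with `lo = hi` when all components agree.
-/
theorem mixDensity_mem_Icc [DecidableEq ι] [Nonempty W] (hφ : ∀ w k x, 0 < φ w k x)
    (hr : Function.Injective r)
    {k : ι} {x : ι → E} {lo hi : ℝ} (h : ∀ w, φ w k x ∈ Set.Icc lo hi) :
    mixDensity φ r k x ∈ Set.Icc lo hi := by
  have hpos := prefixMass_pos (r := r) hφ (r k) x
  have hc : ∀ w, 0 ≤ ∏ k' with r k' < r k, φ w k' x :=
    fun w => Finset.prod_nonneg fun k' _ => (hφ w k' x).le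
  rw [mixDensity, Set.mem_Icc, le_div_iff₀ hpos, div_le_iff₀ hpos, prefixMass_succ hr,
    prefixMass, Finset.mul_sum, Finset.mul_sum]
  refine ⟨Finset.sum_le_sum fun w _ => ?_, Finset.sum_le_sum fun w _ => ?_⟩
  · rw [mul_comm]; exact mul_le_mul_of_nonneg_left (h w).1 (hc w)
  · rw [mul_comm hi]; exact mul_le_mul_of_nonneg_left (h w).2 (hc w)

theorem mixDensity_congr {x x' : ι → E} {k : ι} {φ' : W → ι → (ι → E) → ℝ}
    (h : ∀ w k', r k' ≤ r k → φ w k' x = φ' w k' x') :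
    mixDensity φ r k x = mixDensity φ' r k x' := by
  unfold mixDensity prefixMass
  congr 1 <;>
  · refine Finset.sum_congr rfl fun w _ => Finset.prod_congr rfl fun k' hk' => h w k' ?_
    have := (Finset.mem_filter.1 hk').2
    omega

theorem Ignores.mixDensity [DecidableEq ι] {k j : ι} (h : ∀ w k', r k' ≤ r k → Ignores (φ w k') j) :
    Ignores (mixDensity φ r k) j :=
  fun x v => mixDensity_congr fun w k' hk' => h w k' hk' x v

theorem measurable_mixDensity [MeasurableSpace E] (hm : ∀ w k, Measurable (φ w k)) (k : ι) :
    Measurable (mixDensity φ r k) := by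
  refine Measurable.div ?_ ?_ <;>
  exact Finset.measurable_fun_sum _ fun w _ => Finset.measurable_fun_prod _ fun k _ => hm w k

/-- The posterior weights read only coordinates of lower rank, so integrating over coordinate `k`
averages integrals equal to one. -/
theorem lintegral_mixDensity [DecidableEq ι] [MeasureSpace E] [Nonempty W]
    (hφ : ∀ w k x, 0 < φ w k x)
    (hr : Function.Injective r) (hm : ∀ w k, Measurable (φ w k))
    (hign : ∀ w k k', k' ≠ k → r k ≤ r k' → Ignores (φ w k) k') {k : ι} {x : ι → E}
    (hint : ∀ w, ∫⁻ v, ENNReal.ofReal (φ w k (Function.update x k v)) = 1) :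
    ∫⁻ v, ENNReal.ofReal (mixDensity φ r k (Function.update x k v)) = 1 := by
  have hpos := prefixMass_pos (r := r) hφ (r k) x
  have hlow : ∀ w v k', r k' < r k → φ w k' (Function.update x k v) = φ w k' x :=
    fun w v k' hk' => hign w k' k (by rintro rfl; exact hk'.false) hk'.le x v
  have hden : ∀ v, prefixMass φ r (r k) (Function.update x k v) = prefixMass φ r (r k) x := by
    intro v
    exact Finset.sum_congr rfl fun w _ => Finset.prod_congr rfl fun k' hk' =>
      hlow w v k' (Finset.mem_filter.1 hk').2
  have hc : ∀ w, 0 ≤ (∏ k' with r k' < r k, φ w k' x) / prefixMass φ r (r k) x :=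
    fun w => div_nonneg (Finset.prod_nonneg fun k' _ => (hφ w k' x).le) hpos.le
  have heq : ∀ v, ENNReal.ofReal (mixDensity φ r k (Function.update x k v))
      = ∑ w, ENNReal.ofReal ((∏ k' with r k' < r k, φ w k' x) / prefixMass φ r (r k) x)
        * ENNReal.ofReal (φ w k (Function.update x k v)) := by
    intro v
    rw [BurstyIC.mixDensity, hden, prefixMass_succ hr, Finset.sum_div,
      ENNReal.ofReal_sum_of_nonneg fun w _ => div_nonneg (mul_nonneg
        (Finset.prod_nonneg fun k' _ => (hφ w k' _).le) (hφ w k _).le) hpos.le]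
    refine Finset.sum_congr rfl fun w _ => ?_
    rw [← ENNReal.ofReal_mul (hc w)]
    congr 1
    rw [Finset.prod_congr rfl fun k' hk' => hlow w v k' (Finset.mem_filter.1 hk').2]
    ring
  have hmw : ∀ w, Measurable fun v => ENNReal.ofReal (φ w k (Function.update x k v)) :=
    fun w => ENNReal.measurable_ofReal.comp ((hm w k).comp (measurable_update x))
  simp only [heq]
  rw [lintegral_finsetSum _ fun w _ => (hmw w).const_mul _]
  simp only [lintegral_const_mul _ (hmw _), hint, mul_one]
  rw [← ENNReal.ofReal_sum_of_nonneg fun w _ => hc w, ← Finset.sum_div]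
  change ENNReal.ofReal (prefixMass φ r (r k) x / prefixMass φ r (r k) x) = 1
  rw [div_self hpos.ne', ENNReal.ofReal_one]

end Mixture

/-! ### Extended noises and the law of the true channel noises -/

/-- A product law of identical factors is preserved by an injective reindexing. -/
theorem measurePreserving_comp_injective {ι κ E : Type*} [Fintype ι] [Fintype κ]
    [MeasurableSpace E] (μ : Measure E) [IsProbabilityMeasure μ] {e : κ → ι}
    (he : Function.Injective e) :
    MeasurePreserving (fun (x : ι → E) k => x (e k)) (Measure.pi fun _ => μ)
      (Measure.pi fun _ => μ) := by
  classical
  have hm : Measurable fun (x : ι → E) k => x (e k) := by fun_prop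
  refine ⟨hm, (Measure.pi_eq fun s hs => ?_).symm⟩
  rw [Measure.map_apply hm (MeasurableSet.univ_pi hs)]
  have : (fun (x : ι → E) k => x (e k)) ⁻¹' Set.univ.pi s
      = Set.univ.pi (Function.extend e s fun _ => Set.univ) := by
    ext x
    simp only [Set.mem_preimage, Set.mem_univ_pi]
    constructor
    · intro h i
      by_cases hi : ∃ k, e k = i
      · obtain ⟨k, rfl⟩ := hi
        rw [he.extend_apply]; exact h k
      · rw [Function.extend_apply' _ _ _ hi]; trivial
    · intro h k
      simpa [he.extend_apply] using h (e k)
  rw [this, Measure.pi_pi]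
  refine (Fintype.prod_of_injective e he _ _ (fun i hi => ?_) fun k => ?_).symm
  · rw [Function.extend_apply' _ _ _ hi, measure_univ]
  · rw [he.extend_apply]

theorem measurePreserving_curry (ι κ : Type*) {E : Type*} [Fintype ι] [Fintype κ]
    [MeasurableSpace E] (μ : Measure E) [IsProbabilityMeasure μ] :
    MeasurePreserving (Function.curry : (ι × κ → E) → ι → κ → E) (Measure.pi fun _ => μ)
      (Measure.pi fun _ => Measure.pi fun _ => μ) := by
  refine ⟨(MeasurableEquiv.curry ι κ E).measurable, ?_⟩
  have := Measure.infinitePi_map_curry (ι := ι) (κ := κ) (fun _ _ => μ)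
  simpa only [Measure.infinitePi_eq_pi] using! this

section OtherUser

theorem other_ne (a : Fin 2) : other a ≠ a := by
  fin_cases a <;> decide

theorem other_other (a : Fin 2) : other (other a) = a := by
  fin_cases a <;> decide

theorem eq_other_of_ne {a i : Fin 2} (h : i ≠ a) : i = other a := by
  revert h; fin_cases a <;> fin_cases i <;> decide

end OtherUser

/-- The coordinates `(t, f, j)` of the extended noise: at time `t` in subcarrier `j`, the noise of
receiver `a` is the field `0` when the interference is present and the field `1` when it is absent;
the noise of the other receiver is the field `2`. -/
abbrev Coord (N M : ℕ) : Type := Fin N × Fin 3 × Fin M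

/-- Messages, states and extended noises. -/
abbrev ExtOutcome (M N : ℕ) (m : Fin 2 → ℕ) : Type := Messages m × States M N × (Coord N M → ℂ)

/-- The law of the messages, the states and the extended noises. -/
def extLaw {M : ℕ} (ν : Measure (Fin M → Bool)) (N : ℕ) (m : Fin 2 → ℕ) :
    Measure (ExtOutcome M N m) :=
  (uniformOn Set.univ).prod
    ((Measure.pi fun _ => ν).prod (Measure.pi fun _ => stdComplexGaussian))

/-- The coordinate that holds the output of receiver `a` at time `t` in subcarrier `j`. -/
def ownCoord (s : States M N) (t : Fin N) (j : Fin M) : Coord N M :=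
  (t, if s t j then 0 else 1, j)

/-- The channel noises that are read off the extended noises. -/
def toOutcome (a : Fin 2) (ω : ExtOutcome M N m) : Outcome M N m :=
  (ω.1, ω.2.1, fun t i j => if i = a then ω.2.2 (ownCoord ω.2.1 t j) else ω.2.2 (t, 2, j))

theorem measurable_of_sections {β : Type*} [MeasurableSpace β] {f : ExtOutcome M N m → β}
    (h : ∀ w s, Measurable fun u => f (w, s, u)) : Measurable f :=
  measurable_from_prod_countable_right fun w => measurable_from_prod_countable_right fun s => h w s

theorem measurable_of_sections_states {E β : Type*} [MeasurableSpace E] [MeasurableSpace β]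
    {f : States M N × E → β} (h : ∀ s, Measurable fun u => f (s, u)) : Measurable f :=
  measurable_from_prod_countable_right h

/-- Once the states are fixed, distinct channel noises are read off distinct coordinates, so this is
an injective reindexing of an i.i.d. family. The choice between fields `0` and `1` therefore leaves
no trace in the law. -/
theorem measurePreserving_toOutcome_noise (a : Fin 2) (s : States M N) :
    MeasurePreserving (fun (u : Coord N M → ℂ) (t : Fin N) (i : Fin 2) (j : Fin M) =>
        if i = a then u (ownCoord s t j) else u (t, 2, j))
      (Measure.pi fun _ => stdComplexGaussian)
      (Measure.pi fun _ => Measure.pi fun _ => Measure.pi fun _ => stdComplexGaussian) := by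
  let e : Fin N × Fin 2 × Fin M → Coord N M := fun k =>
    if k.2.1 = a then ownCoord s k.1 k.2.2 else (k.1, 2, k.2.2)
  have he : Function.Injective e := by
    rintro ⟨t, i, j⟩ ⟨t', i', j'⟩ h
    by_cases hi : i = a <;> by_cases hi' : i' = a
    · simp only [e, hi, hi', if_true, ownCoord, Prod.mk.injEq] at h ⊢
      exact ⟨h.1, trivial, h.2.2⟩
    · simp only [e, hi, hi', if_true, if_false, ownCoord, Prod.mk.injEq] at h
      exact absurd h.2.1 (by split_ifs <;> decide)
    · simp only [e, hi, hi', if_true, if_false, ownCoord, Prod.mk.injEq] at h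
      exact absurd h.2.1 (by split_ifs <;> decide)
    · simp only [e, hi, hi', if_false, Prod.mk.injEq] at h ⊢
      exact ⟨h.1, (eq_other_of_ne hi).trans (eq_other_of_ne hi').symm, h.2.2⟩
  have h1 := measurePreserving_comp_injective stdComplexGaussian he
  have h2 := measurePreserving_curry (Fin N) (Fin 2 × Fin M) stdComplexGaussian
  have h3 := measurePreserving_pi (ι := Fin N) (fun _ => _) (fun _ => _)
    (fun _ => measurePreserving_curry (Fin 2) (Fin M) stdComplexGaussian)
  convert h3.comp (h2.comp h1) using 1
  funext u t i j
  simp only [Function.comp, Function.curry, e]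
  split_ifs <;> rfl

theorem measurePreserving_toOutcome (a : Fin 2) (ν : Measure (Fin M → Bool))
    [IsProbabilityMeasure ν] :
    MeasurePreserving (toOutcome a) (extLaw ν N m) (law ν N m) := by
  have h := (MeasurePreserving.id (Measure.pi fun _ : Fin N => ν)).skew_product
    (g := fun (s : States M N) (u : Coord N M → ℂ) (t : Fin N) (i : Fin 2) (j : Fin M) =>
        if i = a then u (ownCoord s t j) else u (t, 2, j))
    (μc := Measure.pi fun _ => stdComplexGaussian)
    (μd := Measure.pi fun _ => Measure.pi fun _ => Measure.pi fun _ => stdComplexGaussian)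
    (measurable_of_sections_states fun s => (measurePreserving_toOutcome_noise a s).measurable)
    (ae_of_all _ fun s => (measurePreserving_toOutcome_noise a s).map_eq)
  exact (MeasurePreserving.id (uniformOn (Set.univ : Set (Messages m)))).prod h

/-! ### Outputs as a triangular translation of the noises -/

namespace Code

variable (c : Code M N m) (gD gI : Fin M → ℂ) (a : Fin 2)

/-- What transmitter `a` sends at time `t`, as a function of the output coordinates `x`. -/
def ownInput (w : Fin (m a)) (s : States M N) (x : Coord N M → ℂ) (t : Fin N) : Fin M → ℂ :=
  c.enc a t w (fun r j => x (ownCoord s ⟨r, r.2.trans t.2⟩ j), fun r => s ⟨r, r.2.trans t.2⟩)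

/-- What the transmitter other than `a` sends at time `t`, as a function of the output
coordinates `x`. -/
def otherInput (w : Fin (m (other a))) (s : States M N) (x : Coord N M → ℂ) (t : Fin N) :
    Fin M → ℂ :=
  c.enc (other a) t w (fun r j => x (⟨r, r.2.trans t.2⟩, 2, j), fun r => s ⟨r, r.2.trans t.2⟩)

/-- The noiseless part of the output coordinate `k`. -/
def drift (w : Messages m) (s : States M N) (k : Coord N M) (x : Coord N M → ℂ) : ℂ :=
  match k with
  | (t, 0, j) => gI j * c.otherInput a (w (other a)) s x t j
      + if s t j then gD j * c.ownInput a (w a) s x t j else 0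
  | (t, 1, j) => if s t j then 0 else gD j * c.ownInput a (w a) s x t j
  | (t, 2, j) => gD j * c.otherInput a (w (other a)) s x t j
      + if s t j then gI j * c.ownInput a (w a) s x t j else 0

/-- The output coordinates. The fields `0` and `1` hold, depending on the state, the output of
receiver `a` and a noisy observation of which that receiver learns nothing; the field `2` holds the
output of the other receiver. -/
def extOutput (ω : ExtOutcome M N m) (k : Coord N M) : ℂ :=
  match k with
  | (t, 0, j) => gI j * c.input gD gI (toOutcome a ω) t (other a) j
      + (if ω.2.1 t j then gD j * c.input gD gI (toOutcome a ω) t a j else 0) + ω.2.2 (t, 0, j)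
  | (t, 1, j) => (if ω.2.1 t j then 0 else gD j * c.input gD gI (toOutcome a ω) t a j)
      + ω.2.2 (t, 1, j)
  | (t, 2, j) => gD j * c.input gD gI (toOutcome a ω) t (other a) j
      + (if ω.2.1 t j then gI j * c.input gD gI (toOutcome a ω) t a j else 0) + ω.2.2 (t, 2, j)

theorem output_eq (ω : Outcome M N m) (t : Fin N) (i : Fin 2) (j : Fin M) :
    c.output gD gI ω t i j = gD j * c.input gD gI ω t i j
      + (if ω.2.1 t j then 1 else 0) * gI j * c.input gD gI ω t (other i) j + ω.2.2 t i j := by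
  rw [Code.output]; rfl

theorem extOutput_ownCoord (ω : ExtOutcome M N m) (t : Fin N) (j : Fin M) :
    c.extOutput gD gI a ω (ownCoord ω.2.1 t j) = c.output gD gI (toOutcome a ω) t a j := by
  rw [output_eq]
  by_cases h : ω.2.1 t j = true
  · simp [ownCoord, extOutput, toOutcome, h]; ring
  · simp [ownCoord, extOutput, toOutcome, h]

theorem extOutput_two (ω : ExtOutcome M N m) (t : Fin N) (j : Fin M) :
    c.extOutput gD gI a ω (t, 2, j) = c.output gD gI (toOutcome a ω) t (other a) j := by
  rw [output_eq, other_other]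
  by_cases h : ω.2.1 t j = true <;> simp [extOutput, toOutcome, h, other_ne]

theorem ownInput_extOutput (ω : ExtOutcome M N m) (t : Fin N) :
    c.ownInput a (ω.1 a) ω.2.1 (c.extOutput gD gI a ω) t
      = c.input gD gI (toOutcome a ω) t a := by
  funext j
  simp only [ownInput, extOutput_ownCoord]
  rfl

theorem otherInput_extOutput (ω : ExtOutcome M N m) (t : Fin N) :
    c.otherInput a (ω.1 (other a)) ω.2.1 (c.extOutput gD gI a ω) t
      = c.input gD gI (toOutcome a ω) t (other a) := by
  funext j
  simp only [otherInput, extOutput_two]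
  rfl

/-- Each encoder can be rerun on the output coordinates that its receiver sees, so the outputs solve
a fixed-point equation. This makes the output map the inverse of an explicit translation. -/
theorem extOutput_eq (ω : ExtOutcome M N m) (k : Coord N M) :
    c.extOutput gD gI a ω k
      = c.drift gD gI a ω.1 ω.2.1 k (c.extOutput gD gI a ω) + ω.2.2 k := by
  obtain ⟨t, f, j⟩ := k
  fin_cases f <;> simp only [drift, ownInput_extOutput, otherInput_extOutput] <;> rfl

variable {a}

theorem ownInput_congr {w : Fin (m a)} {s : States M N} {x x' : Coord N M → ℂ} {t : Fin N}
    (h : ∀ r < t, ∀ j, x (ownCoord s r j) = x' (ownCoord s r j)) :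
    c.ownInput a w s x t = c.ownInput a w s x' t := by
  unfold ownInput
  congr 2
  funext r j
  exact h _ r.2 j

theorem otherInput_congr {w : Fin (m (other a))} {s : States M N} {x x' : Coord N M → ℂ}
    {t : Fin N} (h : ∀ r < t, ∀ j, x (r, 2, j) = x' (r, 2, j)) :
    c.otherInput a w s x t = c.otherInput a w s x' t := by
  unfold otherInput
  congr 2
  funext r j
  exact h _ r.2 j

theorem drift_congr {w : Messages m} {s : States M N} {k : Coord N M} {x x' : Coord N M → ℂ}
    (h : ∀ k', k'.1 < k.1 → x k' = x' k') :
    c.drift gD gI a w s k x = c.drift gD gI a w s k x' := by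
  obtain ⟨t, f, j⟩ := k
  have h1 : c.ownInput a (w a) s x t = c.ownInput a (w a) s x' t :=
    c.ownInput_congr fun r hr j => h _ hr
  have h2 : c.otherInput a (w (other a)) s x t = c.otherInput a (w (other a)) s x' t :=
    c.otherInput_congr fun r hr j => h _ hr
  fin_cases f <;> simp only [drift, h1, h2]

theorem ignores_ownInput {w : Fin (m a)} {s : States M N} {t : Fin N} {k : Coord N M}
    (h : ∀ r < t, ∀ j, ownCoord s r j ≠ k) : Ignores (fun x => c.ownInput a w s x t) k :=
  fun _ _ => c.ownInput_congr fun r hr j => Function.update_of_ne (h r hr j) _ _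

theorem ignores_otherInput {w : Fin (m (other a))} {s : States M N} {t : Fin N} {k : Coord N M}
    (h : ∀ r < t, ∀ j, (r, 2, j) ≠ k) : Ignores (fun x => c.otherInput a w s x t) k :=
  fun _ _ => c.otherInput_congr fun r hr j => Function.update_of_ne (h r hr j) _ _

/-- Strict causality of the feedback: simultaneous coordinates are ignored as well as later ones. -/
theorem ignores_drift {w : Messages m} {s : States M N} {k k' : Coord N M} (h : k.1 ≤ k'.1) :
    Ignores (c.drift gD gI a w s k) k' :=
  fun _ _ => c.drift_congr gD gI fun l hl => Function.update_of_ne (by rintro rfl; omega) _ _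

variable (a)

theorem measurable_ownInput (w : Fin (m a)) (s : States M N) (t : Fin N) :
    Measurable fun x : Coord N M → ℂ => c.ownInput a w s x t :=
  (c.measurable_enc a t w).comp (by fun_prop)

theorem measurable_otherInput (w : Fin (m (other a))) (s : States M N) (t : Fin N) :
    Measurable fun x : Coord N M → ℂ => c.otherInput a w s x t :=
  (c.measurable_enc (other a) t w).comp (by fun_prop)

theorem measurable_drift (w : Messages m) (s : States M N) (k : Coord N M) :
    Measurable (c.drift gD gI a w s k) := by
  obtain ⟨t, f, j⟩ := k
  have h1 := (measurable_pi_apply j).comp (c.measurable_ownInput a (w a) s t)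
  have h2 := (measurable_pi_apply j).comp (c.measurable_otherInput a (w (other a)) s t)
  simp only [Function.comp_def] at h1 h2
  change Measurable fun x => c.drift gD gI a w s (t, f, j) x
  fin_cases f <;> simp only [drift] <;> split_ifs <;> fun_prop

/-- With time as the rank the system is triangular, so it has unit Jacobian although the encoders
are merely measurable. -/
theorem measurePreserving_sub_drift (w : Messages m) (s : States M N) :
    MeasurePreserving fun (x : Coord N M → ℂ) k => x k - c.drift gD gI a w s k x :=
  measurePreserving_triangular (fun k => k.1) _ (c.measurable_drift gD gI a w s)
    fun _ _ h => c.ignores_drift gD gI (by exact_mod_cast h)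

theorem injective_sub_drift (w : Messages m) (s : States M N) :
    Function.Injective fun (x : Coord N M → ℂ) k => x k - c.drift gD gI a w s k x := by
  intro x y h
  have key : ∀ n : ℕ, ∀ k : Coord N M, (k.1 : ℕ) < n → x k = y k := by
    intro n
    induction n with
    | zero => intro k hk; exact absurd hk (Nat.not_lt_zero _)
    | succ n ih =>
      intro k hk
      have h1 := congrFun h k
      have h2 : c.drift gD gI a w s k x = c.drift gD gI a w s k y :=
        c.drift_congr gD gI fun k' hk' => ih k' (by have : (k'.1 : ℕ) < k.1 := hk'; omega)
      simp only [h2] at h1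
      exact sub_left_injective h1
  funext k
  exact key (k.1 + 1) k (Nat.lt_succ_self _)

theorem measurableEmbedding_sub_drift (w : Messages m) (s : States M N) :
    MeasurableEmbedding fun (x : Coord N M → ℂ) k => x k - c.drift gD gI a w s k x :=
  (c.measurePreserving_sub_drift gD gI a w s).measurable.measurableEmbedding
    (c.injective_sub_drift gD gI a w s)

theorem sub_drift_extOutput (w : Messages m) (s : States M N) (u : Coord N M → ℂ) :
    (fun k => c.extOutput gD gI a (w, s, u) k
      - c.drift gD gI a w s k (c.extOutput gD gI a (w, s, u))) = u := by
  funext k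
  rw [sub_eq_iff_eq_add', ← c.extOutput_eq gD gI a (w, s, u) k]

theorem extOutput_sub_drift (w : Messages m) (s : States M N) (x : Coord N M → ℂ) :
    c.extOutput gD gI a (w, s, fun k => x k - c.drift gD gI a w s k x) = x :=
  c.injective_sub_drift gD gI a w s (c.sub_drift_extOutput gD gI a w s _)

/-- For fixed messages and states this map inverts a measurable injection between standard Borel
spaces; such an injection sends measurable sets to measurable sets. -/
theorem measurable_extOutput : Measurable (c.extOutput gD gI a) := by
  refine measurable_of_sections fun w s A hA => ?_
  convert (c.measurableEmbedding_sub_drift gD gI a w s).measurableSet_image.2 hA using 1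
  ext u
  constructor
  · intro hu
    exact ⟨_, hu, c.sub_drift_extOutput gD gI a w s u⟩
  · rintro ⟨x, hx, rfl⟩
    simpa only [Set.mem_preimage, c.extOutput_sub_drift gD gI a w s x] using hx

/-- The conditional density of the output coordinate `k`. -/
def coordDensity (w : Messages m) (s : States M N) (k : Coord N M) (x : Coord N M → ℂ) : ℝ :=
  gaussDensity 1 (x k - c.drift gD gI a w s k x)

/-- The substitution of outputs for noises has unit Jacobian, so the output density is the noise
density at `x - drift x`. -/
theorem lintegral_comp_extOutput (w : Messages m) (s : States M N) {H : (Coord N M → ℂ) → ℝ≥0∞}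
    (hH : Measurable H) :
    ∫⁻ u, H (c.extOutput gD gI a (w, s, u)) ∂(Measure.pi fun _ => stdComplexGaussian)
      = ∫⁻ x, (∏ k, ENNReal.ofReal (c.coordDensity gD gI a w s k x)) * H x := by
  have hsf : SigmaFinite ((volume : Measure ℂ).withDensity
      fun x => ENNReal.ofReal (gaussDensity 1 x)) := by
    rw [← stdComplexGaussian_eq_withDensity]; infer_instance
  have hm : Measurable fun u : Coord N M → ℂ => ∏ k, ENNReal.ofReal (gaussDensity 1 (u k)) := by
    fun_prop
  have hH' : Measurable fun u => H (c.extOutput gD gI a (w, s, u)) :=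
    hH.comp ((c.measurable_extOutput gD gI a).comp (by fun_prop))
  rw [stdComplexGaussian_eq_withDensity, pi_withDensity _ (by fun_prop),
    lintegral_withDensity_eq_lintegral_mul _ hm hH',
    ← (c.measurePreserving_sub_drift gD gI a w s).lintegral_comp (hm.mul hH')]
  refine lintegral_congr fun x => ?_
  simp only [Pi.mul_apply, c.extOutput_sub_drift gD gI a w s x]
  rfl

end Code

/-! ### Replacing the true output density by an auxiliary one -/

instance {ν : Measure (Fin M → Bool)} [IsProbabilityMeasure ν] [∀ i, NeZero (m i)] :
    IsProbabilityMeasure (extLaw ν N m) := by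
  have := isProbabilityMeasure_uniformOn (Ω := Messages m) Set.finite_univ Set.univ_nonempty
  unfold extLaw
  infer_instance

theorem uniformOn_messages_singleton (w : Messages m) :
    uniformOn (Set.univ : Set (Messages m)) {w} = (Fintype.card (Messages m) : ℝ≥0∞)⁻¹ := by
  rw [uniformOn_univ, Measure.count_singleton, one_div]

/-- The states are averaged last, so a bound uniform in the state sequence suffices and their law
plays no role in the mass estimates. -/
theorem Code.lintegral_extLaw_le (c : Code M N m) (gD gI : Fin M → ℂ) (a : Fin 2)
    (ν : Measure (Fin M → Bool)) [IsProbabilityMeasure ν] [∀ i, NeZero (m i)]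
    {H : Messages m → States M N → (Coord N M → ℂ) → ℝ≥0∞} (hH : ∀ w s, Measurable (H w s))
    {B : ℝ≥0∞}
    (hB : ∀ s, ∑ w, ∫⁻ x, (∏ k, ENNReal.ofReal (c.coordDensity gD gI a w s k x)) * H w s x ≤ B) :
    ∫⁻ ω, H ω.1 ω.2.1 (c.extOutput gD gI a ω) ∂(extLaw ν N m)
      ≤ (Fintype.card (Messages m) : ℝ≥0∞)⁻¹ * B := by
  have := isProbabilityMeasure_uniformOn (Ω := Messages m) Set.finite_univ Set.univ_nonempty
  have hsec : ∀ w s, Measurable fun u => H w s (c.extOutput gD gI a (w, s, u)) := fun w s =>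
    (hH w s).comp ((c.measurable_extOutput gD gI a).comp (by fun_prop))
  have hm : Measurable fun ω : ExtOutcome M N m => H ω.1 ω.2.1 (c.extOutput gD gI a ω) :=
    measurable_of_sections hsec
  have hm2 : Measurable fun su : States M N × (Coord N M → ℂ) =>
      ∫⁻ w, H w su.1 (c.extOutput gD gI a (w, su)) ∂(uniformOn (Set.univ : Set (Messages m))) :=
    hm.lintegral_prod_left'
  rw [extLaw, lintegral_prod_symm' _ hm, lintegral_prod _ hm2.aemeasurable]
  calc _ ≤ ∫⁻ _ : States M N, (Fintype.card (Messages m) : ℝ≥0∞)⁻¹ * B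
        ∂(Measure.pi fun _ : Fin N => ν) := by
        refine lintegral_mono fun s => ?_
        simp only [lintegral_fintype, uniformOn_messages_singleton]
        rw [lintegral_finsetSum _ fun w _ => (hsec w s).mul_const _]
        simp only [lintegral_mul_const _ (hsec _ s), c.lintegral_comp_extOutput gD gI a _ s
          (hH _ s)]
        rw [← Finset.sum_mul, mul_comm]
        gcongr
        exact hB s
    _ = _ := by simp

/-- A pair of messages is a message of user `i` together with a message of the other user. -/
def messagesEquiv (m : Fin 2 → ℕ) (i : Fin 2) : Messages m ≃ Fin (m i) × Fin (m (other i)) :=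
  Equiv.ofBijective (fun w => (w i, w (other i))) (by
    constructor
    · intro w w' h
      simp only [Prod.mk.injEq] at h
      funext k
      by_cases hk : k = i
      · subst hk; exact h.1
      · obtain rfl := eq_other_of_ne hk
        exact h.2
    · rintro ⟨x, y⟩
      fin_cases i
      · exact ⟨Fin.cons x (Fin.cons y finZeroElim), rfl⟩
      · exact ⟨Fin.cons y (Fin.cons x finZeroElim), rfl⟩)

theorem messagesEquiv_symm_self (i : Fin 2) (p : Fin (m i) × Fin (m (other i))) :
    (messagesEquiv m i).symm p i = p.1 :=
  congrArg Prod.fst ((messagesEquiv m i).apply_symm_apply p)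

theorem messagesEquiv_symm_other (i : Fin 2) (p : Fin (m i) × Fin (m (other i))) :
    (messagesEquiv m i).symm p (other i) = p.2 :=
  congrArg Prod.snd ((messagesEquiv m i).apply_symm_apply p)

theorem sum_messages {A : Type*} [AddCommMonoid A] (i : Fin 2) (f : Messages m → A) :
    ∑ w, f w = ∑ x, ∑ y, f ((messagesEquiv m i).symm (x, y)) := by
  rw [← (messagesEquiv m i).symm.sum_comp, Fintype.sum_prod_type]

theorem card_messages (i : Fin 2) : Fintype.card (Messages m) = m i * m (other i) := by
  rw [Fintype.card_congr (messagesEquiv m i), Fintype.card_prod, Fintype.card_fin, Fintype.card_fin]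

namespace Code

variable (c : Code M N m) (gD gI : Fin M → ℂ) (a : Fin 2)

/-- The logarithm of the ratio of a joint density `∏ q` of the output coordinates to their true
density. -/
def logRatio (q : Messages m → States M N → Coord N M → (Coord N M → ℂ) → ℝ)
    (ω : ExtOutcome M N m) : ℝ :=
  ∑ k, (Real.log (q ω.1 ω.2.1 k (c.extOutput gD gI a ω)) - Real.log (gaussDensity 1 (ω.2.2 k)))

theorem coordDensity_extOutput (ω : ExtOutcome M N m) (k : Coord N M) :
    c.coordDensity gD gI a ω.1 ω.2.1 k (c.extOutput gD gI a ω) = gaussDensity 1 (ω.2.2 k) := by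
  rw [coordDensity, sub_eq_of_eq_add' (c.extOutput_eq gD gI a ω k)]

theorem coordDensity_pos (w : Messages m) (s : States M N) (k : Coord N M) (x : Coord N M → ℂ) :
    0 < c.coordDensity gD gI a w s k x :=
  gaussDensity_pos one_pos _

theorem measurable_coordDensity (w : Messages m) (s : States M N) (k : Coord N M) :
    Measurable (c.coordDensity gD gI a w s k) :=
  (measurable_gaussDensity 1).comp ((measurable_pi_apply k).sub (c.measurable_drift gD gI a w s k))

/-- The factor `exp (logRatio)` cancels the true output density and installs `∏ q`. The weight `θ`
is later either `1` or the indicator of correct decoding. -/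
theorem lintegral_mul_exp_logRatio_le (ν : Measure (Fin M → Bool)) [IsProbabilityMeasure ν]
    [∀ i, NeZero (m i)] {q : Messages m → States M N → Coord N M → (Coord N M → ℂ) → ℝ}
    (hq : ∀ w s k x, 0 < q w s k x) (qm : ∀ w s k, Measurable (q w s k))
    {θ : Messages m → States M N → (Coord N M → ℂ) → ℝ≥0∞} (θm : ∀ w s, Measurable (θ w s))
    {B : ℝ≥0∞} (hB : ∀ s, ∑ w, ∫⁻ x, θ w s x * ∏ k, ENNReal.ofReal (q w s k x) ≤ B) :
    ∫⁻ ω, θ ω.1 ω.2.1 (c.extOutput gD gI a ω)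
        * ENNReal.ofReal (Real.exp (c.logRatio gD gI a q ω)) ∂(extLaw ν N m)
      ≤ (Fintype.card (Messages m) : ℝ≥0∞)⁻¹ * B := by
  have hpos := c.coordDensity_pos gD gI a
  have hexp : ∀ ω, Real.exp (c.logRatio gD gI a q ω)
      = ∏ k, q ω.1 ω.2.1 k (c.extOutput gD gI a ω)
          / c.coordDensity gD gI a ω.1 ω.2.1 k (c.extOutput gD gI a ω) := by
    intro ω
    rw [logRatio, Real.exp_sum]
    refine Finset.prod_congr rfl fun k _ => ?_
    rw [coordDensity_extOutput, Real.exp_sub, Real.exp_log (hq _ _ _ _),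
      Real.exp_log (gaussDensity_pos one_pos _)]
  simp only [hexp]
  have hm : ∀ w s, Measurable fun x => θ w s x
      * ENNReal.ofReal (∏ k, q w s k x / c.coordDensity gD gI a w s k x) := fun w s =>
    (θm w s).mul (ENNReal.measurable_ofReal.comp (Finset.measurable_fun_prod _ fun k _ =>
      (qm w s k).div (c.measurable_coordDensity gD gI a w s k)))
  refine c.lintegral_extLaw_le gD gI a ν hm fun s => le_trans (le_of_eq ?_) (hB s)
  refine Finset.sum_congr rfl fun w _ => lintegral_congr fun x => ?_
  rw [mul_left_comm, ← ENNReal.ofReal_prod_of_nonneg fun k _ => (hpos w s k x).le,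
    ← ENNReal.ofReal_mul (Finset.prod_nonneg fun k _ => (hpos w s k x).le),
    ← ENNReal.ofReal_prod_of_nonneg fun k _ => (hq w s k x).le, ← Finset.prod_mul_distrib]
  congr 3
  funext k
  rw [mul_div_cancel₀ _ (hpos w s k x).ne']

end Code

/-! ### Decoding weights against densities free of the message -/

section DecodingSums

/-- If the auxiliary joint density does not depend on the message of user `i`, then weights with sum
at most `κ` over that message have total mass at most `κ` for each message of the other user. -/
theorem sum_lintegral_mul_le (i : Fin 2) {X : Type*} [MeasureSpace X] {Q : Messages m → X → ℝ≥0∞}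
    (hQ : ∀ w w', w (other i) = w' (other i) → Q w = Q w') (Qm : ∀ w, Measurable (Q w))
    (hint : ∀ w, ∫⁻ x, Q w x ≤ 1) {θ : Fin (m i) → X → ℝ≥0∞} (θm : ∀ w, Measurable (θ w))
    {κ : ℝ≥0∞} (hθ : ∀ x, ∑ w, θ w x ≤ κ) :
    ∑ w : Messages m, ∫⁻ x, θ (w i) x * Q w x ≤ m (other i) * κ := by
  rw [sum_messages i, Finset.sum_comm]
  simp only [messagesEquiv_symm_self]
  calc _ ≤ ∑ _ : Fin (m (other i)), κ := by
        refine Finset.sum_le_sum fun y _ => ?_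
        rcases isEmpty_or_nonempty (Fin (m i)) with he | ⟨⟨x₀⟩⟩
        · simp
        have hx : ∀ x, Q ((messagesEquiv m i).symm (x, y)) = Q ((messagesEquiv m i).symm (x₀, y)) :=
          fun x => hQ _ _ (by simp only [messagesEquiv_symm_other])
        simp only [hx]
        have hm : ∀ w, Measurable fun z => θ w z * Q ((messagesEquiv m i).symm (x₀, y)) z :=
          fun w => (θm w).mul (Qm _)
        rw [← lintegral_finsetSum _ fun w _ => hm w]
        simp only [← Finset.sum_mul]
        calc _ ≤ ∫⁻ z, κ * Q ((messagesEquiv m i).symm (x₀, y)) z :=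
              lintegral_mono fun z => by gcongr; exact hθ z
          _ = κ * ∫⁻ z, Q ((messagesEquiv m i).symm (x₀, y)) z := lintegral_const_mul _ (Qm _)
          _ ≤ κ := mul_le_of_le_one_right' (hint _)
    _ = _ := by simp

theorem lmarginal_finsetSum {ι E J : Type*} [DecidableEq ι] [MeasureSpace E] (A : Finset ι)
    (S : Finset J) (f : J → (ι → E) → ℝ≥0∞) (fm : ∀ j, Measurable (f j)) :
    (∫⋯∫⁻_A, (fun x => ∑ j ∈ S, f j x)) = fun x => ∑ j ∈ S, (∫⋯∫⁻_A, f j) x := by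
  funext x
  exact lintegral_finsetSum _ fun j _ => (fm j).comp measurable_updateFinset

/-- The coordinates that hold the output of receiver `a`. -/
def ownCoords (s : States M N) : Finset (Coord N M) :=
  {k | k.2.1 = if s k.1 k.2.2 then 0 else 1}

theorem mem_ownCoords {s : States M N} {k : Coord N M} :
    k ∈ ownCoords s ↔ k.2.1 = if s k.1 k.2.2 then 0 else 1 := by
  simp [ownCoords]

theorem ownCoord_mem (s : States M N) (t : Fin N) (j : Fin M) : ownCoord s t j ∈ ownCoords s := by
  simp [mem_ownCoords, ownCoord]

/-- Weights on the message of user `a` that depend on the output of receiver `a` alone, against a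
product density of that output. -/
theorem sum_lmarginal_ownCoords_le {n : ℕ} (s : States M N) {V : Coord N M → ℝ}
    (hV : ∀ k, 0 < V k) {θ : Fin n → (Coord N M → ℂ) → ℝ≥0∞} (θm : ∀ w, Measurable (θ w))
    {κ : ℝ≥0∞} (hθ : ∀ x, ∑ w, θ w x ≤ κ) (x₀ : Coord N M → ℂ) :
    ∑ w, (∫⋯∫⁻_ownCoords s, (fun x => θ w x * ∏ k ∈ ownCoords s,
      ENNReal.ofReal (gaussDensity (V k) (x k)))) x₀ ≤ κ := by
  have hg : ∀ k, Measurable fun x : ℂ => ENNReal.ofReal (gaussDensity (V k) x) := fun k => by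
    fun_prop
  have hgp : Measurable fun x : Coord N M → ℂ =>
      ∏ k ∈ ownCoords s, ENNReal.ofReal (gaussDensity (V k) (x k)) :=
    Finset.measurable_fun_prod _ fun k _ => (hg k).comp (measurable_pi_apply k)
  have h1 := congrFun (lmarginal_finsetSum (ownCoords s) Finset.univ _
    fun w : Fin n => (θm w).mul hgp) x₀
  refine h1.symm.trans_le ?_
  refine (lmarginal_mono (g := fun x => κ * ∏ k ∈ ownCoords s,
    ENNReal.ofReal (gaussDensity (V k) (x k))) (fun x => ?_) x₀).trans ?_
  · simp only [Pi.mul_apply]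
    rw [← Finset.sum_mul]
    gcongr
    exact hθ x
  · have h2 := lmarginal_prod_apply (ownCoords s) _ hg x₀
    simp only [lintegral_gaussDensity (hV _), Finset.prod_const_one] at h2
    simp only [lmarginal] at h2 ⊢
    have hm : Measurable fun y : (i : ownCoords s) → ℂ => ∏ k ∈ ownCoords s,
        ENNReal.ofReal (gaussDensity (V k) (Function.updateFinset x₀ (ownCoords s) y k)) :=
      hgp.comp measurable_updateFinset
    rw [lintegral_const_mul _ hm, h2, mul_one]

end DecodingSums

section GaussianProducts

variable {ι : Type*}

theorem Ignores.gaussDensity_sub [DecidableEq ι] {ctr : (ι → ℂ) → ℂ} {k k' : ι} (h : Ignores ctr k')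
    (hk : k' ≠ k)
    (v : ℝ) : Ignores (fun x => ENNReal.ofReal (gaussDensity v (x k - ctr x))) k' := by
  intro x z
  simp only [h x z, Function.update_of_ne hk.symm]

theorem measurable_gaussDensity_sub {ctr : (ι → ℂ) → ℂ} (hc : Measurable ctr) (k : ι) (v : ℝ) :
    Measurable fun x => ENNReal.ofReal (gaussDensity v (x k - ctr x)) :=
  ENNReal.measurable_ofReal.comp
    ((measurable_gaussDensity v).comp ((measurable_pi_apply k).sub hc))

theorem lintegral_gaussDensity_update [DecidableEq ι] {v : ℝ} (hv : 0 < v) {ctr : (ι → ℂ) → ℂ}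
    {k : ι}
    (h : Ignores ctr k) (x : ι → ℂ) :
    ∫⁻ z, ENNReal.ofReal (gaussDensity v
      (Function.update x k z k - ctr (Function.update x k z))) = 1 := by
  simp only [h x, Function.update_self]
  exact lintegral_gaussDensity_sub hv _

theorem lmarginal_mul_prod_gaussDensity_le [DecidableEq ι] (B : Finset ι) (r : ι → ℕ)
    {h : (ι → ℂ) → ℝ≥0∞}
    (hm : Measurable h) (hh : ∀ k ∈ B, Ignores h k) {v : ι → ℝ} (hv : ∀ k, 0 < v k)
    {ctr : ι → (ι → ℂ) → ℂ} (cm : ∀ k, Measurable (ctr k))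
    (hc : ∀ k ∈ B, ∀ k' ∈ B, r k ≤ r k' → Ignores (ctr k) k') :
    (∫⋯∫⁻_B, (fun x => h x * ∏ k ∈ B, ENNReal.ofReal (gaussDensity (v k) (x k - ctr k x)))) ≤ h :=
  lmarginal_mul_prod_le B r h _ hm (fun k _ => measurable_gaussDensity_sub (cm k) k (v k)) hh
    (fun k hk k' hk' hne hr => (hc k hk k' hk' hr).gaussDensity_sub hne (v k))
    (fun k hk x => (lintegral_gaussDensity_update (hv k) (hc k hk k hk le_rfl) x).le)

theorem lintegral_prod_gaussDensity_le_one [DecidableEq ι] [Fintype ι] (r : ι → ℕ) {v : ι → ℝ}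
    (hv : ∀ k, 0 < v k) {ctr : ι → (ι → ℂ) → ℂ} (cm : ∀ k, Measurable (ctr k))
    (hc : ∀ k k', r k ≤ r k' → Ignores (ctr k) k') :
    ∫⁻ x, ∏ k, ENNReal.ofReal (gaussDensity (v k) (x k - ctr k x)) ≤ 1 :=
  lintegral_prod_le_one r _ (fun k => measurable_gaussDensity_sub (cm k) k (v k))
    (fun k k' hne hr => (hc k k' hr).gaussDensity_sub hne (v k))
    (fun k x => (lintegral_gaussDensity_update (hv k) (hc k k le_rfl) x).le)

end GaussianProducts

/-! ### Orders of integration and variances -/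

section Rank

/-- The position of a coordinate in the lexicographic order. -/
def coordRank (k : Coord N M) : ℕ := k.2.2 + M * (k.2.1 + 3 * k.1)

theorem coordRank_lt {k k' : Coord N M} (h : (k.2.1 : ℕ) + 3 * k.1 < k'.2.1 + 3 * k'.1) :
    coordRank k < coordRank k' := by
  unfold coordRank
  have h1 := k.2.2.2
  have h2 : M * ((k.2.1 : ℕ) + 3 * k.1 + 1) ≤ M * (k'.2.1 + 3 * k'.1) := Nat.mul_le_mul_left M h
  rw [mul_add, mul_one] at h2
  omega

theorem field_le_of_coordRank_le {k k' : Coord N M} (h : coordRank k ≤ coordRank k') :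
    (k.2.1 : ℕ) + 3 * k.1 ≤ k'.2.1 + 3 * k'.1 := by
  by_contra! hlt
  exact (coordRank_lt hlt).not_ge h

theorem time_le_of_coordRank_le {k k' : Coord N M} (h : coordRank k ≤ coordRank k') :
    k.1 ≤ k'.1 := by
  have h1 := field_le_of_coordRank_le h
  have h2 := k.2.1.2
  have h3 := k'.2.1.2
  rw [Fin.le_def]
  omega

theorem coordRank_injective : Function.Injective (coordRank : Coord N M → ℕ) := by
  intro k k' h
  have h1 := field_le_of_coordRank_le h.le
  have h2 := field_le_of_coordRank_le h.ge
  have h3 := k.2.1.2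
  have h4 := k'.2.1.2
  have h5 : (k.2.1 : ℕ) + 3 * k.1 = k'.2.1 + 3 * k'.1 := le_antisymm h1 h2
  have h6 : (k.2.2 : ℕ) = k'.2.2 := by
    unfold coordRank at h
    rw [h5] at h
    omega
  refine Prod.ext (Fin.ext ?_) (Prod.ext (Fin.ext ?_) (Fin.ext h6)) <;> omega

end Rank

section Variances

variable (gD gI : Fin M → ℂ) (j : Fin M)

/-- The output variance without interference. -/
def varDirect : ℝ := 1 + ‖gD j‖ ^ 2

/-- The variance of the interference with noise. -/
def varCross : ℝ := 1 + ‖gI j‖ ^ 2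

/-- The output variance with fully aligned interference. -/
def varSum : ℝ := 1 + (‖gD j‖ + ‖gI j‖) ^ 2

/-- The variance of an output given a noisy observation of the interference it causes. -/
def varCond : ℝ := 1 + ‖gD j‖ ^ 2 / (1 + ‖gI j‖ ^ 2)

/-- The coefficient of linear estimation of `gD * x + z` from `gI * x + z'`. -/
def mmseCoeff : ℂ := gD j * (starRingEnd ℂ) (gI j) / (1 + ‖gI j‖ ^ 2 : ℝ)

theorem varDirect_pos : 0 < varDirect gD j := by unfold varDirect; positivity
theorem varCross_pos : 0 < varCross gI j := by unfold varCross; positivity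
theorem varSum_pos : 0 < varSum gD gI j := by unfold varSum; positivity
theorem varCond_pos : 0 < varCond gD gI j := by unfold varCond; positivity

end Variances

/-- A weight reads only the coordinates in `A`. -/
def ReadsOnly {β : Type*} (A : Finset (Coord N M)) (f : (Coord N M → ℂ) → β) : Prop :=
  ∀ k ∉ A, Ignores f k

namespace Code

variable (c : Code M N m) (gD gI : Fin M → ℂ) (a : Fin 2)

/-! ### Auxiliary density for the single-rate bound -/

section Cutset

/-- Variances of the auxiliary density for the cut-set bound. -/
def cutVar (s : States M N) (k : Coord N M) : ℝ :=
  match k with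
  | (t, 0, j) => if s t j then varCond gD gI j else 1
  | (t, 1, j) => if s t j then 1 else varDirect gD j
  | (t, 2, j) => if s t j then varCross gI j else 1

/-- Centres of the auxiliary density for the cut-set bound. -/
def cutCenter (w : Messages m) (s : States M N) (k : Coord N M) (x : Coord N M → ℂ) : ℂ :=
  match k with
  | (t, 0, j) => gI j * c.otherInput a (w (other a)) s x t j + if s t j then
      mmseCoeff gD gI j * (x (t, 2, j) - gD j * c.otherInput a (w (other a)) s x t j) else 0
  | (_, 1, _) => 0
  | (t, 2, j) => gD j * c.otherInput a (w (other a)) s x t j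

theorem cutVar_pos (s : States M N) (k : Coord N M) : 0 < cutVar gD gI s k := by
  obtain ⟨t, f, j⟩ := k
  have := varDirect_pos gD j
  have := varCross_pos gI j
  have := varCond_pos gD gI j
  fin_cases f <;> simp only [cutVar] <;> split_ifs <;> first | assumption | exact one_pos

theorem measurable_cutCenter (w : Messages m) (s : States M N) (k : Coord N M) :
    Measurable (c.cutCenter gD gI a w s k) := by
  obtain ⟨t, f, j⟩ := k
  have h2 := (measurable_pi_apply j).comp (c.measurable_otherInput a (w (other a)) s t)
  simp only [Function.comp_def] at h2
  change Measurable fun x => c.cutCenter gD gI a w s (t, f, j) x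
  fin_cases f <;> simp only [cutCenter] <;> try split_ifs
  all_goals fun_prop

/-- Within one time, field `2` must precede the others, because the own output is estimated from the
simultaneous output of the other receiver; hence the rank `2 t` for field `2` and `2 t + 1` for the
rest. -/
theorem ignores_cutCenter (w : Messages m) (s : States M N) {k k' : Coord N M}
    (h : 2 * (k.1 : ℕ) + (if k.2.1 = 2 then 0 else 1) ≤ 2 * k'.1 + if k'.2.1 = 2 then 0 else 1) :
    Ignores (c.cutCenter gD gI a w s k) k' := by
  obtain ⟨t, f, j⟩ := k
  intro x z
  have ht : t ≤ k'.1 := by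
    rw [Fin.le_def]
    dsimp only at h
    split_ifs at h <;> omega
  have h2 : c.otherInput a (w (other a)) s (Function.update x k' z) t
      = c.otherInput a (w (other a)) s x t :=
    c.ignores_otherInput (fun r hr j' he => by subst he; exact absurd hr (not_lt.2 ht)) x z
  fin_cases f
  · have h3 : ((t, 2, j) : Coord N M) ≠ k' := by
      rintro rfl
      simp at h
    simp only [cutCenter, h2, Function.update_of_ne h3]
  · rfl
  · simp only [cutCenter, h2]

/-- The centres involve only the message of the other user, so given that message the outputs say
nothing about the message of `a`. -/
theorem sum_lintegral_cut_le (s : States M N) {θ : Fin (m a) → (Coord N M → ℂ) → ℝ≥0∞}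
    (θm : ∀ w, Measurable (θ w)) {κ : ℝ≥0∞} (hθ : ∀ x, ∑ w, θ w x ≤ κ) :
    ∑ w : Messages m, ∫⁻ x, θ (w a) x * ∏ k, ENNReal.ofReal
      (gaussDensity (cutVar gD gI s k) (x k - c.cutCenter gD gI a w s k x)) ≤ m (other a) * κ := by
  refine sum_lintegral_mul_le a (fun w w' h => ?_) (fun w => Finset.measurable_fun_prod _ fun k _ =>
    measurable_gaussDensity_sub (c.measurable_cutCenter gD gI a w s k) k _) (fun w => ?_) θm hθ
  · funext x
    refine Finset.prod_congr rfl fun k _ => ?_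
    obtain ⟨t, f, j⟩ := k
    fin_cases f <;> simp only [cutCenter, h]
  · exact lintegral_prod_gaussDensity_le_one (fun k => 2 * (k.1 : ℕ) + if k.2.1 = 2 then 0 else 1)
      (cutVar_pos gD gI s) (c.measurable_cutCenter gD gI a w s)
      fun k k' h => c.ignores_cutCenter gD gI a w s h

end Cutset

/-! ### Auxiliary density for the sum-rate bound -/

section SumRate

/-- Variances of the auxiliary density for the sum-rate bound. -/
def sumVar (s : States M N) (k : Coord N M) : ℝ :=
  match k with
  | (t, 0, j) => if s t j then varSum gD gI j else 1
  | (t, 1, j) => if s t j then 1 else varDirect gD j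
  | (t, 2, j) => if s t j then varCond gD gI j else varDirect gD j

/-- Centres of the auxiliary density for the sum-rate bound. -/
def sumCenter (w : Messages m) (s : States M N) (k : Coord N M) (x : Coord N M → ℂ) : ℂ :=
  match k with
  | (t, 0, j) => if s t j then 0 else gI j * c.otherInput a (w (other a)) s x t j
  | (_, 1, _) => 0
  | (t, 2, j) => if s t j then gI j * c.ownInput a (w a) s x t j
      + mmseCoeff gD gI j * (x (t, 0, j) - gD j * c.ownInput a (w a) s x t j) else 0

theorem sumVar_pos (s : States M N) (k : Coord N M) : 0 < sumVar gD gI s k := by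
  obtain ⟨t, f, j⟩ := k
  have := varDirect_pos gD j
  have := varSum_pos gD gI j
  have := varCond_pos gD gI j
  fin_cases f <;> simp only [sumVar] <;> split_ifs <;> first | assumption | exact one_pos

theorem measurable_sumCenter (w : Messages m) (s : States M N) (k : Coord N M) :
    Measurable (c.sumCenter gD gI a w s k) := by
  obtain ⟨t, f, j⟩ := k
  have h1 := (measurable_pi_apply j).comp (c.measurable_ownInput a (w a) s t)
  have h2 := (measurable_pi_apply j).comp (c.measurable_otherInput a (w (other a)) s t)
  simp only [Function.comp_def] at h1 h2
  change Measurable fun x => c.sumCenter gD gI a w s (t, f, j) x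
  fin_cases f <;> simp only [sumCenter] <;> try split_ifs
  all_goals fun_prop

/-- The coordinates of the other receiver. -/
def otherCoords (N M : ℕ) : Finset (Coord N M) := {k | k.2.1 = 2}

/-- The coordinates that no receiver sees. -/
def idleCoords (s : States M N) : Finset (Coord N M) :=
  {k | k.2.1 = if s k.1 k.2.2 then 1 else 0}

theorem mem_otherCoords {k : Coord N M} : k ∈ otherCoords N M ↔ k.2.1 = 2 := by
  simp [otherCoords]

theorem mem_idleCoords {s : States M N} {k : Coord N M} :
    k ∈ idleCoords s ↔ k.2.1 = if s k.1 k.2.2 then 1 else 0 := by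
  simp [idleCoords]

theorem univ_eq_coords_union (s : States M N) :
    (Finset.univ : Finset (Coord N M)) = ownCoords s ∪ (otherCoords N M ∪ idleCoords s) := by
  ext ⟨t, f, j⟩
  simp only [Finset.mem_univ, Finset.mem_union, mem_ownCoords, mem_otherCoords, mem_idleCoords,
    true_iff]
  by_cases h : s t j = true <;> fin_cases f <;> simp [h]

theorem disjoint_other_idle (s : States M N) : Disjoint (otherCoords N M) (idleCoords s) := by
  rw [Finset.disjoint_left]
  intro k h1 h2
  rw [mem_otherCoords] at h1
  rw [mem_idleCoords, h1] at h2
  revert h2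
  split_ifs <;> decide

theorem disjoint_own_other_idle (s : States M N) :
    Disjoint (ownCoords s) (otherCoords N M ∪ idleCoords s) := by
  rw [Finset.disjoint_left]
  intro k h1 h2
  rw [mem_ownCoords] at h1
  rw [Finset.mem_union, mem_otherCoords, mem_idleCoords, h1] at h2
  revert h2
  split_ifs <;> decide

/-- This is what makes the output of receiver `a` independent of both messages under the auxiliary
law. -/
theorem sumCenter_of_mem_ownCoords {w : Messages m} {s : States M N} {k : Coord N M}
    (hk : k ∈ ownCoords s) (x : Coord N M → ℂ) : c.sumCenter gD gI a w s k x = 0 := by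
  obtain ⟨t, f, j⟩ := k
  rw [mem_ownCoords] at hk
  by_cases h : s t j = true
  · obtain rfl : f = 0 := by simpa [h] using hk
    simp [sumCenter, h]
  · obtain rfl : f = 1 := by simpa [h] using hk
    rfl

theorem ignores_sumCenter_idle {w : Messages m} {s : States M N} {k k' : Coord N M}
    (hk : k ∈ idleCoords s) (h : k.1 ≤ k'.1) : Ignores (c.sumCenter gD gI a w s k) k' := by
  obtain ⟨t, f, j⟩ := k
  intro x z
  have h2 : c.otherInput a (w (other a)) s (Function.update x k' z) t
      = c.otherInput a (w (other a)) s x t :=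
    c.ignores_otherInput (fun r hr j' he => by subst he; exact absurd hr (not_lt.2 h)) x z
  rw [mem_idleCoords] at hk
  have hf : f ≠ 2 := by
    rintro rfl
    revert hk; dsimp only; split_ifs <;> decide
  fin_cases f
  · simp only [sumCenter, h2]
  · rfl
  · exact absurd rfl hf

/-- The estimate of the other output uses only the output and the input of user `a`. The whole
output of receiver `a` can thus be fixed first, even though the true other output depends on its own
feedback. -/
theorem ignores_sumCenter_other {w : Messages m} {s : States M N} {k k' : Coord N M}
    (hk : k ∈ otherCoords N M) (hk' : k' ∉ ownCoords s) :
    Ignores (c.sumCenter gD gI a w s k) k' := by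
  obtain ⟨t, f, j⟩ := k
  intro x z
  obtain rfl : f = 2 := mem_otherCoords.1 hk
  have h1 : c.ownInput a (w a) s (Function.update x k' z) t = c.ownInput a (w a) s x t :=
    c.ignores_ownInput (fun r hr j' he => by subst he; exact hk' (ownCoord_mem s r j')) x z
  by_cases h : s t j = true
  · have h3 : ((t, 0, j) : Coord N M) ≠ k' := by
      rintro rfl
      exact hk' (by simp [mem_ownCoords, h])
    simp only [sumCenter, h1, Function.update_of_ne h3]
  · simp only [sumCenter, h, if_false, Bool.false_eq_true]

/-- The idle coordinates keep their true conditional density, which reads the other message, but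
neither decoder reads them, so they are integrated out first. The factors of the other output then
depend on the message of `a` alone, so the other message can be summed. What remains is a
message-free density of the own output. -/
theorem sum_lintegral_sum_le (s : States M N) {θ : Fin (m a) → (Coord N M → ℂ) → ℝ≥0∞}
    (θm : ∀ w, Measurable (θ w)) (θr : ∀ w, ReadsOnly (ownCoords s) (θ w))
    {κ : ℝ≥0∞} (hθ : ∀ x, ∑ w, θ w x ≤ κ)
    {θ' : Fin (m (other a)) → (Coord N M → ℂ) → ℝ≥0∞}
    (θm' : ∀ w, Measurable (θ' w)) (θr' : ∀ w, ReadsOnly (otherCoords N M) (θ' w))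
    {κ' : ℝ≥0∞} (hθ' : ∀ x, ∑ w, θ' w x ≤ κ') :
    ∑ w : Messages m, ∫⁻ x, (θ (w a) x * θ' (w (other a)) x) * ∏ k, ENNReal.ofReal
      (gaussDensity (sumVar gD gI s k) (x k - c.sumCenter gD gI a w s k x)) ≤ κ' * κ := by
  set A := ownCoords s with hA
  set T := otherCoords N M with hT
  set U := idleCoords s with hU
  let g : Messages m → Coord N M → (Coord N M → ℂ) → ℝ≥0∞ := fun w k x => ENNReal.ofReal
    (gaussDensity (sumVar gD gI s k) (x k - c.sumCenter gD gI a w s k x))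
  have gm : ∀ w k, Measurable (g w k) := fun w k =>
    measurable_gaussDensity_sub (c.measurable_sumCenter gD gI a w s k) k _
  have gpm : ∀ w (B : Finset (Coord N M)), Measurable fun x => ∏ k ∈ B, g w k x :=
    fun w B => Finset.measurable_fun_prod _ fun k _ => gm w k
  let p : (Coord N M → ℂ) → ℝ≥0∞ := fun x => ∏ k ∈ A,
    ENNReal.ofReal (gaussDensity (sumVar gD gI s k) (x k))
  have hp : ∀ w x, ∏ k ∈ A, g w k x = p x := fun w x => Finset.prod_congr rfl fun k hk => by
    simp only [g, c.sumCenter_of_mem_ownCoords gD gI a hk, sub_zero]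
  have pm : Measurable p := Finset.measurable_fun_prod _ fun k _ => by fun_prop
  have pign : ∀ k ∉ A, Ignores p k := fun k hk x z =>
    Finset.prod_congr rfl fun k' hk' => by
      rw [Function.update_of_ne (by rintro rfl; exact hk hk')]
  have hAT : ∀ k ∈ T, k ∉ A := fun k hk hk' =>
    Finset.disjoint_left.1 (disjoint_own_other_idle s) hk' (Finset.mem_union_left _ hk)
  have hAU : ∀ k ∈ U, k ∉ A := fun k hk hk' =>
    Finset.disjoint_left.1 (disjoint_own_other_idle s) hk' (Finset.mem_union_right _ hk)
  have hTU : ∀ k ∈ U, k ∉ T := fun k hk hk' =>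
    Finset.disjoint_left.1 (disjoint_other_idle s) hk' hk
  have hm1 : ∀ w, Measurable fun x => θ (w a) x * θ' (w (other a)) x * (p x * ∏ k ∈ T, g w k x) :=
    fun w => ((θm _).mul (θm' _)).mul (pm.mul (gpm w T))
  let x₀ : Coord N M → ℂ := 0
  have step1 : ∀ w : Messages m, ∫⁻ x, (θ (w a) x * θ' (w (other a)) x) * ∏ k, g w k x
      ≤ (∫⋯∫⁻_A, ∫⋯∫⁻_T, (fun x => θ (w a) x * θ' (w (other a)) x
        * (p x * ∏ k ∈ T, g w k x))) x₀ := by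
    intro w
    have hfull : Measurable fun x => (θ (w a) x * θ' (w (other a)) x) * ∏ k, g w k x :=
      ((θm _).mul (θm' _)).mul (gpm w Finset.univ)
    rw [volume_pi, lintegral_eq_lmarginal_univ x₀, univ_eq_coords_union s, lmarginal_union _ _
      (by rw [← univ_eq_coords_union s]; exact hfull) (disjoint_own_other_idle s),
      lmarginal_union _ _ (by rw [← univ_eq_coords_union s]; exact hfull) (disjoint_other_idle s)]
    refine lmarginal_mono (lmarginal_mono ?_) x₀
    refine le_trans (le_of_eq ?_) (lmarginal_mul_prod_gaussDensity_le U (fun k => (k.1 : ℕ))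
      (hm1 w) (fun k hk x z => ?_) (sumVar_pos gD gI s) (c.measurable_sumCenter gD gI a w s)
      fun k hk k' hk' hr => c.ignores_sumCenter_idle gD gI a hk (by exact_mod_cast hr))
    · congr 1
      funext x
      rw [Finset.prod_union (disjoint_own_other_idle s), Finset.prod_union (disjoint_other_idle s),
        hp, ← mul_assoc, ← mul_assoc, ← mul_assoc]
    · simp only [θr _ k (hAU k hk) x z, θr' _ k (hTU k hk) x z, pign k (hAU k hk) x z]
      congr 2
      refine Finset.prod_congr rfl fun k' hk' => ?_
      exact (c.ignores_sumCenter_other gD gI a hk' (hAU k hk)).gaussDensity_sub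
        (by rintro rfl; exact hTU k hk hk') _ x z
  refine (Finset.sum_le_sum fun w _ => step1 w).trans ?_
  rw [sum_messages a]
  simp only [messagesEquiv_symm_self, messagesEquiv_symm_other]
  refine le_trans (Finset.sum_le_sum fun w _ => ?_)
    (sum_lmarginal_ownCoords_le s (sumVar_pos gD gI s) (θ := fun w x => κ' * θ w x)
      (fun w => (θm w).const_mul _) (κ := κ' * κ)
      (fun x => by rw [← Finset.mul_sum]; gcongr; exact hθ x) x₀)
  rcases isEmpty_or_nonempty (Fin (m (other a))) with he | ⟨⟨y₀⟩⟩
  · simp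
  have hgT : ∀ y k, k ∈ T → g ((messagesEquiv m a).symm (w, y)) k
      = g ((messagesEquiv m a).symm (w, y₀)) k := by
    rintro y ⟨t, f, j⟩ hk
    obtain rfl : f = 2 := mem_otherCoords.1 hk
    funext x
    simp only [g, sumCenter, messagesEquiv_symm_self]
  have hpT : ∀ y x, ∏ k ∈ T, g ((messagesEquiv m a).symm (w, y)) k x
      = ∏ k ∈ T, g ((messagesEquiv m a).symm (w, y₀)) k x := fun y x =>
    Finset.prod_congr rfl fun k hk => congrFun (hgT y k hk) x
  simp only [hpT]
  set G : (Coord N M → ℂ) → ℝ≥0∞ := fun x => ∏ k ∈ T, g ((messagesEquiv m a).symm (w, y₀)) k x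
  have Gm : Measurable G := gpm _ T
  have hm2 : ∀ y, Measurable fun x => θ w x * θ' y x * (p x * G x) :=
    fun y => ((θm _).mul (θm' _)).mul (pm.mul Gm)
  have h3 := congrFun (lmarginal_finsetSum A Finset.univ
    (fun y => ∫⋯∫⁻_T, (fun x => θ w x * θ' y x * (p x * G x))) fun y => (hm2 y).lmarginal _) x₀
  refine h3.symm.trans_le (lmarginal_mono (fun x => ?_) x₀)
  have h4 := congrFun (lmarginal_finsetSum T Finset.univ
    (fun y x => θ w x * θ' y x * (p x * G x)) hm2) x
  refine h4.symm.trans_le ?_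
  have h5 := lmarginal_mul_prod_gaussDensity_le T (fun _ => 0)
    (h := fun x => κ' * θ w x * p x) (((θm w).const_mul _).mul pm)
    (fun k hk x z => by simp only [θr w k (hAT k hk) x z, pign k (hAT k hk) x z])
    (sumVar_pos gD gI s) (c.measurable_sumCenter gD gI a ((messagesEquiv m a).symm (w, y₀)) s)
    (fun k hk k' hk' _ => c.ignores_sumCenter_other gD gI a hk (hAT k' hk'))
  refine le_trans (lmarginal_mono (fun x => ?_) x) (h5 x)
  change _ ≤ κ' * θ w x * p x * G x
  rw [← Finset.sum_mul, ← Finset.mul_sum, mul_assoc _ (p x), mul_comm κ']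
  gcongr
  exact hθ' x

end SumRate

end Code

namespace Code

variable (c : Code M N m) (gD gI : Fin M → ℂ) (a : Fin 2)

/-! ### Auxiliary densities for the weighted bound -/

section Weighted

/-- The conditional density of an output coordinate given the lower ones, the message of user `a`
and the states, when the message of the other user is averaged out. -/
def condDensity (w : Fin (m a)) (s : States M N) (k : Coord N M) (x : Coord N M → ℂ) : ℝ :=
  mixDensity (fun w' => c.coordDensity gD gI a ((messagesEquiv m a).symm (w, w')) s) coordRank k x

/-- The auxiliary density for the rate of user `a`, in the weighted bound. -/
def ownAux (w : Messages m) (s : States M N) (k : Coord N M) (x : Coord N M → ℂ) : ℝ :=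
  c.coordDensity gD gI a w s k x * if k ∈ ownCoords s then
    gaussDensity (sumVar gD gI s k) (x k) / c.condDensity gD gI a (w a) s k x else 1

/-- The estimate of the output of the other receiver, in the weighted bound. -/
def mmseCenter (w : Messages m) (s : States M N) (t : Fin N) (j : Fin M) (x : Coord N M → ℂ) : ℂ :=
  (if s t j then gI j * c.ownInput a (w a) s x t j else 0)
    + mmseCoeff gD gI j * (x (t, 0, j) - if s t j then gD j * c.ownInput a (w a) s x t j else 0)

/-- The auxiliary density for the rate of the other user, in the weighted bound. -/
def otherAux (w : Messages m) (s : States M N) (k : Coord N M) (x : Coord N M → ℂ) : ℝ :=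
  match k with
  | (t, 0, j) => c.condDensity gD gI a (w a) s (t, 0, j) x
  | (t, 1, j) => c.coordDensity gD gI a w s (t, 1, j) x
  | (t, 2, j) => gaussDensity (varCond gD gI j) (x (t, 2, j) - c.mmseCenter gD gI a w s t j x)

theorem ignores_coordDensity {w : Messages m} {s : States M N} {k k' : Coord N M} (hne : k' ≠ k)
    (h : coordRank k ≤ coordRank k') : Ignores (c.coordDensity gD gI a w s k) k' := by
  intro x z
  unfold coordDensity
  rw [c.ignores_drift gD gI (time_le_of_coordRank_le h) x z, Function.update_of_ne hne.symm]

theorem lintegral_coordDensity_update (w : Messages m) (s : States M N) (k : Coord N M)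
    (x : Coord N M → ℂ) :
    ∫⁻ v, ENNReal.ofReal (c.coordDensity gD gI a w s k (Function.update x k v)) = 1 :=
  lintegral_gaussDensity_update one_pos (c.ignores_drift gD gI le_rfl) x

theorem condDensity_pos [∀ i, NeZero (m i)] (w : Fin (m a)) (s : States M N) (k : Coord N M)
    (x : Coord N M → ℂ) :
    0 < c.condDensity gD gI a w s k x :=
  mixDensity_pos (fun _ _ _ => c.coordDensity_pos gD gI a _ s _ _) k x

theorem measurable_condDensity (w : Fin (m a)) (s : States M N) (k : Coord N M) :
    Measurable (c.condDensity gD gI a w s k) :=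
  measurable_mixDensity (fun _ _ => c.measurable_coordDensity gD gI a _ s _) k

theorem lintegral_condDensity_update [∀ i, NeZero (m i)] (w : Fin (m a)) (s : States M N)
    (k : Coord N M)
    (x : Coord N M → ℂ) :
    ∫⁻ v, ENNReal.ofReal (c.condDensity gD gI a w s k (Function.update x k v)) = 1 :=
  lintegral_mixDensity
    (φ := fun w' => c.coordDensity gD gI a ((messagesEquiv m a).symm (w, w')) s)
    (fun _ _ _ => c.coordDensity_pos gD gI a _ s _ _) coordRank_injective
    (fun _ _ => c.measurable_coordDensity gD gI a _ s _)
    (fun _ _ _ hne h => c.ignores_coordDensity gD gI a hne h)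
    (fun _ => c.lintegral_coordDensity_update gD gI a _ s k x)

theorem ignores_condDensity {w : Fin (m a)} {s : States M N} {k k' : Coord N M} (hne : k' ≠ k)
    (h : coordRank k ≤ coordRank k') : Ignores (c.condDensity gD gI a w s k) k' := by
  refine Ignores.mixDensity fun w' l hl => c.ignores_coordDensity gD gI a ?_ (hl.trans h)
  rintro rfl
  exact hne (coordRank_injective (le_antisymm hl h))

theorem ownAux_pos [∀ i, NeZero (m i)] (w : Messages m) (s : States M N) (k : Coord N M)
    (x : Coord N M → ℂ) :
    0 < c.ownAux gD gI a w s k x := by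
  have h1 := c.coordDensity_pos gD gI a w s k x
  have h2 := c.condDensity_pos gD gI a (w a) s k x
  have h3 := gaussDensity_pos (sumVar_pos gD gI s k) (x k)
  unfold ownAux
  split_ifs <;> positivity

theorem otherAux_pos [∀ i, NeZero (m i)] (w : Messages m) (s : States M N) (k : Coord N M)
    (x : Coord N M → ℂ) :
    0 < c.otherAux gD gI a w s k x := by
  obtain ⟨t, f, j⟩ := k
  fin_cases f
  · exact c.condDensity_pos gD gI a (w a) s _ x
  · exact c.coordDensity_pos gD gI a w s _ x
  · exact gaussDensity_pos (varCond_pos gD gI j) _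

theorem measurable_ownAux (w : Messages m) (s : States M N) (k : Coord N M) :
    Measurable (c.ownAux gD gI a w s k) := by
  have h1 := c.measurable_coordDensity gD gI a w s k
  have h2 := c.measurable_condDensity gD gI a (w a) s k
  unfold ownAux
  split_ifs
  · exact h1.mul (((measurable_gaussDensity _).comp (measurable_pi_apply k)).div h2)
  · exact h1.mul measurable_const

theorem measurable_mmseCenter (w : Messages m) (s : States M N) (t : Fin N) (j : Fin M) :
    Measurable (c.mmseCenter gD gI a w s t j) := by
  have h1 := (measurable_pi_apply j).comp (c.measurable_ownInput a (w a) s t)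
  simp only [Function.comp_def] at h1
  unfold mmseCenter
  split_ifs <;> fun_prop

theorem measurable_otherAux (w : Messages m) (s : States M N) (k : Coord N M) :
    Measurable (c.otherAux gD gI a w s k) := by
  obtain ⟨t, f, j⟩ := k
  change Measurable fun x => c.otherAux gD gI a w s (t, f, j) x
  fin_cases f
  · exact c.measurable_condDensity gD gI a (w a) s _
  · exact c.measurable_coordDensity gD gI a w s _
  · exact (measurable_gaussDensity _).comp
      ((measurable_pi_apply _).sub (c.measurable_mmseCenter gD gI a w s t j))

/-- The estimate reads the current field `0` whether or not interference is present, so field `0`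
must come before field `2` in the order. -/
theorem ignores_mmseCenter {w : Messages m} {s : States M N} {t : Fin N} {j : Fin M}
    {k' : Coord N M} (h : 2 + 3 * (t : ℕ) ≤ k'.2.1 + 3 * k'.1) :
    Ignores (c.mmseCenter gD gI a w s t j) k' := by
  intro x z
  have hk := k'.2.1.2
  have h1 : c.ownInput a (w a) s (Function.update x k' z) t = c.ownInput a (w a) s x t :=
    c.ignores_ownInput (fun r hr j' he => by
      subst he
      have : (r : ℕ) < t := hr
      simp only [ownCoord] at h hk
      omega) x z
  have h3 : ((t, 0, j) : Coord N M) ≠ k' := by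
    rintro rfl
    simp at h
  simp only [mmseCenter, h1, Function.update_of_ne h3]

theorem lintegral_prod_otherAux_le_one [∀ i, NeZero (m i)] (w : Messages m) (s : States M N) :
    ∫⁻ x, ∏ k, ENNReal.ofReal (c.otherAux gD gI a w s k x) ≤ 1 := by
  refine lintegral_prod_le_one coordRank _
    (fun k => ENNReal.measurable_ofReal.comp (c.measurable_otherAux gD gI a w s k)) ?_ ?_
  · rintro ⟨t, f, j⟩ k' hne h x z
    have h1 := field_le_of_coordRank_le h
    fin_cases f
    · exact congrArg _ (c.ignores_condDensity gD gI a hne h x z)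
    · exact congrArg _ (c.ignores_coordDensity gD gI a hne h x z)
    · exact (c.ignores_mmseCenter gD gI a h1).gaussDensity_sub hne _ x z
  · rintro ⟨t, f, j⟩ x
    fin_cases f
    · exact (c.lintegral_condDensity_update gD gI a (w a) s _ x).le
    · exact (c.lintegral_coordDensity_update gD gI a w s _ x).le
    · exact (lintegral_gaussDensity_update (varCond_pos gD gI j)
        (c.ignores_mmseCenter gD gI a (k' := (t, 2, j)) le_rfl) x).le

/-- No factor reads the other message: it is averaged out in field `0`, absent from the drift in
field `1`, and absent from the estimate in field `2`. -/
theorem sum_lintegral_other_le [∀ i, NeZero (m i)] (s : States M N)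
    {θ : Fin (m (other a)) → (Coord N M → ℂ) → ℝ≥0∞}
    (θm : ∀ w, Measurable (θ w)) {κ : ℝ≥0∞} (hθ : ∀ x, ∑ w, θ w x ≤ κ) :
    ∑ w : Messages m, ∫⁻ x, θ (w (other a)) x * ∏ k, ENNReal.ofReal (c.otherAux gD gI a w s k x)
      ≤ m (other (other a)) * κ := by
  refine sum_lintegral_mul_le (other a) (fun w w' h => ?_) (fun w =>
    Finset.measurable_fun_prod _ fun k _ =>
      ENNReal.measurable_ofReal.comp (c.measurable_otherAux gD gI a w s k))
    (fun w => c.lintegral_prod_otherAux_le_one gD gI a w s) θm hθ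
  rw [other_other] at h
  funext x
  refine Finset.prod_congr rfl fun k _ => congrArg ENNReal.ofReal ?_
  obtain ⟨t, f, j⟩ := k
  fin_cases f <;> simp only [otherAux, coordDensity, drift, mmseCenter, h]

/-- By the chain rule for the mixture, the sum over the other message turns the true density into `∏
condDensity`; the denominators built into `ownAux` then cancel on the own coordinates. -/
theorem sum_prod_ownAux [∀ i, NeZero (m i)] (w : Fin (m a)) (s : States M N) (x : Coord N M → ℂ) :
    ∑ w', ∏ k, c.ownAux gD gI a ((messagesEquiv m a).symm (w, w')) s k x
      = m (other a) * ((∏ k ∈ ownCoords s, gaussDensity (sumVar gD gI s k) (x k))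
        * ∏ k ∈ (ownCoords s)ᶜ, c.condDensity gD gI a w s k x) := by
  have h1 : ∀ w', ∏ k, c.ownAux gD gI a ((messagesEquiv m a).symm (w, w')) s k x
      = (∏ k, c.coordDensity gD gI a ((messagesEquiv m a).symm (w, w')) s k x)
        * ∏ k ∈ ownCoords s, gaussDensity (sumVar gD gI s k) (x k)
          / c.condDensity gD gI a w s k x := by
    intro w'
    simp only [ownAux, messagesEquiv_symm_self]
    rw [Finset.prod_mul_distrib, Finset.prod_ite_mem, Finset.univ_inter]
  simp only [h1]
  rw [← Finset.sum_mul, sum_prod_eq_card_mul_prod_mixDensity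
    (φ := fun w' => c.coordDensity gD gI a ((messagesEquiv m a).symm (w, w')) s)
    (fun _ _ _ => c.coordDensity_pos gD gI a _ s _ _) coordRank_injective, Fintype.card_fin]
  change m (other a) * (∏ k, c.condDensity gD gI a w s k x) * _ = _
  rw [← Finset.prod_mul_prod_compl (ownCoords s), Finset.prod_div_distrib]
  have h2 : ∏ k ∈ ownCoords s, c.condDensity gD gI a w s k x ≠ 0 :=
    Finset.prod_ne_zero_iff.2 fun k _ => (c.condDensity_pos gD gI a w s k x).ne'
  field_simp

/-- After the other message is summed, the conditional densities off the own coordinates integrate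
out in rank order, since the decision of receiver `a` does not read them. A product Gaussian law
free of messages is left on the own output. -/
theorem sum_lintegral_own_le [∀ i, NeZero (m i)] (s : States M N)
    {θ : Fin (m a) → (Coord N M → ℂ) → ℝ≥0∞}
    (θm : ∀ w, Measurable (θ w)) (θr : ∀ w, ReadsOnly (ownCoords s) (θ w))
    {κ : ℝ≥0∞} (hθ : ∀ x, ∑ w, θ w x ≤ κ) :
    ∑ w : Messages m, ∫⁻ x, θ (w a) x * ∏ k, ENNReal.ofReal (c.ownAux gD gI a w s k x)
      ≤ m (other a) * κ := by
  let x₀ : Coord N M → ℂ := 0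
  let p : (Coord N M → ℂ) → ℝ≥0∞ := fun x => ∏ k ∈ ownCoords s,
    ENNReal.ofReal (gaussDensity (sumVar gD gI s k) (x k))
  have pm : Measurable p := Finset.measurable_fun_prod _ fun k _ => by fun_prop
  have pign : ∀ k ∉ ownCoords s, Ignores p k := fun k hk x z =>
    Finset.prod_congr rfl fun k' hk' => by
      rw [Function.update_of_ne (by rintro rfl; exact hk hk')]
  have qm : ∀ w, Measurable fun x => ∏ k, ENNReal.ofReal (c.ownAux gD gI a w s k x) := fun w =>
    Finset.measurable_fun_prod _ fun k _ =>
      ENNReal.measurable_ofReal.comp (c.measurable_ownAux gD gI a w s k)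
  have cm : ∀ (w : Fin (m a)) k, Measurable fun x => ENNReal.ofReal (c.condDensity gD gI a w s k x)
    :=
    fun w k => ENNReal.measurable_ofReal.comp (c.measurable_condDensity gD gI a w s k)
  rw [sum_messages a]
  simp only [messagesEquiv_symm_self]
  refine le_trans (Finset.sum_le_sum fun w _ => ?_)
    (sum_lmarginal_ownCoords_le s (sumVar_pos gD gI s) (θ := fun w x => m (other a) * θ w x)
      (fun w => (θm w).const_mul _) (κ := m (other a) * κ)
      (fun x => by rw [← Finset.mul_sum]; gcongr; exact hθ x) x₀)
  have hm : ∀ w', Measurable fun x => θ w x * ∏ k,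
      ENNReal.ofReal (c.ownAux gD gI a ((messagesEquiv m a).symm (w, w')) s k x) :=
    fun w' => (θm w).mul (qm _)
  rw [← lintegral_finsetSum _ fun w' _ => hm w']
  have heq : ∀ x, ∑ w', θ w x * ∏ k,
      ENNReal.ofReal (c.ownAux gD gI a ((messagesEquiv m a).symm (w, w')) s k x)
      = (m (other a) * θ w x * p x)
        * ∏ k ∈ (ownCoords s)ᶜ, ENNReal.ofReal (c.condDensity gD gI a w s k x) := by
    intro x
    rw [← Finset.mul_sum]
    simp only [← ENNReal.ofReal_prod_of_nonneg fun k _ => (c.ownAux_pos gD gI a _ s k x).le]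
    rw [← ENNReal.ofReal_sum_of_nonneg fun w' _ =>
      Finset.prod_nonneg fun k _ => (c.ownAux_pos gD gI a _ s k x).le, sum_prod_ownAux,
      ENNReal.ofReal_mul (by positivity), ENNReal.ofReal_natCast, ENNReal.ofReal_mul
        (Finset.prod_nonneg fun k _ => (gaussDensity_pos (sumVar_pos gD gI s k) _).le),
      ENNReal.ofReal_prod_of_nonneg fun k _ => (gaussDensity_pos (sumVar_pos gD gI s k) _).le,
      ENNReal.ofReal_prod_of_nonneg fun k _ => (c.condDensity_pos gD gI a w s k x).le]
    simp only [p]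
    ring
  simp only [heq]
  have hm0 : Measurable fun x => (m (other a) : ℝ≥0∞) * θ w x * p x := ((θm w).const_mul _).mul pm
  have hfull : Measurable fun x => (m (other a) * θ w x * p x)
        * ∏ k ∈ (ownCoords s)ᶜ, ENNReal.ofReal (c.condDensity gD gI a w s k x) :=
    hm0.mul (Finset.measurable_fun_prod _ fun k _ => cm w k)
  rw [volume_pi, lintegral_eq_lmarginal_univ x₀, ← Finset.union_compl (ownCoords s),
    lmarginal_union _ _ hfull disjoint_compl_right]
  refine lmarginal_mono (lmarginal_mul_prod_le _ coordRank _ _ hm0 (fun k _ => cm w k)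
    (fun k hk x z => ?_) (fun k _ k' _ hne h x z => congrArg _
      (c.ignores_condDensity gD gI a hne h x z))
    (fun k _ x => (c.lintegral_condDensity_update gD gI a w s k x).le)) x₀
  have hk' := Finset.mem_compl.1 hk
  simp only [θr w k hk' x z, pign k hk' x z]

end Weighted

end Code

/-! ### Converse inequalities from the auxiliary densities -/

namespace Code

variable (c : Code M N m) (gD gI : Fin M → ℂ) (a : Fin 2)

/-- The event that receiver `i` decodes correctly. -/
def correct (i : Fin 2) : Set (ExtOutcome M N m) :=
  {ω | c.dec i (fun t => c.output gD gI (toOutcome a ω) t i, ω.2.1) = ω.1 i}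

/-- The decision of receiver `a`, as a function of the output coordinates. -/
def ownDecision (s : States M N) (x : Coord N M → ℂ) : Fin (m a) :=
  c.dec a (fun t j => x (ownCoord s t j), s)

/-- The decision of the other receiver, as a function of the output coordinates. -/
def otherDecision (s : States M N) (x : Coord N M → ℂ) : Fin (m (other a)) :=
  c.dec (other a) (fun t j => x (t, 2, j), s)

theorem correct_own : c.correct gD gI a a
    = {ω | c.ownDecision a ω.2.1 (c.extOutput gD gI a ω) = ω.1 a} := by
  simp only [correct, ownDecision, extOutput_ownCoord]

theorem correct_other : c.correct gD gI a (other a)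
    = {ω | c.otherDecision a ω.2.1 (c.extOutput gD gI a ω) = ω.1 (other a)} := by
  simp only [correct, otherDecision, extOutput_two]

theorem measurable_ownDecision (s : States M N) : Measurable (c.ownDecision a s) :=
  (c.measurable_dec a).comp (by fun_prop)

theorem measurable_otherDecision (s : States M N) : Measurable (c.otherDecision a s) :=
  (c.measurable_dec (other a)).comp (by fun_prop)

theorem measurableSet_of_sections {S : Set (ExtOutcome M N m)}
    (h : ∀ w s, MeasurableSet {u | (w, s, u) ∈ S}) : MeasurableSet S :=
  measurableSet_setOfPred.2 (measurable_of_sections fun w s => measurableSet_setOfPred.1 (h w s))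

theorem measurableSet_extOutput_mem {D : Messages m → States M N → Set (Coord N M → ℂ)}
    (hD : ∀ w s, MeasurableSet (D w s)) :
    MeasurableSet {ω | c.extOutput gD gI a ω ∈ D ω.1 ω.2.1} :=
  measurableSet_of_sections fun w s =>
    ((c.measurable_extOutput gD gI a).comp (by fun_prop : Measurable fun u => (w, s, u))) (hD w s)

theorem measurableSet_decision_eq {n : ℕ} {d : (Coord N M → ℂ) → Fin n} (hd : Measurable d)
    (w : Fin n) : MeasurableSet {x | d x = w} :=
  hd (measurableSet_singleton w)

/-- A converse bound from an auxiliary joint density of the output coordinates. -/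
theorem measureReal_mul_log_add_integral_logRatio_le (ν : Measure (Fin M → Bool))
    [IsProbabilityMeasure ν] [∀ i, NeZero (m i)]
    {q : Messages m → States M N → Coord N M → (Coord N M → ℂ) → ℝ}
    (hq : ∀ w s k x, 0 < q w s k x) (qm : ∀ w s k, Measurable (q w s k))
    (hint : Integrable (c.logRatio gD gI a q) (extLaw ν N m)) {n : ℝ} (hn : 0 < n)
    {D : Messages m → States M N → Set (Coord N M → ℂ)} (hD : ∀ w s, MeasurableSet (D w s))
    (h1 : ∀ s, ∑ w, ∫⁻ x, 1 * ∏ k, ENNReal.ofReal (q w s k x) ≤ Fintype.card (Messages m))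
    (h2 : ∀ s, ∑ w, ∫⁻ x, (D w s).indicator 1 x * ∏ k, ENNReal.ofReal (q w s k x)
      ≤ Fintype.card (Messages m) * ENNReal.ofReal n⁻¹) :
    (extLaw ν N m).real {ω | c.extOutput gD gI a ω ∈ D ω.1 ω.2.1} * Real.log n
      + ∫ ω, c.logRatio gD gI a q ω ∂(extLaw ν N m) ≤ 1 := by
  have hc : (Fintype.card (Messages m) : ℝ≥0∞) ≠ 0 := by
    exact_mod_cast (Fintype.card_pos (α := Messages m)).ne'
  have hc' : (Fintype.card (Messages m) : ℝ≥0∞) ≠ ⊤ := ENNReal.natCast_ne_top _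
  refine measureReal_mul_log_add_integral_le _ _ hint (c.measurableSet_extOutput_mem gD gI a hD) hn
    ?_ ?_
  · have h := c.lintegral_mul_exp_logRatio_le gD gI a ν hq qm (θ := fun _ _ _ => 1)
      (fun _ _ => measurable_const) h1
    rw [ENNReal.inv_mul_cancel hc hc'] at h
    simpa only [one_mul] using h
  · have h := c.lintegral_mul_exp_logRatio_le gD gI a ν hq qm
      (θ := fun w s => (D w s).indicator 1) (fun w s => measurable_one.indicator (hD w s)) h2
    rw [← mul_assoc, ENNReal.inv_mul_cancel hc hc', one_mul] at h
    exact h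

theorem natCast_mul_ofReal_inv {k l : ℕ} [NeZero k] :
    ((k * l : ℕ) : ℝ≥0∞) * ENNReal.ofReal (k : ℝ)⁻¹ = l := by
  have hk : 0 < (k : ℝ) := by exact_mod_cast NeZero.pos k
  rw [← ENNReal.ofReal_natCast, ← ENNReal.ofReal_mul (by positivity), ← ENNReal.ofReal_natCast]
  congr 1
  push_cast
  field_simp

theorem sum_indicator_decision_le {n : ℕ} (d : (Coord N M → ℂ) → Fin n) (x : Coord N M → ℂ) :
    ∑ w, ({x | d x = w} : Set _).indicator (1 : (Coord N M → ℂ) → ℝ≥0∞) x ≤ 1 := by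
  simp [Set.indicator_apply]

theorem readsOnly_indicator_ownDecision (s : States M N) (w : Fin (m a)) :
    ReadsOnly (ownCoords s) (({x | c.ownDecision a s x = w} : Set _).indicator
      (1 : (Coord N M → ℂ) → ℝ≥0∞)) := by
  intro k hk x z
  have : c.ownDecision a s (Function.update x k z) = c.ownDecision a s x := by
    unfold ownDecision
    congr 2
    funext t j
    exact Function.update_of_ne (by rintro rfl; exact hk (ownCoord_mem s t j)) _ _
  simp only [Set.indicator_apply, Set.mem_ofPred_eq, this, Pi.one_apply]

theorem readsOnly_indicator_otherDecision (s : States M N) (w : Fin (m (other a))) :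
    ReadsOnly (otherCoords N M) (({x | c.otherDecision a s x = w} : Set _).indicator
      (1 : (Coord N M → ℂ) → ℝ≥0∞)) := by
  intro k hk x z
  have : c.otherDecision a s (Function.update x k z) = c.otherDecision a s x := by
    unfold otherDecision
    congr 2
    funext t j
    exact Function.update_of_ne (by rintro rfl; exact hk (mem_otherCoords.2 rfl)) _ _
  simp only [Set.indicator_apply, Set.mem_ofPred_eq, this, Pi.one_apply]

/-- The auxiliary density for the cut-set bound. -/
def cutAux (w : Messages m) (s : States M N) (k : Coord N M) (x : Coord N M → ℂ) : ℝ :=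
  gaussDensity (cutVar gD gI s k) (x k - c.cutCenter gD gI a w s k x)

/-- The auxiliary density for the sum-rate bound. -/
def sumAux (w : Messages m) (s : States M N) (k : Coord N M) (x : Coord N M → ℂ) : ℝ :=
  gaussDensity (sumVar gD gI s k) (x k - c.sumCenter gD gI a w s k x)

variable (ν : Measure (Fin M → Bool)) [IsProbabilityMeasure ν] [∀ i, NeZero (m i)]

theorem sum_one_le {n : ℕ} (x : Coord N M → ℂ) :
    ∑ _w : Fin n, (1 : (Coord N M → ℂ) → ℝ≥0∞) x ≤ n := by simp

theorem converse_cut (hint : Integrable (c.logRatio gD gI a (c.cutAux gD gI a)) (extLaw ν N m)) :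
    (extLaw ν N m).real (c.correct gD gI a a) * Real.log (m a)
      + ∫ ω, c.logRatio gD gI a (c.cutAux gD gI a) ω ∂(extLaw ν N m) ≤ 1 := by
  rw [correct_own]
  refine c.measureReal_mul_log_add_integral_logRatio_le gD gI a ν
    (D := fun w s => {x | c.ownDecision a s x = w a})
    (fun w s k x => gaussDensity_pos (cutVar_pos gD gI s k) _)
    (fun w s k => (measurable_gaussDensity _).comp
      ((measurable_pi_apply k).sub (c.measurable_cutCenter gD gI a w s k))) hint
    (by exact_mod_cast NeZero.pos (m a))
    (fun w s => measurableSet_decision_eq (c.measurable_ownDecision a s) _)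
    (fun s => ?_) fun s => ?_
  · refine (c.sum_lintegral_cut_le gD gI a s (θ := fun _ => 1) (fun _ => measurable_one)
      (sum_one_le)).trans (le_of_eq ?_)
    rw [card_messages a, mul_comm, Nat.cast_mul]
  · refine (c.sum_lintegral_cut_le gD gI a s
      (fun w => measurable_one.indicator (measurableSet_decision_eq (c.measurable_ownDecision a s)
        w))
      (sum_indicator_decision_le (c.ownDecision a s))).trans (le_of_eq ?_)
    rw [card_messages a, natCast_mul_ofReal_inv, mul_one]

theorem converse_own (hint : Integrable (c.logRatio gD gI a (c.ownAux gD gI a)) (extLaw ν N m)) :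
    (extLaw ν N m).real (c.correct gD gI a a) * Real.log (m a)
      + ∫ ω, c.logRatio gD gI a (c.ownAux gD gI a) ω ∂(extLaw ν N m) ≤ 1 := by
  rw [correct_own]
  refine c.measureReal_mul_log_add_integral_logRatio_le gD gI a ν
    (D := fun w s => {x | c.ownDecision a s x = w a})
    (c.ownAux_pos gD gI a) (c.measurable_ownAux gD gI a) hint
    (by exact_mod_cast NeZero.pos (m a))
    (fun w s => measurableSet_decision_eq (c.measurable_ownDecision a s) _)
    (fun s => ?_) fun s => ?_
  · refine (c.sum_lintegral_own_le gD gI a s (θ := fun _ => 1) (fun _ => measurable_one)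
      (fun _ _ _ _ _ => rfl) (sum_one_le)).trans (le_of_eq ?_)
    rw [card_messages a, mul_comm, Nat.cast_mul]
  · refine (c.sum_lintegral_own_le gD gI a s
      (fun w => measurable_one.indicator (measurableSet_decision_eq (c.measurable_ownDecision a s)
        w))
      (c.readsOnly_indicator_ownDecision a s)
      (sum_indicator_decision_le (c.ownDecision a s))).trans (le_of_eq ?_)
    rw [card_messages a, natCast_mul_ofReal_inv, mul_one]

theorem converse_other
    (hint : Integrable (c.logRatio gD gI a (c.otherAux gD gI a)) (extLaw ν N m)) :
    (extLaw ν N m).real (c.correct gD gI a (other a)) * Real.log (m (other a))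
      + ∫ ω, c.logRatio gD gI a (c.otherAux gD gI a) ω ∂(extLaw ν N m) ≤ 1 := by
  rw [correct_other]
  refine c.measureReal_mul_log_add_integral_logRatio_le gD gI a ν
    (D := fun w s => {x | c.otherDecision a s x = w (other a)})
    (c.otherAux_pos gD gI a) (c.measurable_otherAux gD gI a) hint
    (by exact_mod_cast NeZero.pos (m (other a)))
    (fun w s => measurableSet_decision_eq (c.measurable_otherDecision a s) _)
    (fun s => ?_) fun s => ?_
  · refine (c.sum_lintegral_other_le gD gI a s (θ := fun _ => 1) (fun _ => measurable_one)
      (sum_one_le)).trans (le_of_eq ?_)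
    rw [card_messages (other a), mul_comm, Nat.cast_mul]
  · refine (c.sum_lintegral_other_le gD gI a s
      (fun w => measurable_one.indicator
        (measurableSet_decision_eq (c.measurable_otherDecision a s) w))
      (sum_indicator_decision_le (c.otherDecision a s))).trans (le_of_eq ?_)
    rw [card_messages (other a), natCast_mul_ofReal_inv, mul_one]

/-- The pair of messages is treated as one message with `m a * m (other a)` values, decoded
correctly when both receivers are right. -/
theorem converse_sum (hint : Integrable (c.logRatio gD gI a (c.sumAux gD gI a)) (extLaw ν N m)) :
    (extLaw ν N m).real (c.correct gD gI a a ∩ c.correct gD gI a (other a))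
        * Real.log (m a * m (other a))
      + ∫ ω, c.logRatio gD gI a (c.sumAux gD gI a) ω ∂(extLaw ν N m) ≤ 1 := by
  have hma : 0 < (m a : ℝ) := by exact_mod_cast NeZero.pos (m a)
  have hmb : 0 < (m (other a) : ℝ) := by exact_mod_cast NeZero.pos (m (other a))
  rw [correct_own, correct_other]
  refine c.measureReal_mul_log_add_integral_logRatio_le gD gI a ν
    (D := fun w s => {x | c.ownDecision a s x = w a} ∩ {x | c.otherDecision a s x = w (other a)})
    (fun w s k x => gaussDensity_pos (sumVar_pos gD gI s k) _)
    (fun w s k => (measurable_gaussDensity _).comp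
      ((measurable_pi_apply k).sub (c.measurable_sumCenter gD gI a w s k))) hint
    (by positivity)
    (fun w s => (measurableSet_decision_eq (c.measurable_ownDecision a s) _).inter
      (measurableSet_decision_eq (c.measurable_otherDecision a s) _))
    (fun s => ?_) fun s => ?_
  · have h := c.sum_lintegral_sum_le gD gI a s (θ := fun _ => 1) (fun _ => measurable_one)
      (fun _ _ _ _ _ => rfl) (sum_one_le) (θ' := fun _ => 1) (fun _ => measurable_one)
      (fun _ _ _ _ _ => rfl) (sum_one_le)
    simp only [Pi.one_apply, mul_one] at h
    refine h.trans (le_of_eq ?_)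
    rw [card_messages a, mul_comm, Nat.cast_mul]
  · have h := c.sum_lintegral_sum_le gD gI a s
      (fun w => measurable_one.indicator (measurableSet_decision_eq (c.measurable_ownDecision a s)
        w))
      (c.readsOnly_indicator_ownDecision a s)
      (sum_indicator_decision_le (c.ownDecision a s))
      (fun w => measurable_one.indicator
        (measurableSet_decision_eq (c.measurable_otherDecision a s) w))
      (c.readsOnly_indicator_otherDecision a s)
      (sum_indicator_decision_le (c.otherDecision a s))
    simp only [Set.inter_indicator_one, Pi.mul_apply]
    refine h.trans (le_of_eq ?_)
    rw [card_messages a]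
    have : NeZero (m a * m (other a)) := ⟨mul_ne_zero (NeZero.ne _) (NeZero.ne _)⟩
    have h2 := natCast_mul_ofReal_inv (k := m a * m (other a)) (l := 1)
    rw [mul_one] at h2
    push_cast at h2 ⊢
    rw [h2, mul_one]

end Code

/-! ### Independence by resampling, and second moments -/

section Resampling

variable {A B E : Type*} [MeasurableSpace A] [MeasurableSpace B] [MeasurableSpace E]
  {μA : Measure A} {μB : Measure B} {μE : Measure E} [SFinite μA] [SFinite μB] [SFinite μE]

theorem measurePreserving_resample_snd {Ψ : B × E → B} (h : MeasurePreserving Ψ (μB.prod μE) μB) :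
    MeasurePreserving (fun p : (A × B) × E => (p.1.1, Ψ (p.1.2, p.2)))
      ((μA.prod μB).prod μE) (μA.prod μB) :=
  ((MeasurePreserving.id μA).prod h).comp (measurePreserving_prodAssoc μA μB μE)

theorem measurePreserving_resample_fst {Ψ : B × E → B} (h : MeasurePreserving Ψ (μB.prod μE) μB) :
    MeasurePreserving (fun p : (B × A) × E => (Ψ (p.1.1, p.2), p.1.2))
      ((μB.prod μA).prod μE) (μB.prod μA) :=
  (Measure.measurePreserving_swap (μ := μA) (ν := μB)).comp
    ((measurePreserving_resample_snd h).comp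
      ((Measure.measurePreserving_swap (μ := μB) (ν := μA)).prod (MeasurePreserving.id μE)))

end Resampling

/-- Integrating against an independently resampled factor. -/
theorem integral_mul_of_resample {Ω E 𝕜 : Type*} [RCLike 𝕜] [MeasurableSpace Ω] [MeasurableSpace E]
    {P : Measure Ω} {μ : Measure E} [SFinite P] [SFinite μ] {Φ : Ω × E → Ω}
    (hΦ : MeasurePreserving Φ (P.prod μ) P) {f h : Ω → 𝕜} {g : E → 𝕜} (hf : Measurable f)
    (hh : Measurable h) (hfΦ : ∀ p, f (Φ p) = f p.1) (hhΦ : ∀ p, h (Φ p) = g p.2) :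
    ∫ ω, f ω * h ω ∂P = (∫ ω, f ω ∂P) * ∫ v, g v ∂μ := by
  have hm : AEStronglyMeasurable (fun ω => f ω * h ω) (Measure.map Φ (P.prod μ)) :=
    (hf.mul hh).aestronglyMeasurable
  rw [← integral_prod_mul]
  conv_lhs => rw [← hΦ.map_eq]
  rw [integral_map hΦ.measurable.aemeasurable hm]
  simp only [hfΦ, hhΦ]

section ExtLaw

variable (ν : Measure (Fin M → Bool)) [∀ i, NeZero (m i)]

theorem measurePreserving_resample_noise (k : Coord N M) :
    MeasurePreserving (fun p : ExtOutcome M N m × ℂ =>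
      ((p.1.1, p.1.2.1, Function.update p.1.2.2 k p.2) : ExtOutcome M N m))
      ((extLaw ν N m).prod stdComplexGaussian) (extLaw ν N m) := by
  have := isProbabilityMeasure_uniformOn (Ω := Messages m) Set.finite_univ Set.univ_nonempty
  exact measurePreserving_resample_snd (measurePreserving_resample_snd
    (measurePreserving_update (fun _ : Coord N M => stdComplexGaussian) k))

variable [IsProbabilityMeasure ν]

theorem measurePreserving_resample_state (t : Fin N) :
    MeasurePreserving (fun p : ExtOutcome M N m × (Fin M → Bool) =>
      ((p.1.1, Function.update p.1.2.1 t p.2, p.1.2.2) : ExtOutcome M N m))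
      ((extLaw ν N m).prod ν) (extLaw ν N m) := by
  have := isProbabilityMeasure_uniformOn (Ω := Messages m) Set.finite_univ Set.univ_nonempty
  exact measurePreserving_resample_snd (measurePreserving_resample_fst
    (measurePreserving_update (fun _ : Fin N => ν) t))

theorem measurePreserving_noise (k : Coord N M) :
    MeasurePreserving (fun ω : ExtOutcome M N m => ω.2.2 k) (extLaw ν N m) stdComplexGaussian := by
  have := isProbabilityMeasure_uniformOn (Ω := Messages m) Set.finite_univ Set.univ_nonempty
  exact (measurePreserving_eval (fun _ : Coord N M => stdComplexGaussian) k).comp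
    (measurePreserving_snd.comp measurePreserving_snd)

theorem memLp_noise (k : Coord N M) :
    MemLp (fun ω : ExtOutcome M N m => ω.2.2 k) 2 (extLaw ν N m) :=
  memLp_id_stdComplexGaussian.comp_measurePreserving (measurePreserving_noise ν k)

theorem integral_norm_sq_noise (k : Coord N M) :
    ∫ ω : ExtOutcome M N m, ‖ω.2.2 k‖ ^ 2 ∂(extLaw ν N m) = 1 := by
  have h := measurePreserving_noise (m := m) ν k
  rw [← integral_norm_sq_stdComplexGaussian, ← h.map_eq,
    integral_map h.measurable.aemeasurable (by fun_prop)]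

/-- The function does not depend on the noise coordinate `k`. -/
def NoiseFree {β : Type*} (k : Coord N M) (f : ExtOutcome M N m → β) : Prop :=
  ∀ ω v, f (ω.1, ω.2.1, Function.update ω.2.2 k v) = f ω

/-- The function does not depend on the states at time `t`. -/
def StateFree {β : Type*} (t : Fin N) (f : ExtOutcome M N m → β) : Prop :=
  ∀ ω σ, f (ω.1, Function.update ω.2.1 t σ, ω.2.2) = f ω

theorem integral_mul_noise {f : ExtOutcome M N m → ℂ} (hf : Measurable f) {k : Coord N M}
    (hk : NoiseFree k f) {g : ℂ → ℂ} (hg : Measurable g) :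
    ∫ ω, f ω * g (ω.2.2 k) ∂(extLaw ν N m)
      = (∫ ω, f ω ∂(extLaw ν N m)) * ∫ z, g z ∂stdComplexGaussian :=
  integral_mul_of_resample (measurePreserving_resample_noise ν k) hf (hg.comp (by fun_prop))
    (fun p => hk p.1 p.2) (fun p => by simp)

theorem integral_state_mul {f : ExtOutcome M N m → ℝ} (hf : Measurable f) {t : Fin N}
    (ht : StateFree t f) (χ : (Fin M → Bool) → ℝ) :
    ∫ ω, χ (ω.2.1 t) * f ω ∂(extLaw ν N m) = (∫ σ, χ σ ∂ν) * ∫ ω, f ω ∂(extLaw ν N m) := by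
  have h := integral_mul_of_resample (measurePreserving_resample_state (m := m) ν t) hf
    (h := fun ω => χ (ω.2.1 t)) (g := χ) ((measurable_of_finite χ).comp (by fun_prop))
    (fun p => ht p.1 p.2) (fun p => by simp)
  simpa only [mul_comm] using h

/-- The cross term vanishes because the noise is centred and independent of `f`. -/
theorem integral_norm_add_noise_sq {f : ExtOutcome M N m → ℂ} (hf : Measurable f)
    (hL : MemLp f 2 (extLaw ν N m)) {k : Coord N M} (hk : NoiseFree k f) (d : ℂ) :
    ∫ ω, ‖f ω + d * ω.2.2 k‖ ^ 2 ∂(extLaw ν N m) = ∫ ω, ‖f ω‖ ^ 2 ∂(extLaw ν N m) + ‖d‖ ^ 2 := by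
  have hu := (memLp_noise (m := m) ν k)
  have hcross : ∫ ω, (f ω * (starRingEnd ℂ) d) * (starRingEnd ℂ) (ω.2.2 k) ∂(extLaw ν N m) = 0 := by
    rw [integral_mul_noise ν (hf.mul_const _) (fun ω v => by rw [hk ω v])
      (g := fun z => (starRingEnd ℂ) z) (by fun_prop), integral_conj,
      integral_id_stdComplexGaussian]
    simp
  have hci : Integrable (fun ω : ExtOutcome M N m =>
      (f ω * (starRingEnd ℂ) d) * (starRingEnd ℂ) (ω.2.2 k)) (extLaw ν N m) :=
    (hL.mul_const _).integrable_mul hu.star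
  have hre : ∫ ω, ((f ω * (starRingEnd ℂ) d) * (starRingEnd ℂ) (ω.2.2 k)).re ∂(extLaw ν N m)
      = 0 := by
    have := Complex.reCLM.integral_comp_comm hci
    rw [hcross] at this
    simpa using this
  have hpt : ∀ ω : ExtOutcome M N m, ‖f ω + d * ω.2.2 k‖ ^ 2 = ‖f ω‖ ^ 2
      + ‖d‖ ^ 2 * ‖ω.2.2 k‖ ^ 2
      + 2 * ((f ω * (starRingEnd ℂ) d) * (starRingEnd ℂ) (ω.2.2 k)).re := by
    intro ω
    rw [← mul_pow, ← norm_mul]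
    simp only [Complex.sq_norm]
    rw [Complex.normSq_add, map_mul (starRingEnd ℂ), mul_assoc]
  simp only [hpt]
  have h1 : Integrable (fun ω => ‖f ω‖ ^ 2) (extLaw ν N m) := hL.integrable_norm_pow (by simp)
  have h2 : Integrable (fun ω : ExtOutcome M N m => ‖d‖ ^ 2 * ‖ω.2.2 k‖ ^ 2) (extLaw ν N m) :=
    (hu.integrable_norm_pow (by simp)).const_mul _
  have h12 : Integrable (fun ω : ExtOutcome M N m => ‖f ω‖ ^ 2 + ‖d‖ ^ 2 * ‖ω.2.2 k‖ ^ 2)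
      (extLaw ν N m) := h1.add h2
  have h3 : Integrable (fun ω : ExtOutcome M N m =>
      2 * ((f ω * (starRingEnd ℂ) d) * (starRingEnd ℂ) (ω.2.2 k)).re) (extLaw ν N m) :=
    hci.re.const_mul 2
  rw [integral_add h12 h3, integral_add h1 h2, integral_const_mul, integral_const_mul,
    integral_norm_sq_noise, hre]
  ring

end ExtLaw

/-- The log-likelihood cost of a residual `r` under variance `v`, relative to the noise `u`. -/
def cost (v : ℝ) (r u : ℂ) : ℝ := Real.log v + ‖r‖ ^ 2 / v - ‖u‖ ^ 2

theorem log_gaussDensity_sub_log {v : ℝ} (hv : 0 < v) (r u : ℂ) :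
    Real.log (gaussDensity v r) - Real.log (gaussDensity 1 u) = -cost v r u := by
  rw [log_gaussDensity hv, log_gaussDensity one_pos, cost, Real.log_one]
  ring

theorem cost_one_self (u : ℂ) : cost 1 u u = 0 := by simp [cost]

/-! ### Causality of the inputs and expected costs -/

namespace Code

variable (c : Code M N m) (gD gI : Fin M → ℂ) (a : Fin 2)

theorem output_congr {ω ω' : Outcome M N m} (hw : ω.1 = ω'.1) :
    ∀ n : ℕ, (∀ r : Fin N, (r : ℕ) < n → ω.2.1 r = ω'.2.1 r ∧ ω.2.2 r = ω'.2.2 r) →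
      ∀ t : Fin N, (t : ℕ) < n → ∀ i j, c.output gD gI ω t i j = c.output gD gI ω' t i j := by
  intro n
  induction n with
  | zero => intro _ t ht; exact absurd ht (Nat.not_lt_zero _)
  | succ n ih =>
    intro h t ht i j
    have ih' := ih fun r hr => h r (hr.trans (Nat.lt_succ_self n))
    have hin : ∀ i, c.input gD gI ω t i = c.input gD gI ω' t i := by
      intro i
      funext j
      unfold input
      rw [hw]
      congr 3
      · funext r j
        exact ih' _ (by have := r.2; simp only; omega) i j
      · funext r
        exact (h _ (by have := r.2; simp only; omega)).1
    rw [output_eq, output_eq, hin, hin, (h t ht).1, (h t ht).2]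

theorem input_congr {ω ω' : Outcome M N m} (hw : ω.1 = ω'.1) {t : Fin N}
    (h : ∀ r < t, ω.2.1 r = ω'.2.1 r ∧ ω.2.2 r = ω'.2.2 r) (i : Fin 2) (j : Fin M) :
    c.input gD gI ω t i j = c.input gD gI ω' t i j := by
  unfold input
  rw [hw]
  congr 3
  · funext r j
    exact c.output_congr gD gI hw t (fun r hr => h r hr) _ r.2 i j
  · funext r
    exact (h _ r.2).1

theorem toOutcome_congr {ω ω' : ExtOutcome M N m} {r : Fin N} (hs : ω.2.1 r = ω'.2.1 r)
    (hu : ∀ f j, ω.2.2 (r, f, j) = ω'.2.2 (r, f, j)) :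
    (toOutcome a ω).2.2 r = (toOutcome a ω').2.2 r := by
  funext i j
  simp only [toOutcome, ownCoord, hs, hu]

theorem input_toOutcome_congr {ω ω' : ExtOutcome M N m} (hw : ω.1 = ω'.1) {t : Fin N}
    (h : ∀ r < t, ω.2.1 r = ω'.2.1 r ∧ ∀ f j, ω.2.2 (r, f, j) = ω'.2.2 (r, f, j))
    (i : Fin 2) (j : Fin M) :
    c.input gD gI (toOutcome a ω) t i j = c.input gD gI (toOutcome a ω') t i j :=
  c.input_congr gD gI hw
    (fun r hr => ⟨(h r hr).1, toOutcome_congr a (h r hr).1 (h r hr).2⟩) i j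

theorem noiseFree_input (t : Fin N) (i : Fin 2) (j : Fin M) {k : Coord N M} (hk : t ≤ k.1) :
    NoiseFree k fun ω => c.input gD gI (toOutcome a ω) t i j := by
  intro ω v
  refine c.input_toOutcome_congr gD gI a (ω := (ω.1, ω.2.1, Function.update ω.2.2 k v)) (ω' := ω)
    rfl
    (fun r hr => ⟨rfl, fun f j' => Function.update_of_ne ?_ _ _⟩) i j
  rintro rfl
  exact absurd hr (not_lt.2 hk)

theorem stateFree_input (t : Fin N) (i : Fin 2) (j : Fin M) :
    StateFree t fun ω => c.input gD gI (toOutcome a ω) t i j := fun ω σ =>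
  c.input_toOutcome_congr gD gI a (ω := (ω.1, Function.update ω.2.1 t σ, ω.2.2)) (ω' := ω) rfl
    (fun _ hr => ⟨Function.update_of_ne hr.ne _ _, fun _ _ => rfl⟩) i j

theorem measurable_input (t : Fin N) (i : Fin 2) (j : Fin M) :
    Measurable fun ω : ExtOutcome M N m => c.input gD gI (toOutcome a ω) t i j := by
  refine measurable_of_sections fun w s => ?_
  have hx : Measurable fun u => c.extOutput gD gI a (w, s, u) :=
    (c.measurable_extOutput gD gI a).comp (by fun_prop)
  by_cases hi : i = a
  · subst hi
    have h := (measurable_pi_apply j).comp ((c.measurable_ownInput i (w i) s t).comp hx)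
    convert h using 2 with u
    exact (congrFun (c.ownInput_extOutput gD gI i (w, s, u) t) j).symm
  · obtain rfl := eq_other_of_ne hi
    have h := (measurable_pi_apply j).comp ((c.measurable_otherInput a (w (other a)) s t).comp hx)
    convert h using 2 with u
    exact (congrFun (c.otherInput_extOutput gD gI a (w, s, u) t) j).symm

/-- All the inputs are bounded by `K`. -/
def Bounded (K : ℝ) : Prop := ∀ i t w q j, ‖c.enc i t w q j‖ ≤ K

/-- A combination, at time `t` in subcarrier `j`, of both inputs and of two noises. -/
def residual (t : Fin N) (j : Fin M) (α α' d d' : ℂ) (f f' : Fin 3) (ω : ExtOutcome M N m) : ℂ :=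
  α * c.input gD gI (toOutcome a ω) t a j + α' * c.input gD gI (toOutcome a ω) t (other a) j
    + d * ω.2.2 (t, f, j) + d' * ω.2.2 (t, f', j)

theorem measurable_residual (t : Fin N) (j : Fin M) (α α' d d' : ℂ) (f f' : Fin 3) :
    Measurable (c.residual gD gI a t j α α' d d' f f') := by
  have h1 := c.measurable_input gD gI a t a j
  have h2 := c.measurable_input gD gI a t (other a) j
  unfold residual
  fun_prop

theorem stateFree_residual (t : Fin N) (j : Fin M) (α α' d d' : ℂ) (f f' : Fin 3) :
    StateFree t (c.residual gD gI a t j α α' d d' f f') := by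
  intro ω σ
  have h1 := c.stateFree_input gD gI a t a j ω σ
  have h2 := c.stateFree_input gD gI a t (other a) j ω σ
  simp only [residual] at h1 h2 ⊢
  rw [h1, h2]

variable (ν : Measure (Fin M → Bool)) [IsProbabilityMeasure ν] [∀ i, NeZero (m i)]
  {K : ℝ} (hK : c.Bounded K)

include hK

theorem memLp_input (t : Fin N) (i : Fin 2) (j : Fin M) :
    MemLp (fun ω => c.input gD gI (toOutcome a ω) t i j) 2 (extLaw ν N m) :=
  MemLp.of_bound (c.measurable_input gD gI a t i j).aestronglyMeasurable K
    (ae_of_all _ fun _ => hK _ _ _ _ _)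

theorem memLp_residual (t : Fin N) (j : Fin M) (α α' d d' : ℂ) (f f' : Fin 3) :
    MemLp (c.residual gD gI a t j α α' d d' f f') 2 (extLaw ν N m) :=
  ((((c.memLp_input gD gI a ν hK t a j).const_mul α).add
    ((c.memLp_input gD gI a ν hK t (other a) j).const_mul α')).add
      ((memLp_noise ν (t, f, j)).const_mul d)).add ((memLp_noise ν (t, f', j)).const_mul d')

theorem integral_norm_residual_sq (t : Fin N) (j : Fin M) (α α' d d' : ℂ) {f f' : Fin 3}
    (hf : f ≠ f') :
    ∫ ω, ‖c.residual gD gI a t j α α' d d' f f' ω‖ ^ 2 ∂(extLaw ν N m)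
      = ∫ ω, ‖α * c.input gD gI (toOutcome a ω) t a j
          + α' * c.input gD gI (toOutcome a ω) t (other a) j‖ ^ 2 ∂(extLaw ν N m)
        + ‖d‖ ^ 2 + ‖d'‖ ^ 2 := by
  have m1 := c.measurable_input gD gI a t a j
  have m2 := c.measurable_input gD gI a t (other a) j
  have L1 := ((c.memLp_input gD gI a ν hK t a j).const_mul α).add
    ((c.memLp_input gD gI a ν hK t (other a) j).const_mul α')
  have n1 : ∀ f, NoiseFree (t, f, j) fun ω => α * c.input gD gI (toOutcome a ω) t a j
      + α' * c.input gD gI (toOutcome a ω) t (other a) j := fun f ω v => by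
    have h1 := c.noiseFree_input gD gI a t a j (k := (t, f, j)) le_rfl ω v
    have h2 := c.noiseFree_input gD gI a t (other a) j (k := (t, f, j)) le_rfl ω v
    simp only at h1 h2 ⊢
    rw [h1, h2]
  have h1 := integral_norm_add_noise_sq ν (k := (t, f, j)) (by fun_prop) L1 (n1 f) d
  have h2 := integral_norm_add_noise_sq ν (k := (t, f', j))
    (f := fun ω => α * c.input gD gI (toOutcome a ω) t a j
      + α' * c.input gD gI (toOutcome a ω) t (other a) j + d * ω.2.2 (t, f, j)) (by fun_prop)
    (L1.add ((memLp_noise ν (t, f, j)).const_mul d))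
    (fun ω v => by
      have := n1 f' ω v
      simp only at this ⊢
      rw [this, Function.update_of_ne (by simpa using hf)]) d'
  unfold residual
  rw [h2]
  exact congrArg (· + _) h1

theorem integrable_cost (t : Fin N) (j : Fin M) (α α' d d' : ℂ) (f f' f'' : Fin 3) (v : ℝ)
    (χ : (Fin M → Bool) → ℝ) :
    Integrable (fun ω => χ (ω.2.1 t)
      * cost v (c.residual gD gI a t j α α' d d' f f' ω) (ω.2.2 (t, f'', j))) (extLaw ν N m) := by
  have h1 : Integrable (fun ω => ‖c.residual gD gI a t j α α' d d' f f' ω‖ ^ 2) (extLaw ν N m) :=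
    (c.memLp_residual gD gI a ν hK t j α α' d d' f f').integrable_norm_pow (by simp)
  have h2 : Integrable (fun ω : ExtOutcome M N m => ‖ω.2.2 (t, f'', j)‖ ^ 2) (extLaw ν N m) :=
    (memLp_noise ν (t, f'', j)).integrable_norm_pow (by simp)
  have h3 : Integrable (fun ω => cost v (c.residual gD gI a t j α α' d d' f f' ω)
      (ω.2.2 (t, f'', j))) (extLaw ν N m) :=
    ((integrable_const _).add (h1.div_const v)).sub h2
  obtain ⟨C, hC⟩ := (Set.finite_range χ).isBounded.exists_norm_le
  exact h3.bdd_mul ((measurable_of_finite χ).comp (by fun_prop)).aestronglyMeasurable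
    (ae_of_all _ fun ω => hC _ ⟨_, rfl⟩)

/-- The residual at time `t` is independent of the state at time `t`, so the weight `χ` factors out
as its mean. By the block power constraint the normalised second moments add up to at most `N`,
which the unit noise energies cancel; only `log v` per use survives. -/
theorem sum_integral_cost_le {j : Fin M}
    (hpow : ∀ᵐ ω ∂(extLaw ν N m), ∀ i, ∑ t, ‖c.input gD gI (toOutcome a ω) t i j‖ ^ 2 ≤ N)
    {α α' d d' : ℂ} {f f' : Fin 3} (hf : f ≠ f') (f'' : Fin 3) {v : ℝ} (hv : 0 < v)
    (hv' : (‖α‖ + ‖α'‖) ^ 2 + ‖d‖ ^ 2 + ‖d'‖ ^ 2 ≤ v) {χ : (Fin M → Bool) → ℝ} (hχ : 0 ≤ χ) :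
    ∑ t : Fin N, ∫ ω, χ (ω.2.1 t) * cost v (c.residual gD gI a t j α α' d d' f f' ω)
      (ω.2.2 (t, f'', j)) ∂(extLaw ν N m) ≤ (∫ σ, χ σ ∂ν) * (N * Real.log v) := by
  have hsplit : ∀ t : Fin N, ∫ ω, χ (ω.2.1 t) * cost v (c.residual gD gI a t j α α' d d' f f' ω)
      (ω.2.2 (t, f'', j)) ∂(extLaw ν N m)
      = (∫ σ, χ σ ∂ν) * (Real.log v + (∫ ω, ‖α * c.input gD gI (toOutcome a ω) t a j
          + α' * c.input gD gI (toOutcome a ω) t (other a) j‖ ^ 2 ∂(extLaw ν N m)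
        + ‖d‖ ^ 2 + ‖d'‖ ^ 2) / v - 1) := by
    intro t
    have hm := c.measurable_residual gD gI a t j α α' d d' f f'
    rw [integral_state_mul ν (f := fun ω => cost v (c.residual gD gI a t j α α' d d' f f' ω)
      (ω.2.2 (t, f'', j))) (by unfold cost; fun_prop) (fun ω σ => by
        have := c.stateFree_residual gD gI a t j α α' d d' f f' ω σ
        simp only [this]),
      ← c.integral_norm_residual_sq gD gI a ν hK t j α α' d d' hf]
    congr 1
    have h1 : Integrable (fun ω => ‖c.residual gD gI a t j α α' d d' f f' ω‖ ^ 2 / v)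
        (extLaw ν N m) :=
      ((c.memLp_residual gD gI a ν hK t j α α' d d' f f').integrable_norm_pow (by simp)).div_const v
    have h2 : Integrable (fun ω : ExtOutcome M N m => ‖ω.2.2 (t, f'', j)‖ ^ 2) (extLaw ν N m) :=
      (memLp_noise ν (t, f'', j)).integrable_norm_pow (by simp)
    have h3 : Integrable (fun ω => Real.log v + ‖c.residual gD gI a t j α α' d d' f f' ω‖ ^ 2 / v)
        (extLaw ν N m) := (integrable_const _).add h1
    unfold cost
    rw [integral_sub h3 h2, integral_add (integrable_const _) h1,
      integral_norm_sq_noise, integral_div]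
    simp
  have hsq : ∀ t : Fin N, Integrable (fun ω => ‖α * c.input gD gI (toOutcome a ω) t a j
      + α' * c.input gD gI (toOutcome a ω) t (other a) j‖ ^ 2) (extLaw ν N m) := fun t =>
    (((c.memLp_input gD gI a ν hK t a j).const_mul α).add
      ((c.memLp_input gD gI a ν hK t (other a) j).const_mul α')).integrable_norm_pow (by simp)
  have hE : ∑ t : Fin N, ∫ ω, ‖α * c.input gD gI (toOutcome a ω) t a j
      + α' * c.input gD gI (toOutcome a ω) t (other a) j‖ ^ 2 ∂(extLaw ν N m)
      ≤ N * (‖α‖ + ‖α'‖) ^ 2 := by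
    rw [← integral_finsetSum _ fun t _ => hsq t]
    refine (integral_mono_ae (integrable_finsetSum _ fun t _ => hsq t)
      (integrable_const (N * (‖α‖ + ‖α'‖) ^ 2)) ?_).trans (by simp)
    filter_upwards [hpow] with ω hω
    have h1 := hω a
    have h2 := hω (other a)
    calc _ ≤ ∑ t : Fin N, (‖α‖ + ‖α'‖) * (‖α‖ * ‖c.input gD gI (toOutcome a ω) t a j‖ ^ 2
          + ‖α'‖ * ‖c.input gD gI (toOutcome a ω) t (other a) j‖ ^ 2) := by
          refine Finset.sum_le_sum fun t _ => ?_
          set x := c.input gD gI (toOutcome a ω) t a j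
          set y := c.input gD gI (toOutcome a ω) t (other a) j
          have h3 : ‖α * x + α' * y‖ ≤ ‖α‖ * ‖x‖ + ‖α'‖ * ‖y‖ := by
            rw [← norm_mul, ← norm_mul]; exact norm_add_le _ _
          -- The gap in `(A p + B q)² ≤ (A + B) (A p² + B q²)` equals `A B (p - q)²`. No
          -- independence of the two inputs is used; feedback may correlate them.
          have h4 := mul_nonneg (mul_nonneg (norm_nonneg α) (norm_nonneg α'))
            (sq_nonneg (‖x‖ - ‖y‖))
          calc _ ≤ (‖α‖ * ‖x‖ + ‖α'‖ * ‖y‖) ^ 2 := by gcongr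
            _ ≤ _ := by nlinarith
      _ = (‖α‖ + ‖α'‖) * (‖α‖ * ∑ t, ‖c.input gD gI (toOutcome a ω) t a j‖ ^ 2
          + ‖α'‖ * ∑ t, ‖c.input gD gI (toOutcome a ω) t (other a) j‖ ^ 2) := by
          rw [← Finset.mul_sum, Finset.sum_add_distrib, Finset.mul_sum, Finset.mul_sum]
      _ ≤ (‖α‖ + ‖α'‖) * (‖α‖ * N + ‖α'‖ * N) := by gcongr
      _ = _ := by ring
  simp only [hsplit]
  rw [← Finset.mul_sum]
  refine mul_le_mul_of_nonneg_left ?_ (integral_nonneg hχ)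
  rw [Finset.sum_sub_distrib, Finset.sum_add_distrib, ← Finset.sum_div, Finset.sum_add_distrib,
    Finset.sum_add_distrib]
  simp only [Finset.sum_const, Finset.card_univ, Fintype.card_fin, nsmul_eq_mul, mul_one]
  have h5 : (∑ t : Fin N, ∫ ω, ‖α * c.input gD gI (toOutcome a ω) t a j
      + α' * c.input gD gI (toOutcome a ω) t (other a) j‖ ^ 2 ∂(extLaw ν N m)
      + N * ‖d‖ ^ 2 + N * ‖d'‖ ^ 2) / v ≤ N := by
    rw [div_le_iff₀ hv]
    have h6 := mul_le_mul_of_nonneg_left hv' (Nat.cast_nonneg (α := ℝ) N)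
    nlinarith
  linarith

end Code

/-- The indicator of interference in subcarrier `j`. -/
def present (j : Fin M) (σ : Fin M → Bool) : ℝ := if σ j then 1 else 0

/-- The indicator of no interference in subcarrier `j`. -/
def absent (j : Fin M) (σ : Fin M → Bool) : ℝ := if σ j then 0 else 1

theorem present_nonneg (j : Fin M) : 0 ≤ present j := fun σ => by
  unfold present; split_ifs <;> simp

theorem absent_nonneg (j : Fin M) : 0 ≤ absent j := fun σ => by
  unfold absent; split_ifs <;> simp

theorem integral_present {ν : Measure (Fin M → Bool)} [IsProbabilityMeasure ν] {p : ℝ}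
    (hp : HasMarginals ν p) (j : Fin M) : ∫ σ, present j σ ∂ν = p := by
  have h : present j = ({s | s j = true} : Set (Fin M → Bool)).indicator 1 := by
    funext σ
    simp [present, Set.indicator_apply]
  rw [h, integral_indicator_one (Set.toFinite _).measurableSet, hp j]

theorem integral_absent {ν : Measure (Fin M → Bool)} [IsProbabilityMeasure ν] {p : ℝ}
    (hp : HasMarginals ν p) (j : Fin M) : ∫ σ, absent j σ ∂ν = 1 - p := by
  have h : absent j = fun σ => 1 - present j σ := by
    funext σ
    unfold absent present
    split_ifs <;> simp
  rw [h, integral_sub (integrable_const _) (Integrable.of_finite), integral_present hp]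
  simp

/-! ### Log-ratios as sums of costs -/

/-- The functions `F t` are integrable and their integrals add up to at most `B`. -/
def SumIntegralLE {Ω T : Type*} [MeasurableSpace Ω] [Fintype T] (P : Measure Ω) (F : T → Ω → ℝ)
    (B : ℝ) : Prop :=
  (∀ t, Integrable (F t) P) ∧ ∑ t, ∫ ω, F t ω ∂P ≤ B

section SumIntegral

variable {Ω T : Type*} [MeasurableSpace Ω] [Fintype T] {P : Measure Ω}

theorem SumIntegralLE.add {F G : T → Ω → ℝ} {B C : ℝ} (hF : SumIntegralLE P F B)
    (hG : SumIntegralLE P G C) : SumIntegralLE P (fun t ω => F t ω + G t ω) (B + C) := by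
  refine ⟨fun t => (hF.1 t).add (hG.1 t), ?_⟩
  simp only [integral_add (hF.1 _) (hG.1 _), Finset.sum_add_distrib]
  exact add_le_add hF.2 hG.2

theorem SumIntegralLE.sum {J : Type*} [Fintype J] {F : J → T → Ω → ℝ} {B : J → ℝ}
    (hF : ∀ j, SumIntegralLE P (F j) (B j)) :
    SumIntegralLE P (fun t ω => ∑ j, F j t ω) (∑ j, B j) := by
  refine ⟨fun t => integrable_finsetSum _ fun j _ => (hF j).1 t, ?_⟩
  have h : ∀ t, ∫ ω, ∑ j, F j t ω ∂P = ∑ j, ∫ ω, F j t ω ∂P := fun t =>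
    integral_finsetSum _ fun j _ => (hF j).1 t
  simp only [h]
  rw [Finset.sum_comm]
  exact Finset.sum_le_sum fun j _ => (hF j).2

theorem SumIntegralLE.of_eq_neg {F : T → Ω → ℝ} {B : ℝ} (hF : SumIntegralLE P F B) {L : Ω → ℝ}
    (hL : ∀ ω, L ω = -∑ t, F t ω) : Integrable L P ∧ -∫ ω, L ω ∂P ≤ B := by
  have h : L = fun ω => -∑ t, F t ω := funext hL
  have hi := integrable_finsetSum Finset.univ fun t _ => hF.1 t
  refine ⟨h ▸ hi.neg, ?_⟩
  rw [h, integral_neg, neg_neg, integral_finsetSum _ fun t _ => hF.1 t]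
  exact hF.2

end SumIntegral

theorem sum_coord {A : Type*} [AddCommMonoid A] (f : Coord N M → A) :
    ∑ k, f k = ∑ t, ∑ j, (f (t, 0, j) + f (t, 1, j) + f (t, 2, j)) := by
  rw [Fintype.sum_prod_type]
  refine Finset.sum_congr rfl fun t _ => ?_
  rw [Fintype.sum_prod_type, Fin.sum_univ_three, Finset.sum_add_distrib, Finset.sum_add_distrib]

/-- The residual of linear estimation has variance `varCond`. -/
theorem varCond_eq (gD gI : Fin M → ℂ) (j : Fin M) :
    ‖gD j - mmseCoeff gD gI j * gI j‖ ^ 2 + 1 + ‖mmseCoeff gD gI j‖ ^ 2 = varCond gD gI j := by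
  have hpos : (0 : ℝ) < 1 + ‖gI j‖ ^ 2 := by positivity
  have hne : ((1 + ‖gI j‖ ^ 2 : ℝ) : ℂ) ≠ 0 := by exact_mod_cast hpos.ne'
  have h1 : gD j - mmseCoeff gD gI j * gI j = gD j / (1 + ‖gI j‖ ^ 2 : ℝ) := by
    have h2 : (starRingEnd ℂ) (gI j) * gI j = ((‖gI j‖ ^ 2 : ℝ) : ℂ) := by
      rw [mul_comm, Complex.mul_conj, Complex.normSq_eq_norm_sq]
    rw [mmseCoeff, div_mul_eq_mul_div, mul_assoc, h2]
    field_simp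
    push_cast
    ring
  rw [h1, mmseCoeff, varCond, norm_div, norm_div, norm_mul, Complex.norm_real, RCLike.norm_conj,
    Real.norm_of_nonneg hpos.le]
  field_simp
  ring

namespace Code

variable (c : Code M N m) (gD gI : Fin M → ℂ) (a : Fin 2)

/-- The cost of a residual at the times when the state is weighted by `χ`. -/
def stateCost (j : Fin M) (χ : (Fin M → Bool) → ℝ) (v : ℝ) (α α' d d' : ℂ) (f f' f'' : Fin 3)
    (t : Fin N) (ω : ExtOutcome M N m) : ℝ :=
  χ (ω.2.1 t) * cost v (c.residual gD gI a t j α α' d d' f f' ω) (ω.2.2 (t, f'', j))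

theorem logRatio_gaussDensity {V : States M N → Coord N M → ℝ}
    {C : Messages m → States M N → Coord N M → (Coord N M → ℂ) → ℂ} (hV : ∀ s k, 0 < V s k)
    (ω : ExtOutcome M N m) :
    c.logRatio gD gI a (fun w s k x => gaussDensity (V s k) (x k - C w s k x)) ω
      = -∑ k, cost (V ω.2.1 k)
          (c.extOutput gD gI a ω k - C ω.1 ω.2.1 k (c.extOutput gD gI a ω)) (ω.2.2 k) := by
  rw [logRatio, ← Finset.sum_neg_distrib]
  exact Finset.sum_congr rfl fun k _ => log_gaussDensity_sub_log (hV _ k) _ _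

/-- Coordinates that keep their true density cost nothing. With interference, the estimation
residual of the own output is `(gD - κ gI) x + u - κ u'`, where `κ` is `mmseCoeff`. Noise fields
with coefficient `0` are placeholders, chosen distinct from the active one. -/
theorem logRatio_cutAux (ω : ExtOutcome M N m) :
    c.logRatio gD gI a (c.cutAux gD gI a) ω = -∑ t, ∑ j,
      (c.stateCost gD gI a j (present j) (varCond gD gI j) (gD j - mmseCoeff gD gI j * gI j) 0 1
          (-mmseCoeff gD gI j) 0 2 0 t ω
        + c.stateCost gD gI a j (absent j) (varDirect gD j) (gD j) 0 1 0 1 0 1 t ω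
        + c.stateCost gD gI a j (present j) (varCross gI j) (gI j) 0 1 0 2 0 2 t ω) := by
  refine (c.logRatio_gaussDensity gD gI a (fun s k => cutVar_pos gD gI s k) ω).trans ?_
  rw [sum_coord]
  congr 1
  refine Finset.sum_congr rfl fun t _ => Finset.sum_congr rfl fun j _ => ?_
  by_cases h : ω.2.1 t j = true
  · simp only [cutVar, cutCenter, extOutput, otherInput_extOutput, stateCost, residual, present,
      absent, h, if_true, one_mul, zero_mul, sub_zero, add_zero, zero_add, cost_one_self]
    congr 2 <;> ring
  · simp only [cutVar, cutCenter, extOutput, otherInput_extOutput, stateCost, residual, present,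
      absent, h, if_false, one_mul, zero_mul, sub_zero, add_zero, zero_add, Bool.false_eq_true,
      add_sub_cancel_left, cost_one_self]

theorem logRatio_sumAux (ω : ExtOutcome M N m) :
    c.logRatio gD gI a (c.sumAux gD gI a) ω = -∑ t, ∑ j,
      (c.stateCost gD gI a j (present j) (varSum gD gI j) (gD j) (gI j) 1 0 0 1 0 t ω
        + c.stateCost gD gI a j (absent j) (varDirect gD j) (gD j) 0 1 0 1 0 1 t ω
        + c.stateCost gD gI a j (present j) (varCond gD gI j) 0 (gD j - mmseCoeff gD gI j * gI j) 1
          (-mmseCoeff gD gI j) 2 0 2 t ω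
        + c.stateCost gD gI a j (absent j) (varDirect gD j) 0 (gD j) 1 0 2 0 2 t ω) := by
  refine (c.logRatio_gaussDensity gD gI a (fun s k => sumVar_pos gD gI s k) ω).trans ?_
  rw [sum_coord]
  congr 1
  refine Finset.sum_congr rfl fun t _ => Finset.sum_congr rfl fun j _ => ?_
  by_cases h : ω.2.1 t j = true
  · simp only [sumVar, sumCenter, extOutput, ownInput_extOutput, stateCost, residual, present,
      absent, h, if_true, one_mul, zero_mul, sub_zero, add_zero, zero_add, cost_one_self]
    congr 2 <;> ring
  · simp only [sumVar, sumCenter, extOutput, otherInput_extOutput, stateCost, residual, present,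
      absent, h, if_false, one_mul, zero_mul, sub_zero, add_zero, zero_add, Bool.false_eq_true,
      add_sub_cancel_left, cost_one_self]

/-! ### The information term shared by the two weighted bounds -/

section CrossDensity

/-- The log-ratio of the density of a noisy observation of the interference, given the past, to its
density given also the message of the other user. -/
def crossLogRatio (t : Fin N) (j : Fin M) (ω : ExtOutcome M N m) : ℝ :=
  Real.log (c.condDensity gD gI a (ω.1 a) ω.2.1 (t, 0, j) (c.extOutput gD gI a ω))
    - Real.log (gaussDensity 1 (ω.2.2 (t, 0, j)))

theorem logRatio_otherAux (ω : ExtOutcome M N m) :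
    c.logRatio gD gI a (c.otherAux gD gI a) ω = -∑ t, ∑ j,
      (-c.crossLogRatio gD gI a t j ω
        + c.stateCost gD gI a j (fun _ => 1) (varCond gD gI j) 0
          (gD j - mmseCoeff gD gI j * gI j) 1 (-mmseCoeff gD gI j) 2 0 2 t ω) := by
  rw [logRatio, sum_coord, ← Finset.sum_neg_distrib]
  refine Finset.sum_congr rfl fun t _ => ?_
  rw [← Finset.sum_neg_distrib]
  refine Finset.sum_congr rfl fun j _ => ?_
  simp only [otherAux, coordDensity_extOutput, sub_self, add_zero, stateCost, one_mul, mmseCenter,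
    ownInput_extOutput, log_gaussDensity_sub_log (varCond_pos gD gI j), crossLogRatio, neg_add,
    neg_neg]
  congr 3
  by_cases h : ω.2.1 t j = true
  · simp only [extOutput, residual, h, if_true]
    ring
  · simp only [extOutput, residual, h, if_false, Bool.false_eq_true]
    ring

theorem measurable_crossLogRatio (t : Fin N) (j : Fin M) :
    Measurable (c.crossLogRatio gD gI a t j) := by
  refine measurable_of_sections fun w s => ?_
  unfold crossLogRatio
  exact (Real.measurable_log.comp ((c.measurable_condDensity gD gI a (w a) s _).comp
    ((c.measurable_extOutput gD gI a).comp (by fun_prop)))).sub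
    (Real.measurable_log.comp ((measurable_gaussDensity 1).comp (by fun_prop)))

/-- The own input is known and cancels. What remains compares the actual interference with the one a
candidate message `w'` would have caused, and no longer shows the current state. -/
theorem coordDensity_field_zero (t : Fin N) (j : Fin M) (ω : ExtOutcome M N m)
    (w' : Fin (m (other a))) :
    c.coordDensity gD gI a ((messagesEquiv m a).symm (ω.1 a, w')) ω.2.1 (t, 0, j)
        (c.extOutput gD gI a ω)
      = gaussDensity 1 (gI j * (c.input gD gI (toOutcome a ω) t (other a) j
          - c.otherInput a w' ω.2.1 (c.extOutput gD gI a ω) t j) + ω.2.2 (t, 0, j)) := by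
  simp only [coordDensity, drift, messagesEquiv_symm_self, messagesEquiv_symm_other,
    ownInput_extOutput]
  congr 1
  simp only [extOutput]
  ring

theorem drift_congr_states {w : Messages m} {s s' : States M N} {k : Coord N M}
    {x x' : Coord N M → ℂ} (hs : ∀ r ≤ k.1, s r = s' r) (hx : ∀ k', k'.1 < k.1 → x k' = x' k') :
    c.drift gD gI a w s k x = c.drift gD gI a w s' k x' := by
  have h : c.drift gD gI a w s k x = c.drift gD gI a w s' k x := by
    obtain ⟨t, f, j⟩ := k
    have h1 : c.ownInput a (w a) s x t = c.ownInput a (w a) s' x t := by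
      unfold ownInput
      congr 2
      · funext r j
        simp only [ownCoord, hs ⟨r, r.2.trans t.2⟩ (Fin.le_def.2 r.2.le)]
      · funext r
        exact hs _ (Fin.le_def.2 r.2.le)
    have h2 : c.otherInput a (w (other a)) s x t = c.otherInput a (w (other a)) s' x t := by
      unfold otherInput
      congr 2
      funext r
      exact hs _ (Fin.le_def.2 r.2.le)
    fin_cases f <;> simp only [drift, h1, h2, hs t le_rfl]
  rw [h, c.drift_congr gD gI hx]

/-- Past coordinates do not involve the current state, and the current field `0` involves it only
through the own input, which cancels. Field `0` ranks first within its time, so nothing else enters.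
This independence lets the information term factor as `p` times its mean. -/
theorem stateFree_crossLogRatio (t : Fin N) (j : Fin M) :
    StateFree t (c.crossLogRatio gD gI a t j) := by
  intro ω σ
  set ω' : ExtOutcome M N m := (ω.1, Function.update ω.2.1 t σ, ω.2.2) with hω'
  have hs : ∀ r < t, ω'.2.1 r = ω.2.1 r := fun r hr => Function.update_of_ne hr.ne _ _
  have hin : ∀ r ≤ t, ∀ i j, c.input gD gI (toOutcome a ω') r i j
      = c.input gD gI (toOutcome a ω) r i j := fun r hr i j =>
    c.input_toOutcome_congr gD gI a (ω := ω') (ω' := ω) rfl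
      (fun q hq => ⟨hs q (hq.trans_le hr), fun _ _ => rfl⟩) i j
  have hext : ∀ k : Coord N M, k.1 < t → c.extOutput gD gI a ω' k = c.extOutput gD gI a ω k := by
    rintro ⟨r, f, l⟩ hr
    fin_cases f <;> simp only [extOutput, hin r hr.le, hs r hr] <;> rfl
  have hu : ω'.2.2 = ω.2.2 := rfl
  have hw : ω'.1 = ω.1 := rfl
  unfold crossLogRatio
  rw [hu]
  congr 2
  refine mixDensity_congr fun w' k' hk' => ?_
  have hf := field_le_of_coordRank_le hk'
  -- A coordinate of rank at most that of `(t, 0, j)` is either strictly past or in field `0` of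
  -- time `t`.
  rcases (time_le_of_coordRank_le hk').lt_or_eq with hlt | heq
  · change k'.1 < t at hlt
    rw [hw]
    unfold coordDensity
    rw [hext k' hlt, c.drift_congr_states gD gI a (s' := ω.2.1) (x' := c.extOutput gD gI a ω)
      (fun r hr => hs r (hr.trans_lt hlt)) (fun l hl => hext l (hl.trans hlt))]
  · obtain ⟨r, f, l⟩ := k'
    obtain rfl : r = t := heq
    obtain rfl : f = 0 := by
      simp only [Fin.isValue, Fin.val_zero, zero_add] at hf
      exact Fin.ext (by simpa using hf)
    rw [coordDensity_field_zero, coordDensity_field_zero, hin r le_rfl, hu]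
    congr 4
    have h2 : c.otherInput a w' ω'.2.1 (c.extOutput gD gI a ω') r
        = c.otherInput a w' ω.2.1 (c.extOutput gD gI a ω) r := by
      unfold otherInput
      congr 2
      · funext q l
        exact hext _ q.2
      · funext q
        exact hs _ q.2
    rw [h2]

variable [∀ i, NeZero (m i)]

/-- Field `1` does not contain the other input, so the mixture averages equal numbers; without
interference the own output therefore carries no information term. -/
theorem condDensity_field_one (t : Fin N) (j : Fin M) (ω : ExtOutcome M N m) :
    c.condDensity gD gI a (ω.1 a) ω.2.1 (t, 1, j) (c.extOutput gD gI a ω)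
      = gaussDensity 1 (ω.2.2 (t, 1, j)) := by
  have h := mixDensity_mem_Icc (r := coordRank) (k := (t, 1, j)) (x := c.extOutput gD gI a ω)
    (φ := fun w' => c.coordDensity gD gI a ((messagesEquiv m a).symm (ω.1 a, w')) ω.2.1)
    (lo := gaussDensity 1 (ω.2.2 (t, 1, j))) (hi := gaussDensity 1 (ω.2.2 (t, 1, j)))
    (fun _ _ _ => c.coordDensity_pos gD gI a _ _ _ _) coordRank_injective fun w' => by
      rw [Set.Icc_self, Set.mem_singleton_iff, ← c.coordDensity_extOutput gD gI a ω (t, 1, j)]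
      simp only [coordDensity, drift, messagesEquiv_symm_self]
  exact le_antisymm h.2 h.1

theorem logRatio_ownAux (ω : ExtOutcome M N m) :
    c.logRatio gD gI a (c.ownAux gD gI a) ω = -∑ t, ∑ j,
      (c.stateCost gD gI a j (present j) (varSum gD gI j) (gD j) (gI j) 1 0 0 1 0 t ω
        + c.stateCost gD gI a j (absent j) (varDirect gD j) (gD j) 0 1 0 1 0 1 t ω
        + present j (ω.2.1 t) * c.crossLogRatio gD gI a t j ω) := by
  rw [logRatio, sum_coord, ← Finset.sum_neg_distrib]
  refine Finset.sum_congr rfl fun t _ => ?_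
  rw [← Finset.sum_neg_distrib]
  refine Finset.sum_congr rfl fun j _ => ?_
  have hne : ∀ u : ℂ, gaussDensity 1 u ≠ 0 := fun u => (gaussDensity_pos one_pos u).ne'
  have hlog : ∀ v : ℝ, 0 < v → ∀ r u F, 0 < F →
      Real.log (gaussDensity 1 u * (gaussDensity v r / F)) = Real.log (gaussDensity 1 u)
        + (Real.log (gaussDensity 1 u) - cost v r u) - Real.log F := by
    intro v hv r u F hF
    have h1 := gaussDensity_pos hv r
    rw [Real.log_mul (hne u) (by positivity), Real.log_div h1.ne' hF.ne']
    linarith [log_gaussDensity_sub_log hv r u]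
  by_cases h : ω.2.1 t j = true
  · simp only [ownAux, coordDensity_extOutput, mem_ownCoords, h, if_true, Fin.isValue,
      one_ne_zero, if_false, mul_one, sub_self, add_zero, (by decide : (2 : Fin 3) ≠ 0),
      stateCost, present, absent, zero_mul, one_mul, crossLogRatio, sumVar, residual]
    rw [hlog _ (varSum_pos gD gI j) _ _ _ (c.condDensity_pos gD gI a _ _ _ _)]
    simp only [extOutput, h, if_true]
    ring_nf
  · simp only [ownAux, coordDensity_extOutput, mem_ownCoords, h, Bool.false_eq_true, Fin.isValue,
      zero_ne_one, if_true, if_false, mul_one, sub_self, add_zero, zero_add,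
      (by decide : (2 : Fin 3) ≠ 1),
      stateCost, present, absent, zero_mul, one_mul, sumVar, residual, condDensity_field_one]
    rw [hlog _ (varDirect_pos gD j) _ _ _ (gaussDensity_pos one_pos _)]
    simp only [extOutput, h, if_false, Bool.false_eq_true]
    ring_nf

end CrossDensity

end Code

/-! ### Bounds at finite block length for bounded inputs -/

namespace Code

variable (c : Code M N m) (gD gI : Fin M → ℂ) (a : Fin 2)

variable (ν : Measure (Fin M → Bool)) [IsProbabilityMeasure ν] [∀ i, NeZero (m i)]
  {K : ℝ} (hK : c.Bounded K)

include hK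

/-- Two candidate inputs differ by at most `2 K`, so every component of the mixture lies between the
unit Gaussian density at distance `2 K ‖gI j‖ + ‖u‖` and its maximum `1 / π`; the average lies there
too. The resulting quadratic bound gives integrability. -/
theorem norm_crossLogRatio_le (t : Fin N) (j : Fin M) (ω : ExtOutcome M N m) :
    ‖c.crossLogRatio gD gI a t j ω‖
      ≤ (2 * K * ‖gI j‖ + ‖ω.2.2 (t, 0, j)‖) ^ 2 + ‖ω.2.2 (t, 0, j)‖ ^ 2 := by
  have hlog : ∀ y, Real.log (gaussDensity 1 y) = -Real.log Real.pi - ‖y‖ ^ 2 := fun y => by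
    rw [log_gaussDensity one_pos, Real.log_one, div_one, sub_zero]
  have hF : c.condDensity gD gI a (ω.1 a) ω.2.1 (t, 0, j) (c.extOutput gD gI a ω)
      ∈ Set.Icc (Real.exp (-Real.log Real.pi - (2 * K * ‖gI j‖ + ‖ω.2.2 (t, 0, j)‖) ^ 2))
        (Real.exp (-Real.log Real.pi)) := by
    refine mixDensity_mem_Icc (fun _ _ _ => c.coordDensity_pos gD gI a _ _ _ _)
      coordRank_injective fun w' => ?_
    rw [coordDensity_field_zero]
    have h1 := (norm_sub_le (c.input gD gI (toOutcome a ω) t (other a) j)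
      (c.otherInput a w' ω.2.1 (c.extOutput gD gI a ω) t j)).trans
        (add_le_add (hK _ _ _ _ _) (hK _ _ _ _ _))
    have h2 := norm_add_le (gI j * (c.input gD gI (toOutcome a ω) t (other a) j
      - c.otherInput a w' ω.2.1 (c.extOutput gD gI a ω) t j)) (ω.2.2 (t, 0, j))
    rw [norm_mul] at h2
    have h3 := mul_le_mul_of_nonneg_left h1 (norm_nonneg (gI j))
    generalize gI j * (c.input gD gI (toOutcome a ω) t (other a) j
      - c.otherInput a w' ω.2.1 (c.extOutput gD gI a ω) t j) + ω.2.2 (t, 0, j) = y at h2 ⊢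
    have hy : ‖y‖ ^ 2 ≤ (2 * K * ‖gI j‖ + ‖ω.2.2 (t, 0, j)‖) ^ 2 :=
      pow_le_pow_left₀ (norm_nonneg _) (by linarith) 2
    rw [Set.mem_Icc, ← Real.exp_log (gaussDensity_pos one_pos y), Real.exp_le_exp, Real.exp_le_exp,
      hlog]
    constructor <;> linarith [sq_nonneg ‖y‖]
  have hpos := c.condDensity_pos gD gI a (ω.1 a) ω.2.1 (t, 0, j) (c.extOutput gD gI a ω)
  have h1 := (Real.le_log_iff_exp_le hpos).2 hF.1
  have h2 := (Real.log_le_iff_le_exp hpos).2 hF.2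
  rw [crossLogRatio, hlog, Real.norm_eq_abs, abs_le]
  constructor <;> linarith [sq_nonneg (2 * K * ‖gI j‖ + ‖ω.2.2 (t, 0, j)‖),
    sq_nonneg ‖ω.2.2 (t, 0, j)‖]

theorem integrable_crossLogRatio (t : Fin N) (j : Fin M) :
    Integrable (c.crossLogRatio gD gI a t j) (extLaw ν N m) := by
  have hu : MemLp (fun ω : ExtOutcome M N m => ‖ω.2.2 (t, 0, j)‖) 2 (extLaw ν N m) :=
    (memLp_noise ν (t, 0, j)).norm
  have hρ : MemLp (fun ω : ExtOutcome M N m => 2 * K * ‖gI j‖ + ‖ω.2.2 (t, 0, j)‖) 2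
      (extLaw ν N m) := MemLp.add (memLp_const (2 * K * ‖gI j‖)) hu
  have h1 := hu.integrable_sq
  have h2 := hρ.integrable_sq
  have hint : Integrable (fun ω : ExtOutcome M N m =>
      (2 * K * ‖gI j‖ + ‖ω.2.2 (t, 0, j)‖) ^ 2 + ‖ω.2.2 (t, 0, j)‖ ^ 2) (extLaw ν N m) := h2.add h1
  exact hint.mono' (c.measurable_crossLogRatio gD gI a t j).aestronglyMeasurable
    (ae_of_all _ (c.norm_crossLogRatio_le gD gI a hK t j))

variable {a} {ν} {gD} {gI} {p : ℝ} (hp : HasMarginals ν p)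
  (hpow : ∀ j, ∀ᵐ ω ∂(extLaw ν N m), ∀ i,
    ∑ t, ‖c.input gD gI (toOutcome a ω) t i j‖ ^ 2 ≤ N)

include hpow

theorem sumIntegralLE_stateCost (j : Fin M) {α α' d d' : ℂ} {f f' : Fin 3} (hf : f ≠ f')
    (f'' : Fin 3) {v : ℝ} (hv : 0 < v) (hv' : (‖α‖ + ‖α'‖) ^ 2 + ‖d‖ ^ 2 + ‖d'‖ ^ 2 ≤ v)
    {χ : (Fin M → Bool) → ℝ} (hχ : 0 ≤ χ) {q : ℝ} (hq : ∫ σ, χ σ ∂ν = q) :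
    SumIntegralLE (extLaw ν N m) (c.stateCost gD gI a j χ v α α' d d' f f' f'')
      (q * (N * Real.log v)) :=
  ⟨fun t => c.integrable_cost gD gI a ν hK t j α α' d d' f f' f'' v χ,
    hq ▸ c.sum_integral_cost_le gD gI a ν hK (hpow j) hf f'' hv hv' hχ⟩

include hp

theorem measureReal_correct_mul_log_le :
    (extLaw ν N m).real (c.correct gD gI a a) * Real.log (m a) ≤ 1 + N * ∑ j,
      (p * (Real.log (varCond gD gI j) + Real.log (varCross gI j))
        + (1 - p) * Real.log (varDirect gD j)) := by
  obtain ⟨h1, h2⟩ := (SumIntegralLE.sum fun j =>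
    ((c.sumIntegralLE_stateCost hK hpow j (by decide : (0 : Fin 3) ≠ 2) 0 (varCond_pos gD gI j)
      (by simpa using (varCond_eq gD gI j).le) (present_nonneg j) (integral_present hp j)).add
    (c.sumIntegralLE_stateCost hK hpow j (by decide : (1 : Fin 3) ≠ 0) 1 (varDirect_pos gD j)
      (by simp [varDirect, add_comm]) (absent_nonneg j) (integral_absent hp j))).add
    (c.sumIntegralLE_stateCost hK hpow j (by decide : (2 : Fin 3) ≠ 0) 2 (varCross_pos gI j)
      (by simp [varCross, add_comm]) (present_nonneg j) (integral_present hp j))).of_eq_neg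
    (c.logRatio_cutAux gD gI a)
  have h3 := c.converse_cut gD gI a ν h1
  rw [Finset.mul_sum]
  refine le_trans (by linarith) (add_le_add_right (h2.trans (le_of_eq ?_)) 1)
  exact Finset.sum_congr rfl fun j _ => by ring

theorem measureReal_correct_inter_mul_log_le :
    (extLaw ν N m).real (c.correct gD gI a a ∩ c.correct gD gI a (other a))
        * Real.log (m a * m (other a)) ≤ 1 + N * ∑ j,
      (p * (Real.log (varSum gD gI j) + Real.log (varCond gD gI j))
        + 2 * ((1 - p) * Real.log (varDirect gD j))) := by
  obtain ⟨h1, h2⟩ := (SumIntegralLE.sum fun j =>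
    (((c.sumIntegralLE_stateCost hK hpow j (by decide : (0 : Fin 3) ≠ 1) 0 (varSum_pos gD gI j)
      (by simp [varSum, add_comm]) (present_nonneg j) (integral_present hp j)).add
    (c.sumIntegralLE_stateCost hK hpow j (by decide : (1 : Fin 3) ≠ 0) 1 (varDirect_pos gD j)
      (by simp [varDirect, add_comm]) (absent_nonneg j) (integral_absent hp j))).add
    (c.sumIntegralLE_stateCost hK hpow j (by decide : (2 : Fin 3) ≠ 0) 2 (varCond_pos gD gI j)
      (by simpa using (varCond_eq gD gI j).le) (present_nonneg j) (integral_present hp j))).add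
    (c.sumIntegralLE_stateCost hK hpow j (by decide : (2 : Fin 3) ≠ 0) 2 (varDirect_pos gD j)
      (by simp [varDirect, add_comm]) (absent_nonneg j) (integral_absent hp j))).of_eq_neg
    (c.logRatio_sumAux gD gI a)
  have h3 := c.converse_sum gD gI a ν h1
  rw [Finset.mul_sum]
  refine le_trans (by linarith) (add_le_add_right (h2.trans (le_of_eq ?_)) 1)
  exact Finset.sum_congr rfl fun j _ => by ring

theorem measureReal_correct_weighted_le (hp0 : 0 ≤ p) :
    (extLaw ν N m).real (c.correct gD gI a a) * Real.log (m a)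
      + p * ((extLaw ν N m).real (c.correct gD gI a (other a)) * Real.log (m (other a)))
      ≤ 1 + p + N * ∑ j, (p * (Real.log (varSum gD gI j) + Real.log (varCond gD gI j))
        + (1 - p) * Real.log (varDirect gD j)) := by
  have hG := c.integrable_crossLogRatio gD gI a ν hK
  -- `γ j` enters the bound for user `a` as `p * γ j` and the bound for the other user as `-γ j`.
  -- Its value is never estimated.
  set γ : Fin M → ℝ := fun j => ∑ t, ∫ ω, c.crossLogRatio gD gI a t j ω ∂(extLaw ν N m)
  have hown : ∀ j, SumIntegralLE (extLaw ν N m)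
      (fun t ω => present j (ω.2.1 t) * c.crossLogRatio gD gI a t j ω) (p * γ j) := by
    refine fun j => ⟨fun t => ?_, ?_⟩
    · obtain ⟨C, hC⟩ := (Set.finite_range (present j)).isBounded.exists_norm_le
      exact (hG t j).bdd_mul ((measurable_of_finite (present j)).comp
        (by fun_prop)).aestronglyMeasurable (ae_of_all _ fun ω => hC _ ⟨_, rfl⟩)
    · rw [Finset.mul_sum]
      refine Finset.sum_le_sum fun t _ => le_of_eq ?_
      rw [integral_state_mul ν (c.measurable_crossLogRatio gD gI a t j)
        (c.stateFree_crossLogRatio gD gI a t j), integral_present hp]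
  have hother : ∀ j, SumIntegralLE (extLaw ν N m)
      (fun t ω => -c.crossLogRatio gD gI a t j ω) (-γ j) := by
    refine fun j => ⟨fun t => (hG t j).neg, ?_⟩
    simp only [integral_neg, Finset.sum_neg_distrib]
    exact le_rfl
  obtain ⟨h1, h2⟩ := (SumIntegralLE.sum fun j =>
    ((c.sumIntegralLE_stateCost hK hpow j (by decide : (0 : Fin 3) ≠ 1) 0 (varSum_pos gD gI j)
      (by simp [varSum, add_comm]) (present_nonneg j) (integral_present hp j)).add
    (c.sumIntegralLE_stateCost hK hpow j (by decide : (1 : Fin 3) ≠ 0) 1 (varDirect_pos gD j)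
      (by simp [varDirect, add_comm]) (absent_nonneg j) (integral_absent hp j))).add
    (hown j)).of_eq_neg (c.logRatio_ownAux gD gI a)
  obtain ⟨h1', h2'⟩ := (SumIntegralLE.sum fun j => (hother j).add
    (c.sumIntegralLE_stateCost hK hpow j (by decide : (2 : Fin 3) ≠ 0) 2 (varCond_pos gD gI j)
      (by simpa using (varCond_eq gD gI j).le) (χ := fun _ => 1) (fun _ => zero_le_one)
      (q := 1) (by simp))).of_eq_neg (c.logRatio_otherAux gD gI a)
  have h3 := c.converse_own gD gI a ν h1
  have h3' := c.converse_other gD gI a ν h1'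
  have h4 := mul_le_mul_of_nonneg_left (add_le_add h3' h2') hp0
  have h5 : (∑ j, (p * (N * Real.log (varSum gD gI j))
        + (1 - p) * (N * Real.log (varDirect gD j)) + p * γ j))
      + p * (∑ j, (-γ j + 1 * (N * Real.log (varCond gD gI j))))
      = N * ∑ j, (p * (Real.log (varSum gD gI j) + Real.log (varCond gD gI j))
        + (1 - p) * Real.log (varDirect gD j)) := by
    rw [Finset.mul_sum, Finset.mul_sum, ← Finset.sum_add_distrib]
    exact Finset.sum_congr rfl fun j _ => by ring
  linarith

end Code

/-! ### From the power constraint to bounded inputs -/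

namespace Code

variable (c : Code M N m) (gD gI : Fin M → ℂ) (a : Fin 2)

/-- The code that sends nothing whenever one input would exceed the power of the whole block. -/
def clip : Code M N m where
  enc i t w q j := if ‖c.enc i t w q j‖ ^ 2 ≤ N then c.enc i t w q j else 0
  measurable_enc i t w := measurable_pi_iff.2 fun j => by
    have h := (measurable_pi_apply j).comp (c.measurable_enc i t w)
    exact Measurable.ite (measurableSet_le (h.norm.pow_const 2) measurable_const) h
      measurable_const
  dec := c.dec
  measurable_dec := c.measurable_dec

theorem bounded_clip : c.clip.Bounded (Real.sqrt N) := by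
  intro i t w q j
  simp only [clip]
  split_ifs with h
  · exact Real.le_sqrt_of_sq_le h
  · simp

variable {gD gI} in
theorem clip_output {ω : Outcome M N m} (h : ∀ t i j, ‖c.input gD gI ω t i j‖ ^ 2 ≤ N) (n : ℕ) :
    ∀ t : Fin N, (t : ℕ) < n → ∀ i, c.clip.output gD gI ω t i = c.output gD gI ω t i := by
  induction n with
  | zero => intro t ht; exact absurd ht (Nat.not_lt_zero _)
  | succ n ih =>
    intro t ht i
    have hin : ∀ i j, c.clip.input gD gI ω t i j = c.input gD gI ω t i j := by
      intro i j
      have hpast : (fun r : Fin t => c.clip.output gD gI ω ⟨r, r.2.trans t.2⟩ i)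
          = fun r : Fin t => c.output gD gI ω ⟨r, r.2.trans t.2⟩ i :=
        funext fun r => ih _ (by have := r.2; simp only; omega) i
      have hle := h t i j
      unfold input at hle ⊢
      simp only [clip] at hpast ⊢
      rw [hpast, if_pos hle]
    funext j
    rw [output_eq, output_eq, hin, hin]

variable {gD gI} in
theorem clip_input {ω : Outcome M N m} (h : ∀ t i j, ‖c.input gD gI ω t i j‖ ^ 2 ≤ N)
    (t : Fin N) (i : Fin 2) (j : Fin M) : c.clip.input gD gI ω t i j = c.input gD gI ω t i j := by
  have h1 := c.clip.output_eq gD gI ω t i j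
  have hpast : (fun r : Fin t => c.clip.output gD gI ω ⟨r, r.2.trans t.2⟩ i)
      = fun r : Fin t => c.output gD gI ω ⟨r, r.2.trans t.2⟩ i :=
    funext fun r => c.clip_output h t _ r.2 i
  have hle := h t i j
  unfold input at hle ⊢
  simp only [clip] at hpast ⊢
  rw [hpast, if_pos hle]

variable {gD gI} in
theorem sum_norm_input_sq_le (hN : 0 < N) {ω : Outcome M N m}
    (h : ∀ i j, (1 / (N : ℝ)) * ∑ t, ‖c.input gD gI ω t i j‖ ^ 2 ≤ 1) (i : Fin 2) (j : Fin M) :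
    ∑ t, ‖c.input gD gI ω t i j‖ ^ 2 ≤ N := by
  have h1 := h i j
  have hN' : (0 : ℝ) < N := by exact_mod_cast hN
  rwa [one_div, inv_mul_le_iff₀ hN', mul_one] at h1

variable {gD gI} in
theorem norm_input_sq_le (hN : 0 < N) {ω : Outcome M N m}
    (h : ∀ i j, (1 / (N : ℝ)) * ∑ t, ‖c.input gD gI ω t i j‖ ^ 2 ≤ 1) (t : Fin N) (i : Fin 2)
    (j : Fin M) : ‖c.input gD gI ω t i j‖ ^ 2 ≤ N :=
  (Finset.single_le_sum (f := fun t => ‖c.input gD gI ω t i j‖ ^ 2) (fun _ _ => sq_nonneg _)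
    (Finset.mem_univ t)).trans (c.sum_norm_input_sq_le hN h i j)

variable {ν : Measure (Fin M → Bool)} [IsProbabilityMeasure ν]
  (hN : 0 < N) (hpow : c.PowerConstraint gD gI ν)

include hN hpow

theorem ae_sum_norm_clip_input_sq_le (j : Fin M) : ∀ᵐ ω ∂(extLaw ν N m), ∀ i,
    ∑ t, ‖c.clip.input gD gI (toOutcome a ω) t i j‖ ^ 2 ≤ N := by
  filter_upwards [(measurePreserving_toOutcome a ν).quasiMeasurePreserving.ae hpow] with ω hω i
  simp only [c.clip_input (c.norm_input_sq_le hN hω)]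
  exact c.sum_norm_input_sq_le hN hω i j

variable [∀ i, NeZero (m i)]

theorem measureReal_compl_correct_clip_le (i : Fin 2) :
    (extLaw ν N m).real (c.clip.correct gD gI a i)ᶜ ≤ c.errorProb gD gI ν i := by
  have hmp := measurePreserving_toOutcome (m := m) (N := N) a ν
  have hprob : IsProbabilityMeasure (law ν N m) := by
    rw [← hmp.map_eq]
    exact Measure.isProbabilityMeasure_map hmp.measurable.aemeasurable
  refine ENNReal.toReal_mono (measure_ne_top _ _) ?_
  calc extLaw ν N m (c.clip.correct gD gI a i)ᶜ
      ≤ extLaw ν N m (toOutcome a ⁻¹'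
          {ω | c.dec i (fun t => c.output gD gI ω t i, ω.2.1) ≠ ω.1 i}) := by
        refine measure_mono_ae ?_
        filter_upwards [hmp.quasiMeasurePreserving.ae hpow] with ω hω hmem heq
        refine hmem ?_
        have hout : (fun t => c.clip.output gD gI (toOutcome a ω) t i)
            = fun t => c.output gD gI (toOutcome a ω) t i :=
          funext fun t => c.clip_output (c.norm_input_sq_le hN hω) N t t.2 i
        change c.dec i (fun t => c.clip.output gD gI (toOutcome a ω) t i, ω.2.1) = ω.1 i
        rw [hout]
        exact heq
    -- Only this direction is needed, and it holds without measurability of the error event.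
    _ ≤ Measure.map (toOutcome a) (extLaw ν N m) _ :=
        Measure.le_map_apply hmp.measurable.aemeasurable _
    _ = _ := by rw [hmp.map_eq]

theorem one_sub_errorProb_le (i : Fin 2) :
    1 - c.errorProb gD gI ν i ≤ (extLaw ν N m).real (c.clip.correct gD gI a i) := by
  have h1 := c.measureReal_compl_correct_clip_le gD gI a hN hpow i
  have h2 := measureReal_union_le (μ := extLaw ν N m) (c.clip.correct gD gI a i)
    (c.clip.correct gD gI a i)ᶜ
  rw [Set.union_compl_self, probReal_univ] at h2
  linarith

theorem one_sub_errorProb_add_le :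
    1 - (c.errorProb gD gI ν a + c.errorProb gD gI ν (other a)) ≤ (extLaw ν N m).real
      (c.clip.correct gD gI a a ∩ c.clip.correct gD gI a (other a)) := by
  have h1 := c.measureReal_compl_correct_clip_le gD gI a hN hpow a
  have h1' := c.measureReal_compl_correct_clip_le gD gI a hN hpow (other a)
  have h2 := measureReal_union_le (μ := extLaw ν N m)
    (c.clip.correct gD gI a a ∩ c.clip.correct gD gI a (other a))
    (c.clip.correct gD gI a a ∩ c.clip.correct gD gI a (other a))ᶜ
  rw [Set.union_compl_self, probReal_univ, Set.compl_inter] at h2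
  have h3 := measureReal_union_le (μ := extLaw ν N m) (c.clip.correct gD gI a a)ᶜ
    (c.clip.correct gD gI a (other a))ᶜ
  linarith

variable {b : ℝ} (hb : 1 < b) {p : ℝ} (hp : HasMarginals ν p)

include hb hp

theorem one_sub_errorProb_mul_logb_le :
    (1 - c.errorProb gD gI ν a) * Real.logb b (m a) ≤ (Real.log b)⁻¹ + N * ∑ j,
      (p * (Real.logb b (varCond gD gI j) + Real.logb b (varCross gI j))
        + (1 - p) * Real.logb b (varDirect gD j)) := by
  have hlb := inv_nonneg.2 (Real.log_pos hb).le
  have h1 := c.clip.measureReal_correct_mul_log_le c.bounded_clip hp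
    (c.ae_sum_norm_clip_input_sq_le gD gI a hN hpow)
  have h2 := mul_le_mul_of_nonneg_right (c.one_sub_errorProb_le gD gI a hN hpow a)
    (Real.log_natCast_nonneg (m a))
  have h3 := mul_le_mul_of_nonneg_right (h2.trans h1) hlb
  simp only [Real.logb, div_eq_mul_inv]
  refine (le_of_eq (by ring)).trans (h3.trans (le_of_eq ?_))
  rw [add_mul, one_mul, mul_assoc, Finset.sum_mul]
  congr 2
  exact Finset.sum_congr rfl fun j _ => by ring

theorem weighted_mul_logb_le (hp0 : 0 ≤ p) :
    (1 - c.errorProb gD gI ν a) * Real.logb b (m a)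
      + p * ((1 - c.errorProb gD gI ν (other a)) * Real.logb b (m (other a)))
      ≤ (1 + p) * (Real.log b)⁻¹ + N * ∑ j,
        (p * (Real.logb b (varSum gD gI j) + Real.logb b (varCond gD gI j))
          + (1 - p) * Real.logb b (varDirect gD j)) := by
  have hlb := inv_nonneg.2 (Real.log_pos hb).le
  have h1 := c.clip.measureReal_correct_weighted_le c.bounded_clip hp
    (c.ae_sum_norm_clip_input_sq_le gD gI a hN hpow) hp0
  have h2 := fun i => mul_le_mul_of_nonneg_right (c.one_sub_errorProb_le gD gI a hN hpow i)
    (Real.log_natCast_nonneg (m i))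
  have h3 := mul_le_mul_of_nonneg_right
    ((add_le_add (h2 a) (mul_le_mul_of_nonneg_left (h2 (other a)) hp0)).trans h1) hlb
  simp only [Real.logb, div_eq_mul_inv]
  refine (le_of_eq (by ring)).trans (h3.trans (le_of_eq ?_))
  rw [add_mul, mul_assoc, Finset.sum_mul]
  congr 2
  exact Finset.sum_congr rfl fun j _ => by ring

theorem one_sub_errorProb_add_mul_logb_le :
    (1 - (c.errorProb gD gI ν a + c.errorProb gD gI ν (other a)))
        * (Real.logb b (m a) + Real.logb b (m (other a)))
      ≤ (Real.log b)⁻¹ + N * ∑ j,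
        (p * (Real.logb b (varSum gD gI j) + Real.logb b (varCond gD gI j))
          + 2 * ((1 - p) * Real.logb b (varDirect gD j))) := by
  have hlb := inv_nonneg.2 (Real.log_pos hb).le
  have h1 := c.clip.measureReal_correct_inter_mul_log_le c.bounded_clip hp
    (c.ae_sum_norm_clip_input_sq_le gD gI a hN hpow)
  rw [Real.log_mul (by exact_mod_cast NeZero.ne (m a)) (by exact_mod_cast NeZero.ne _)] at h1
  have h2 := mul_le_mul_of_nonneg_right (c.one_sub_errorProb_add_le gD gI a hN hpow)
    (add_nonneg (Real.log_natCast_nonneg (m a)) (Real.log_natCast_nonneg (m (other a))))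
  have h3 := mul_le_mul_of_nonneg_right (h2.trans h1) hlb
  simp only [Real.logb, div_eq_mul_inv]
  refine (le_of_eq (by ring)).trans (h3.trans (le_of_eq ?_))
  rw [add_mul, one_mul, mul_assoc, Finset.sum_mul]
  congr 2
  exact Finset.sum_congr rfl fun j _ => by ring

end Code

/-! ### Passage to the limit -/

section Limits

/-- The lower limit of the sequence is at least `r`. -/
def EventuallyGE (x : ℕ → ℝ) (r : ℝ) : Prop := ∀ ε > 0, ∀ᶠ n in atTop, r - ε ≤ x n

theorem EventuallyGE.add {x y : ℕ → ℝ} {r s : ℝ} (hx : EventuallyGE x r) (hy : EventuallyGE y s) :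
    EventuallyGE (fun n => x n + y n) (r + s) := by
  intro ε hε
  filter_upwards [hx (ε / 2) (by positivity), hy (ε / 2) (by positivity)] with n h1 h2
  linarith

theorem EventuallyGE.const_mul {x : ℕ → ℝ} {r q : ℝ} (hx : EventuallyGE x r) (hq : 0 ≤ q) :
    EventuallyGE (fun n => q * x n) (q * r) := by
  intro ε hε
  filter_upwards [hx (ε / (q + 1)) (by positivity)] with n h
  have h1 := mul_le_mul_of_nonneg_left h hq
  have h2 : q * (ε / (q + 1)) ≤ ε := by
    rw [← mul_div_assoc, div_le_iff₀ (by positivity)]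
    nlinarith
  linarith

theorem EventuallyGE.mul_tendsto_one {x d : ℕ → ℝ} {r : ℝ} (hx : EventuallyGE x r)
    (hd : Tendsto d atTop (𝓝 1)) : EventuallyGE (fun n => d n * x n) r := by
  intro ε hε
  -- Half of `ε` pays for the factor `d n`; the limit argument works for either sign of `r`.
  have h1 : Tendsto (fun n => d n * (r - ε / 2)) atTop (𝓝 (1 * (r - ε / 2))) := hd.mul_const _
  filter_upwards [hx (ε / 2) (by positivity), hd.eventually_const_lt zero_lt_one,
    h1.eventually_const_lt (show r - ε < 1 * (r - ε / 2) by linarith)] with n h2 h3 h4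
  exact h4.le.trans (mul_le_mul_of_nonneg_left h2 h3.le)

theorem EventuallyGE.le_of_le {x y : ℕ → ℝ} {r s : ℝ} (hx : EventuallyGE x r)
    (hxy : ∀ᶠ n in atTop, x n ≤ y n) (hy : Tendsto y atTop (𝓝 s)) : r ≤ s := by
  refine le_of_forall_pos_le_add fun ε hε => ?_
  have h : r - ε ≤ s := ge_of_tendsto hy <| by
    filter_upwards [hx ε hε, hxy] with n h1 h2 using h1.trans h2
  linarith

theorem tendsto_div_natCast_add (C B : ℝ) : Tendsto (fun n : ℕ => C / n + B) atTop (𝓝 B) := by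
  simpa using (tendsto_const_div_atTop_nhds_zero_nat C).add_const B

theorem eventuallyGE_rate {b : ℝ} (hb : 1 < b) {μ : ℕ → ℕ} (hμ : ∀ n, 0 < μ n) {r : ℝ}
    (h : ∀ ε > (0 : ℝ), ∀ᶠ n : ℕ in atTop, b ^ ((n : ℝ) * (r - ε)) ≤ (μ n : ℝ)) :
    EventuallyGE (fun n => Real.logb b (μ n) / n) r := by
  intro ε hε
  filter_upwards [h ε hε, eventually_gt_atTop 0] with n h1 hn
  have hn' : (0 : ℝ) < n := by exact_mod_cast hn
  rw [le_div_iff₀ hn', mul_comm]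
  exact (Real.le_logb_iff_rpow_le hb (by exact_mod_cast hμ n)).2 h1

end Limits

end BurstyIC

end

/-! ### The outer bound -/

theorem theorem2 (b : ℝ) (hb : 1 < b) (M : ℕ) (hM : 0 < M) (gD gI : Fin M → ℂ)
    (ν : MeasureTheory.Measure (Fin M → Bool)) [MeasureTheory.IsProbabilityMeasure ν]
    (p : ℝ) (hp : BurstyIC.HasMarginals ν p)
    (R : Fin 2 → ℝ) (hR : BurstyIC.Achievable b gD gI ν R) :
    (∀ i, R i ≤ ∑ j, ((1 - p) * Real.logb b (1 + ‖gD j‖ ^ 2)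
        + p * Real.logb b (1 + ‖gD j‖ ^ 2 + ‖gI j‖ ^ 2))) ∧
    (∀ i i', i ≠ i' → R i + p * R i' ≤
        p * BurstyIC.deltaG b gD gI + (1 + p) * ∑ j, Real.logb b (1 + ‖gD j‖ ^ 2)) ∧
    (∀ i i', i ≠ i' → R i + R i' ≤
        p * BurstyIC.deltaG b gD gI + 2 * ∑ j, Real.logb b (1 + ‖gD j‖ ^ 2)) := by
  open BurstyIC Filter Topology in
  obtain ⟨m, c, hpow, hrate, herr⟩ := hR
  -- A decoder is a total function, so its value at any input shows that the message set is
  -- nonempty.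
  have hm : ∀ N i, NeZero (m N i) := fun N i =>
    ⟨(Fin.pos ((c N).dec i (fun _ _ => 0, fun _ _ => false))).ne'⟩
  -- The sign of `p` is read off an actual subcarrier, whence the need for `0 < M`.
  have hp0 : 0 ≤ p := hp ⟨0, hM⟩ ▸ MeasureTheory.measureReal_nonneg
  have hge : ∀ i, EventuallyGE (fun N => Real.logb b (m N i) / N) (R i) := fun i =>
    eventuallyGE_rate hb (fun N => (hm N i).pos) (hrate i)
  have hone : ∀ i, Tendsto (fun N => 1 - (c N).errorProb gD gI ν i) atTop (𝓝 1) := fun i => by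
    simpa using (herr i).const_sub 1
  have hΔ : deltaG b gD gI = ∑ j, (Real.logb b (varSum gD gI j) + Real.logb b (varCond gD gI j)
      - 2 * Real.logb b (varDirect gD j)) := rfl
  refine ⟨fun i => ?_, fun i i' hne => ?_, fun i i' hne => ?_⟩
  · refine ((hge i).mul_tendsto_one (hone i)).le_of_le ?_
      (tendsto_div_natCast_add (Real.log b)⁻¹ _)
    filter_upwards [eventually_gt_atTop 0] with N hN
    have hN' : (0 : ℝ) < N := by exact_mod_cast hN
    have h := (c N).one_sub_errorProb_mul_logb_le gD gI i hN (hpow N) hb hp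
    rw [mul_div_assoc', div_add' _ _ _ hN'.ne']
    refine div_le_div_of_nonneg_right (h.trans (le_of_eq ?_)) hN'.le
    rw [mul_comm (N : ℝ)]
    congr 2
    refine Finset.sum_congr rfl fun j _ => ?_
    -- The two costs combine into the determinant of the covariance of the two outputs given the
    -- other input.
    have hmul : varCond gD gI j * varCross gI j = 1 + ‖gD j‖ ^ 2 + ‖gI j‖ ^ 2 := by
      unfold varCond varCross
      field_simp
      ring
    rw [← Real.logb_mul (varCond_pos gD gI j).ne' (varCross_pos gI j).ne', hmul, add_comm]
    rfl
  · obtain rfl := eq_other_of_ne hne.symm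
    refine (((hge i).mul_tendsto_one (hone i)).add
      (((hge (other i)).mul_tendsto_one (hone (other i))).const_mul hp0)).le_of_le ?_
      (tendsto_div_natCast_add ((1 + p) * (Real.log b)⁻¹) _)
    filter_upwards [eventually_gt_atTop 0] with N hN
    have hN' : (0 : ℝ) < N := by exact_mod_cast hN
    have h := (c N).weighted_mul_logb_le gD gI i hN (hpow N) hb hp hp0
    rw [mul_div_assoc', mul_div_assoc', mul_div_assoc', ← add_div, div_add' _ _ _ hN'.ne']
    refine div_le_div_of_nonneg_right (h.trans (le_of_eq ?_)) hN'.le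
    rw [mul_comm (N : ℝ), hΔ, Finset.mul_sum, Finset.mul_sum, ← Finset.sum_add_distrib]
    congr 2
    refine Finset.sum_congr rfl fun j _ => ?_
    unfold varDirect
    ring
  · obtain rfl := eq_other_of_ne hne.symm
    have hone' : Tendsto (fun N => 1 - ((c N).errorProb gD gI ν i
        + (c N).errorProb gD gI ν (other i))) atTop (𝓝 1) := by
      simpa using ((herr i).add (herr (other i))).const_sub 1
    refine (((hge i).add (hge (other i))).mul_tendsto_one hone').le_of_le ?_
      (tendsto_div_natCast_add (Real.log b)⁻¹ _)
    filter_upwards [eventually_gt_atTop 0] with N hN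
    have hN' : (0 : ℝ) < N := by exact_mod_cast hN
    have h := (c N).one_sub_errorProb_add_mul_logb_le gD gI i hN (hpow N) hb hp
    rw [← add_div, mul_div_assoc', div_add' _ _ _ hN'.ne']
    refine div_le_div_of_nonneg_right (h.trans (le_of_eq ?_)) hN'.le
    rw [mul_comm (N : ℝ), hΔ, Finset.mul_sum, Finset.mul_sum, ← Finset.sum_add_distrib]
    congr 2
    refine Finset.sum_congr rfl fun j _ => ?_
    unfold varDirect
    ring
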